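/- Let $(X,\omega)$ be a compact Kähler manifold of complex dimension $n$, let $E$ be a holomorphic vector bundle of rank $r$ on $X$, and let $h_0$ be a smooth Hermitian metric on $E$ with Chern connection $D=D'+\bar\partial$ and curvature $\Theta_0$ (normalized by $\Theta_0=\sqrt{-1}\,\bar\partial(H^{-1}\partial H)$, where $H$ is the Gram matrix of $h_0$ in a local holomorphic frame). For $p\ge 1$ let $\mathcal H^{1,p}$ be the space of $h_0$-self-adjoint trace-free endomorphisms $w$ of $E$ with coefficients in the Sobolev space $W^{1,p}$, where $\|w\|_{L^p}^p=\int_X \mathrm{tr}(ww^*)^{p/2}\,\omega^n$ (with $\|w\|_{L^\infty}$ the essential supremum of $\mathrm{tr}(ww^*)^{1/2}$) and $\|w\|_{W^{1,p}}=\|w\|_{L^p}+\|Dw\|_{L^p}$, with $Dw$ the weak covariant derivative. For $w\in\mathcal H^{1,1}$ and almost every $z\in X$, choose a unitary basis of $E_z$ that diagonalizes $w(z)$, with eigenvalues $\lambda_1,\dots,\lambda_r$, let $(\eta_{ij})$ be the matrix of $(\bar\partial w)(z)$ in it, and set $$f_w(z)=\sum_{i,j=1}^r|\eta_{ij}|^2\,\frac{e^{\lambda_i-\lambda_j}-(\lambda_i-\lambda_j)-1}{(\lambda_i-\lambda_j)^2},$$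 where $\frac{e^x-x-1}{x^2}$ means $\frac12$ at $x=0$, and $|\cdot|$ is the norm on $(0,1)$-forms given by the Hermitian metric $(g_{k\bar l})$ with $\omega=\sqrt{-1}\sum g_{k\bar l}\,dz_k\wedge d\bar z_l$. Put $$\mathcal M(w)=\int_X f_w\,\omega^n+\int_X\mathrm{tr}(\Theta_0w)\wedge\omega^{n-1}$$ if $f_w\in L^1(X)$, and $\mathcal M(w)=+\infty$ otherwise. Let $\mathcal S=\{w\in\mathcal H^{1,1}:\mathcal M(w)<\infty\}$ and $p_{\max}=\frac{2n}{2n-1}$. **Proposition.** There are constants $C_1,C_2>0$, depending only on $(X,\omega)$ and $(E,h_0)$, such that for every $1<p\le p_{\max}$ and every $w\in\mathcal H^{1,p}$ $$\|w\|_{W^{1,p}}\le C_1\,\mathcal M(w)+C_2\bigl(\|w\|_{L^{p^*}}+1\bigr),\qquad p^*=\frac{p}{2-p}$$ (with $p^*=\infty$ if $p=2$, which occurs only for $n=1$). In particular, if $n\ge2$, then $\mathcal S\subset\mathcal H^{1,p_{\max}}$; and if $n=1$, then $\mathcal S\subset\mathcal H^{1,p}$ for every $1<p<2$. -/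

import Mathlib

open scoped Manifold ContDiff ENNReal ComplexConjugate
open MeasureTheory Bundle

noncomputable section

namespace HermBundle

/-! ### Wirtinger derivatives on `ℂⁿ` -/

/-- The value `∂f(v) = ∑ₖ vₖ ∂f/∂zₖ` of the `(1,0)`-part of the real differential of `f`. -/
def dHol {n : ℕ} (f : (Fin n → ℂ) → ℂ) (y v : Fin n → ℂ) : ℂ :=
  (fderiv ℝ f y v - Complex.I * fderiv ℝ f y (Complex.I • v)) / 2

/-- The value `∂̄f(v) = ∑ₖ conj vₖ ∂f/∂z̄ₖ` of the `(0,1)`-part of the real differential of `f`. -/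
def dBar {n : ℕ} (f : (Fin n → ℂ) → ℂ) (y v : Fin n → ℂ) : ℂ :=
  (fderiv ℝ f y v + Complex.I * fderiv ℝ f y (Complex.I • v)) / 2

/-! ### Local frames of a holomorphic vector bundle

`X` is a complex manifold modelled on `ℂⁿ`, and `E` a complex vector bundle of rank `r` on `X`.
For every `a : X`, the preferred chart at `a` and the preferred trivialization at `a` provide
holomorphic coordinates and a holomorphic frame near `a`; these cover `X`. -/

section Local

variable (n r : ℕ) {X : Type*} [TopologicalSpace X] [ChartedSpace (Fin n → ℂ) X]
  {E : X → Type*} [∀ x, AddCommGroup (E x)] [∀ x, Module ℂ (E x)] [∀ x, TopologicalSpace (E x)]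
  [TopologicalSpace (TotalSpace (Fin r → ℂ) E)] [FiberBundle (Fin r → ℂ) E]
  [VectorBundle ℂ (Fin r → ℂ) E]

variable (E) in
/-- The open part of `ℂⁿ` on which the coordinates and the frame attached to `a` both exist. -/
def localDomain (a : X) : Set (Fin n → ℂ) :=
  (chartAt (Fin n → ℂ) a).target ∩
    (chartAt (Fin n → ℂ) a).symm ⁻¹' (trivializationAt (Fin r → ℂ) E a).baseSet

variable (E) in
/-- The vector at `x` with constant coordinates `c` in the holomorphic frame attached to `a`. -/
def localVector (a x : X) (c : Fin r → ℂ) : E x :=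
  (trivializationAt (Fin r → ℂ) E a).symmₗ ℂ x c

/-- The coordinates of `u : E x` in the holomorphic frame attached to `a`. -/
def localCoord (a x : X) (u : E x) : Fin r → ℂ :=
  (trivializationAt (Fin r → ℂ) E a).linearMapAt ℂ x u

/-- The matrix of an endomorphism of `E x` in the holomorphic frame attached to `a`. -/
def localMatrix (a x : X) (T : E x →ₗ[ℂ] E x) : Matrix (Fin r) (Fin r) ℂ :=
  LinearMap.toMatrix' ((trivializationAt (Fin r → ℂ) E a).linearMapAt ℂ x ∘ₗ T ∘ₗ
    (trivializationAt (Fin r → ℂ) E a).symmₗ ℂ x)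

end Local

variable {n r : ℕ} {X : Type*} [TopologicalSpace X] [ChartedSpace (Fin n → ℂ) X]
  {E : X → Type*} [∀ x, AddCommGroup (E x)] [∀ x, Module ℂ (E x)] [∀ x, TopologicalSpace (E x)]
  [TopologicalSpace (TotalSpace (Fin r → ℂ) E)] [FiberBundle (Fin r → ℂ) E]
  [VectorBundle ℂ (Fin r → ℂ) E]

/-- The holomorphic tangent bundle of `X`, whose fibre is the tangent space with its complex
structure. -/
abbrev HolTangent (n : ℕ) (X : Type*) [TopologicalSpace X] [ChartedSpace (Fin n → ℂ) X] :
    X → Type :=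
  TangentSpace 𝓘(ℂ, Fin n → ℂ)

/-! ### Hermitian metrics, Chern connection, curvature -/

variable (n r E) in
/-- A smooth Hermitian metric on `E`, conjugate linear in the first variable. -/
structure HermitianMetric where
  /-- The Hermitian product on the fibres. -/
  form : ∀ x, E x →ₗ⋆[ℂ] E x →ₗ[ℂ] ℂ
  conj_symm : ∀ x u v, conj (form x u v) = form x v u
  pos : ∀ x u, u ≠ 0 → 0 < (form x u u).re
  smooth : ∀ (a : X) (i j : Fin r), ContDiffOn ℝ ∞
    (fun y : Fin n → ℂ => form ((chartAt (Fin n → ℂ) a).symm y)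
      (localVector r E a ((chartAt (Fin n → ℂ) a).symm y) (Pi.single i 1))
      (localVector r E a ((chartAt (Fin n → ℂ) a).symm y) (Pi.single j 1)))
    (localDomain n r E a)

/-- The Gram matrix `H i j = ⟨eᵢ, eⱼ⟩` of the frame `(eᵢ)` attached to `a`, in the coordinates
attached to `a`. -/
def HermitianMetric.gram (h : HermitianMetric n r E) (a : X) (y : Fin n → ℂ) :
    Matrix (Fin r) (Fin r) ℂ :=
  Matrix.of fun i j => h.form ((chartAt (Fin n → ℂ) a).symm y)
    (localVector r E a ((chartAt (Fin n → ℂ) a).symm y) (Pi.single i 1))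
    (localVector r E a ((chartAt (Fin n → ℂ) a).symm y) (Pi.single j 1))

/-- The connection matrix `A = H⁻¹ ∂H` of the Chern connection of `h`, evaluated on `v`. -/
def HermitianMetric.connection (h : HermitianMetric n r E) (a : X) (y v : Fin n → ℂ) :
    Matrix (Fin r) (Fin r) ℂ :=
  (h.gram a y)⁻¹ * Matrix.of fun i j => dHol (fun z => h.gram a z i j) y v

/-- The coefficients of the curvature `∂̄A` of the Chern connection:
`∂̄A = ∑ₖₗ (∂A(∂ₖ)/∂z̄ₗ) dz̄ₗ ∧ dzₖ`, and the value here at `u`, `v` is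
`∑ₖₗ uₖ conj vₗ ∂A(∂ₖ)/∂z̄ₗ`. -/
def HermitianMetric.curvature (h : HermitianMetric n r E) (a : X) (y u v : Fin n → ℂ) :
    Matrix (Fin r) (Fin r) ℂ :=
  Matrix.of fun i j => dBar (fun z => h.connection a z u i j) y v

/-- A family of `r` vectors of `E x` is unitary. -/
def HermitianMetric.IsUnitary (h : HermitianMetric n r E) (x : X) (e : Fin r → E x) : Prop :=
  ∀ i j, h.form x (e i) (e j) = if i = j then 1 else 0

theorem HermitianMetric.exists_isUnitary (h : HermitianMetric n r E) (x : X) :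
    ∃ e : Fin r → E x, h.IsUnitary x e := by
  let L : E x ≃ₗ[ℂ] (Fin r → ℂ) :=
    ((trivializationAt (Fin r → ℂ) E x).continuousLinearEquivAt ℂ x
      (FiberBundle.mem_baseSet_trivializationAt' x)).toLinearEquiv
  have : FiniteDimensional ℂ (E x) := LinearEquiv.finiteDimensional L.symm
  have hr : Module.finrank ℂ (E x) = r := by rw [L.finrank_eq]; simp
  let c : InnerProductSpace.Core ℂ (E x) :=
    { inner := fun u v => h.form x u v
      conj_inner_symm := fun u v => h.conj_symm x v u
      re_inner_nonneg := fun u => by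
        by_cases hu : u = 0
        · simp [hu]
        · exact (h.pos x u hu).le
      add_left := fun u v w => by simp
      smul_left := fun u v t => by simp
      definite := fun u hu => by
        by_contra hne
        have := h.pos x u hne
        rw [hu] at this
        simp at this }
  let _ : NormedAddCommGroup (E x) := @InnerProductSpace.Core.toNormedAddCommGroup ℂ (E x) _ _ _ c
  let _ : InnerProductSpace ℂ (E x) := InnerProductSpace.ofCore c.toCore
  let b := (stdOrthonormalBasis ℂ (E x)).reindex (finCongr hr)
  refine ⟨fun i => b i, fun i j => ?_⟩
  exact (orthonormal_iff_ite.1 b.orthonormal) i j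

/-- A chosen unitary basis of `E x`. -/
def HermitianMetric.unitaryFrame (h : HermitianMetric n r E) (x : X) : Fin r → E x :=
  (h.exists_isUnitary x).choose

/-! ### The Kähler metric and its volume -/

section Kahler

variable [IsManifold 𝓘(ℂ, Fin n → ℂ) ω X]

/-- The Hermitian metric `g` on `X` is Kähler: its fundamental form
`ω = √-1 ∑ₖₗ g(∂ₗ, ∂ₖ) dzₖ ∧ dz̄ₗ` (`g` being linear in the second variable) is closed. As `ω` is a
real form, this says that `∂ω = 0`. -/
def IsKahler (g : HermitianMetric n n (HolTangent n X)) : Prop :=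
  ∀ (a : X), ∀ y ∈ (chartAt (Fin n → ℂ) a).target, ∀ k l m : Fin n,
    dHol (fun z => g.gram a z l k) y (Pi.single m 1) =
      dHol (fun z => g.gram a z l m) y (Pi.single k 1)

variable [MeasurableSpace X]

/-- The measure given by the restriction of `ωⁿ` to the domain of the chart at `a`. In coordinates
`ωⁿ = n! det(g) ∏ₖ (√-1 dzₖ ∧ dz̄ₖ) = n! 2ⁿ det(g)` times Lebesgue measure. -/
def chartVolume (g : HermitianMetric n n (HolTangent n X)) (a : X) : Measure X :=
  ((volume.withDensity fun y : Fin n → ℂ =>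
      ENNReal.ofReal ((n.factorial : ℝ) * 2 ^ n * (g.gram a y).det.re)).restrict
    (chartAt (Fin n → ℂ) a).target).map (chartAt (Fin n → ℂ) a).symm

/-- The measure `ωⁿ` on `X`. The measures `chartVolume g a` agree on overlaps of chart domains, and
their supremum is the measure that restricts to each of them. -/
def kahlerVolume (g : HermitianMetric n n (HolTangent n X)) : Measure X :=
  ⨆ a : X, chartVolume g a

end Kahler

/-! ### Endomorphisms of `E` and their weak covariant derivatives -/

variable (E) in
/-- Sections (without any regularity) of the bundle `End E`. -/
abbrev EndSection : Type _ := ∀ x, E x →ₗ[ℂ] E x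

variable (n E) in
/-- One-forms (without any regularity) with values in `End E`, decomposed by type. -/
@[ext]
structure EndForm where
  /-- The `(1,0)`-part. -/
  hol : ∀ x : X, HolTangent n X x →ₗ[ℂ] (E x →ₗ[ℂ] E x)
  /-- The `(0,1)`-part. -/
  anti : ∀ x : X, HolTangent n X x →ₗ⋆[ℂ] (E x →ₗ[ℂ] E x)

/-- The norm `tr (T T*) ^ (1/2)` of an endomorphism of `E x`. -/
def endNorm (h : HermitianMetric n r E) (x : X) (T : E x →ₗ[ℂ] E x) : ℝ :=
  √(∑ i, ∑ j, ‖h.form x (h.unitaryFrame x i) (T (h.unitaryFrame x j))‖ ^ 2)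

section Sobolev

variable [IsManifold 𝓘(ℂ, Fin n → ℂ) ω X]

/-- The pointwise norm of an `End E`-valued one-form, for the metrics `g` on `X` and `h` on `E`. -/
def formNorm (g : HermitianMetric n n (HolTangent n X)) (h : HermitianMetric n r E)
    (D : EndForm n E) (x : X) : ℝ :=
  √(∑ k, (endNorm h x (D.hol x (g.unitaryFrame x k)) ^ 2 +
    endNorm h x (D.anti x (g.unitaryFrame x k)) ^ 2))

/-- `D` is the weak covariant derivative of `w` for the Chern connection of `h`. In the holomorphic
coordinates and frame attached to `a`, if `W` is the matrix of `w` and `A` is the connection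
matrix, this means that `D' = ∂W + [A, W]` and `D'' = ∂̄W` in the sense of distributions, all
coefficients being locally integrable. -/
def IsWeakDerivative (h : HermitianMetric n r E) (w : EndSection E) (D : EndForm n E) : Prop :=
  ∀ a : X,
    let s : (Fin n → ℂ) → X := (chartAt (Fin n → ℂ) a).symm
    let W : (Fin n → ℂ) → Matrix (Fin r) (Fin r) ℂ := fun y => localMatrix r a (s y) (w (s y))
    let t : (v : Fin n → ℂ) → ∀ y, HolTangent n X (s y) := fun v y =>
      localVector n (HolTangent n X) a (s y) v
    let P : (Fin n → ℂ) → (Fin n → ℂ) → Matrix (Fin r) (Fin r) ℂ := fun v y =>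
      localMatrix r a (s y) (D.hol (s y) (t v y))
    let Q : (Fin n → ℂ) → (Fin n → ℂ) → Matrix (Fin r) (Fin r) ℂ := fun v y =>
      localMatrix r a (s y) (D.anti (s y) (t v y))
    ∀ i j : Fin r,
      LocallyIntegrableOn (fun y => W y i j) (localDomain n r E a) ∧
      ∀ v : Fin n → ℂ,
        LocallyIntegrableOn (fun y => P v y i j) (localDomain n r E a) ∧
        LocallyIntegrableOn (fun y => Q v y i j) (localDomain n r E a) ∧
        ∀ φ : (Fin n → ℂ) → ℂ, ContDiff ℝ ∞ φ → HasCompactSupport φ →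
          tsupport φ ⊆ localDomain n r E a →
          ∫ y, W y i j * dHol φ y v =
            -∫ y, (P v y - (h.connection a y v * W y - W y * h.connection a y v)) i j * φ y ∧
          ∫ y, W y i j * dBar φ y v = -∫ y, Q v y i j * φ y

open Classical in
/-- The weak covariant derivative of `w` for the Chern connection of `h` (unique up to null sets;
zero if there is none). Its `(0,1)`-part is `∂̄w`. -/
def weakDerivative (h : HermitianMetric n r E) (w : EndSection E) : EndForm n E :=
  if hw : ∃ D, IsWeakDerivative h w D then hw.choose else ⟨fun _ => 0, fun _ => 0⟩

variable [MeasurableSpace X]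

/-- The space `H^{1,p}` of `h`-self-adjoint trace-free endomorphisms of `E` with coefficients in the
Sobolev space `W^{1,p}`. -/
def sobolevSpace (g : HermitianMetric n n (HolTangent n X)) (h : HermitianMetric n r E)
    (p : ℝ≥0∞) : Set (EndSection E) :=
  {w | (∀ᵐ x ∂kahlerVolume g, ∀ u v, h.form x (w x u) v = h.form x u (w x v)) ∧
    (∀ᵐ x ∂kahlerVolume g, LinearMap.trace ℂ (E x) (w x) = 0) ∧
    (∃ D, IsWeakDerivative h w D) ∧
    MemLp (fun x => endNorm h x (w x)) p (kahlerVolume g) ∧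
    MemLp (formNorm g h (weakDerivative h w)) p (kahlerVolume g)}

/-- The norm of `w` in `L^q` with respect to the measure `ωⁿ`. -/
def lpNorm (g : HermitianMetric n n (HolTangent n X)) (h : HermitianMetric n r E)
    (q : ℝ≥0∞) (w : EndSection E) : ℝ≥0∞ :=
  eLpNorm (fun x => endNorm h x (w x)) q (kahlerVolume g)

/-- The norm of `w` in `W^{1,p}`. -/
def sobolevNorm (g : HermitianMetric n n (HolTangent n X)) (h : HermitianMetric n r E)
    (p : ℝ≥0∞) (w : EndSection E) : ℝ≥0∞ :=
  lpNorm g h p w + eLpNorm (formNorm g h (weakDerivative h w)) p (kahlerVolume g)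

/-! ### The Donaldson functional -/

/-- The function `(eᵗ - t - 1) / t²`, with value `1/2` at `0`. -/
def phi (t : ℝ) : ℝ := if t = 0 then 1 / 2 else (Real.exp t - t - 1) / t ^ 2

/-- `e` is a unitary basis of `E x` that diagonalizes `T`, with eigenvalues `lam`. -/
def IsEigenframe (h : HermitianMetric n r E) (x : X) (T : E x →ₗ[ℂ] E x)
    (b : (Fin r → E x) × (Fin r → ℝ)) : Prop :=
  h.IsUnitary x b.1 ∧ ∀ i, T (b.1 i) = (b.2 i : ℂ) • b.1 i

open Classical in
/-- The function `f_w = ∑ᵢⱼ |ηᵢⱼ|² (exp(λᵢ - λⱼ) - (λᵢ - λⱼ) - 1) / (λᵢ - λⱼ)²`, where `(ηᵢⱼ)` is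
the matrix of `∂̄w` in a unitary frame that diagonalizes `w` with eigenvalues `(λᵢ)`. The entries of
a block that belongs to a pair of distinct or equal eigenvalues all carry the same factor, so that
the sum over blocks is the sum over pairs of basis vectors. -/
def energyDensity (g : HermitianMetric n n (HolTangent n X)) (h : HermitianMetric n r E)
    (w : EndSection E) (x : X) : ℝ :=
  if hx : ∃ b, IsEigenframe h x (w x) b then
    ∑ i, ∑ j, phi (hx.choose.2 i - hx.choose.2 j) *
      ∑ k, ‖h.form x (hx.choose.1 i)
        ((weakDerivative h w).anti x (g.unitaryFrame x k) (hx.choose.1 j))‖ ^ 2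
  else 0

/-- The function `tr(Θ w) ∧ ωⁿ⁻¹ / ωⁿ`, where `Θ = √-1 ∂̄(H⁻¹ ∂H)` is the curvature of `h`. For a
`(1,1)`-form `α = √-1 ∑ₖₗ αₖₗ dzₖ ∧ dz̄ₗ` the quotient `α ∧ ωⁿ⁻¹ / ωⁿ` is `1/n` times the trace of
`(αₖₗ)` in a unitary frame; here `αₖₗ = - tr((∂A(∂ₖ)/∂z̄ₗ) W)`, computed in the coordinates and the
frame attached to `x`. The value is real when `w x` is self-adjoint. -/
def curvatureDensity (g : HermitianMetric n n (HolTangent n X)) (h : HermitianMetric n r E)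
    (w : EndSection E) (x : X) : ℝ :=
  -(1 / (n : ℝ)) * ∑ k,
    (Matrix.trace (h.curvature x (chartAt (Fin n → ℂ) x x)
        (localCoord n x x (g.unitaryFrame x k)) (localCoord n x x (g.unitaryFrame x k)) *
      localMatrix r x x (w x))).re

open Classical in
/-- The Donaldson functional `M(w) = ∫ f_w ωⁿ + ∫ tr(Θ w) ∧ ωⁿ⁻¹` if `f_w` is integrable, and
`M(w) = +∞` otherwise. -/
def donaldson (g : HermitianMetric n n (HolTangent n X)) (h : HermitianMetric n r E)
    (w : EndSection E) : EReal :=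
  if Integrable (energyDensity g h w) (kahlerVolume g) then
    (((∫ x, energyDensity g h w x ∂kahlerVolume g) +
      ∫ x, curvatureDensity g h w x ∂kahlerVolume g : ℝ) : EReal)
  else ⊤

/-- The set `S` of all `w` in `H^{1,1}` with `M(w) < ∞`. -/
def finiteEnergy (g : HermitianMetric n n (HolTangent n X)) (h : HermitianMetric n r E) :
    Set (EndSection E) :=
  {w | w ∈ sobolevSpace g h 1 ∧ donaldson g h w < ⊤}

end Sobolev

end HermBundle

end

set_option linter.unusedSectionVars false

/-! The pointwise heart is the lower bound `phi_ge`: the weight `(eᵗ - t - 1)/t²` is at least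
`1/(4(1+|t|))`, the slowest decay being like `1/|t|` as `t → -∞`. Differences of eigenvalues of `w`
are at most `2|w|`, so `|∂̄w|² ≤ 4(1 + 2|w|) f_w` (`antiNormSq_le_energyDensity`). As `w` is
self-adjoint, `D'w` is the adjoint of `∂̄w` (`IsWeakDerivative.ae_adjoint`), whence `|Dw|² ≤ (8 +
16|w|) f_w` almost everywhere.

For the inequality, take square roots and apply Hölder with exponents `2p*`, `2` and `p`, where `p*
= p/(2-p)`: `‖Dw‖_p` is at most `‖8 + 16|w|‖_{p*} + ‖f_w‖₁` (`eLpNorm_formNorm_le`). The functional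
differs from `‖f_w‖₁` by the curvature integral, which is at most a constant times `‖w‖₁` because
the curvature is smooth and `X` is compact (`exists_abs_curvatureDensity_le`). The other terms are
absorbed by `‖w‖_{p*} + 1` (`exists_sobolevNorm_le`), and `C₁ = 1` works.

For the inclusions it is enough to show `w ∈ L^{p*}`, since the same Hölder estimate then bounds
`Dw` in `L^p`. Finite energy says that `|Dw|²/(1 + |w|)` is integrable. In a chart the function `k =
(1 + |W|²)^{1/4} - 1` satisfies `|dk|² ≤ |dW|²/(1 + |W|)`, so `k` is locally in `W^{1,2}`. The
Sobolev inequality in real dimension `2n` puts `k` in `L^{2n/(n-1)}` when `n ≥ 2`, hence `W`, of the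
size of `k²`, in `L^{n/(n-1)}`, and `n/(n-1)` is exactly `p*` for `p = 2n/(2n-1)`. When `n = 1`,
exponents `s < 2` replace the borderline exponent `2` and every finite `p*` is reached. This is
`HasWeakFDerivOn.eLpNorm_lt_top_of_lintegral`, globalized in `lpNorm_lt_top`.

The rest makes this rigorous for weak derivatives on a manifold. The chain rule and the Sobolev
inequality pass to weak derivatives by mollification, `ωⁿ` is compared with Lebesgue measure on
finitely many coordinate balls, and the intrinsic norms are compared with those of matrices in
holomorphic frames. -/

namespace WeakDeriv

/-! ### Mollification and weak derivatives on a vector space -/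

open Filter Topology ContinuousLinearMap
open scoped Convolution NNReal

variable {V : Type*} [NormedAddCommGroup V] [NormedSpace ℝ V] [FiniteDimensional ℝ V]
  [MeasurableSpace V] [BorelSpace V] {μ : Measure V} [μ.IsAddHaarMeasure]
  {F : Type*} [NormedAddCommGroup F] [NormedSpace ℝ F] [CompleteSpace F]

/-- Convolution with a normalized bump function does not increase the `L^p` norm. -/
theorem eLpNorm_normed_convolution_le (ρ : ContDiffBump (0 : V)) {f : V → F}
    (hf : Integrable f μ) {p : ℝ≥0} (hp : 1 ≤ p) :
    eLpNorm (ρ.normed μ ⋆[lsmul ℝ ℝ, μ] f) p μ ≤ eLpNorm f p μ := by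
  have hp0 : p ≠ 0 := (zero_lt_one.trans_le hp).ne'
  set d : V → ℝ≥0∞ := fun t => ENNReal.ofReal (ρ.normed μ t) with hd
  have hdm : Measurable d := (ρ.continuous_normed (μ := μ)).measurable.ennreal_ofReal
  set ν := μ.withDensity d with hν
  have hdint : ∫⁻ t, d t ∂μ = 1 := by
    rw [hd, ← ofReal_integral_eq_lintegral_ofReal ρ.integrable_normed
      (Eventually.of_forall ρ.nonneg_normed), ρ.integral_normed, ENNReal.ofReal_one]
  have : IsProbabilityMeasure ν := ⟨by simp [hν, hdint]⟩
  have hfm := hf.aestronglyMeasurable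
  have hsub : ∀ x, AEStronglyMeasurable (fun t => f (x - t)) μ := fun x =>
    hfm.comp_quasiMeasurePreserving (quasiMeasurePreserving_sub_left_of_right_invariant μ x)
  have key : ∀ x, ‖(ρ.normed μ ⋆[lsmul ℝ ℝ, μ] f) x‖ₑ ^ (p : ℝ) ≤
      ∫⁻ t, d t * ‖f (x - t)‖ₑ ^ (p : ℝ) ∂μ := by
    intro x
    have h1 : ‖(ρ.normed μ ⋆[lsmul ℝ ℝ, μ] f) x‖ₑ ≤ ∫⁻ t, ‖f (x - t)‖ₑ ∂ν := by
      rw [convolution_lsmul]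
      refine (enorm_integral_le_lintegral_enorm _).trans ?_
      rw [hν, lintegral_withDensity_eq_lintegral_mul₀ hdm.aemeasurable (hsub x).enorm]
      refine lintegral_mono fun t => ?_
      simp only [Pi.mul_apply, enorm_smul, hd, Real.enorm_eq_ofReal (ρ.nonneg_normed t), le_refl]
    have hac : ν ≪ μ := withDensity_absolutelyContinuous _ _
    -- Jensen's inequality: the bump times `μ` is the probability measure `ν`, so the `L¹(ν)` norm
    -- of `t ↦ f (x - t)` is at most its `L^p(ν)` norm. Tonelli and translation invariance then
    -- finish the proof.
    have h2 := eLpNorm_le_eLpNorm_of_exponent_le (μ := ν) (p := 1) (q := p)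
      (by exact_mod_cast hp) ((hsub x).mono_ac hac)
    rw [eLpNorm_one_eq_lintegral_enorm, eLpNorm_nnreal_eq_lintegral hp0] at h2
    calc _ ≤ (∫⁻ t, ‖f (x - t)‖ₑ ∂ν) ^ (p : ℝ) := by gcongr
      _ ≤ ((∫⁻ t, ‖f (x - t)‖ₑ ^ (p : ℝ) ∂ν) ^ (1 / (p : ℝ))) ^ (p : ℝ) := by gcongr
      _ = ∫⁻ t, ‖f (x - t)‖ₑ ^ (p : ℝ) ∂ν := by
        rw [← ENNReal.rpow_mul, one_div_mul_cancel (by positivity), ENNReal.rpow_one]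
      _ = _ := by
        rw [hν, lintegral_withDensity_eq_lintegral_mul₀ hdm.aemeasurable
          ((hsub x).enorm.pow_const _)]
        rfl
  rw [eLpNorm_nnreal_eq_lintegral hp0, eLpNorm_nnreal_eq_lintegral hp0]
  refine ENNReal.rpow_le_rpow ?_ (by positivity)
  calc ∫⁻ x, ‖(ρ.normed μ ⋆[lsmul ℝ ℝ, μ] f) x‖ₑ ^ (p : ℝ) ∂μ
      ≤ ∫⁻ x, ∫⁻ t, d t * ‖f (x - t)‖ₑ ^ (p : ℝ) ∂μ ∂μ := lintegral_mono key
    _ = ∫⁻ t, ∫⁻ x, d t * ‖f (x - t)‖ₑ ^ (p : ℝ) ∂μ ∂μ := by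
      refine lintegral_lintegral_swap ?_
      refine (hdm.comp measurable_snd).aemeasurable.mul ?_
      refine AEMeasurable.pow_const ?_ _
      exact (hfm.comp_quasiMeasurePreserving
        (quasiMeasurePreserving_sub_of_right_invariant μ μ)).enorm
    _ = ∫⁻ t, d t * ∫⁻ x, ‖f x‖ₑ ^ (p : ℝ) ∂μ ∂μ := by
      refine lintegral_congr fun t => ?_
      rw [lintegral_const_mul' _ _ ENNReal.ofReal_ne_top,
        lintegral_sub_right_eq_self (fun x => ‖f x‖ₑ ^ (p : ℝ)) t]
    _ = ∫⁻ x, ‖f x‖ₑ ^ (p : ℝ) ∂μ := by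
      rw [lintegral_mul_const _ hdm, hdint, one_mul]

/-- If `f k → f` almost everywhere and the `L¹` norms of the `f k` do not exceed the norm of `f`,
then `f k → f` in `L¹`. -/
theorem tendsto_lintegral_enorm_sub {α : Type*} [MeasurableSpace α] {μ : Measure α}
    {f : ℕ → α → F} {g : α → F} (hf : ∀ k, Integrable (f k) μ) (hg : Integrable g μ)
    (hle : ∀ k, ∫⁻ x, ‖f k x‖ₑ ∂μ ≤ ∫⁻ x, ‖g x‖ₑ ∂μ)
    (hlim : ∀ᵐ x ∂μ, Tendsto (fun k => f k x) atTop (𝓝 (g x))) :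
    Tendsto (fun k => ∫⁻ x, ‖f k x - g x‖ₑ ∂μ) atTop (𝓝 0) := by
  set I := ∫⁻ x, ‖g x‖ₑ ∂μ with hI
  have hIfin : I ≠ ⊤ := hg.2.ne
  -- Fatou is applied to these nonnegative functions, which tend to `2‖g‖` almost everywhere. The
  -- norm bound caps their integrals by `2I - ∫ ‖f k - g‖`, so the subtracted integral has to vanish
  -- in the limit.
  set u : ℕ → α → ℝ≥0∞ := fun k x => ‖f k x‖ₑ + ‖g x‖ₑ - ‖f k x - g x‖ₑ with hu
  have hum : ∀ k, AEMeasurable (u k) μ := fun k =>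
    ((hf k).1.enorm.add hg.1.enorm).sub ((hf k).sub hg).1.enorm
  have hfin : ∀ k, ∫⁻ x, ‖f k x - g x‖ₑ ∂μ ≠ ⊤ := fun k => ((hf k).sub hg).2.ne
  have huI : ∀ k, ∫⁻ x, u k x ∂μ + ∫⁻ x, ‖f k x - g x‖ₑ ∂μ ≤ I + I := by
    intro k
    rw [← lintegral_add_right' (u k) (g := fun x => ‖f k x - g x‖ₑ) ((hf k).sub hg).1.enorm]
    calc _ = ∫⁻ x, ‖f k x‖ₑ + ‖g x‖ₑ ∂μ := by
          refine lintegral_congr fun x => ?_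
          exact tsub_add_cancel_of_le enorm_sub_le
      _ ≤ _ := by
        rw [lintegral_add_right' _ hg.1.enorm]
        gcongr
        exact hle k
  have hlow : I + I ≤ liminf (fun k => ∫⁻ x, u k x ∂μ) atTop := by
    refine le_trans (le_of_eq ?_) (lintegral_liminf_le' hum)
    rw [hI, ← lintegral_add_right' _ hg.1.enorm]
    refine lintegral_congr_ae ?_
    filter_upwards [hlim] with x hx
    refine Eq.symm (Tendsto.liminf_eq ?_)
    have h0 : Tendsto (fun k => ‖f k x - g x‖ₑ) atTop (𝓝 0) := by
      have := (hx.sub_const (g x)).enorm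
      simpa using this
    have h1 : Tendsto (fun k => u k x) atTop (𝓝 (‖g x‖ₑ + ‖g x‖ₑ - 0)) :=
      ENNReal.Tendsto.sub (hx.enorm.add tendsto_const_nhds) h0 (Or.inr (by simp))
    simpa using h1
  have hup : ∀ k, ∫⁻ x, ‖f k x - g x‖ₑ ∂μ ≤ I + I - ∫⁻ x, u k x ∂μ := fun k =>
    ENNReal.le_sub_of_add_le_left
      (ne_top_of_le_ne_top (by simp [hIfin]) (le_self_add.trans (huI k))) (huI k)
  have hulim : Tendsto (fun k => ∫⁻ x, u k x ∂μ) atTop (𝓝 (I + I)) :=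
    tendsto_of_le_liminf_of_limsup_le hlow
      (limsup_le_of_le (h := Eventually.of_forall fun k => le_self_add.trans (huI k)))
  have h2 : Tendsto (fun k => I + I - ∫⁻ x, u k x ∂μ) atTop (𝓝 (I + I - (I + I))) :=
    ENNReal.Tendsto.sub tendsto_const_nhds hulim (Or.inl (by simp [hIfin]))
  rw [tsub_self] at h2
  exact tendsto_of_tendsto_of_tendsto_of_le_of_le tendsto_const_nhds h2 (fun _ => bot_le) hup

/-- A sequence of bump functions at the origin that shrinks to a point. -/
noncomputable def bump (V : Type*) [NormedAddCommGroup V] (k : ℕ) : ContDiffBump (0 : V) where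
  rIn := 1 / (2 * ((k : ℝ) + 1))
  rOut := 1 / ((k : ℝ) + 1)
  rIn_pos := by positivity
  rIn_lt_rOut := by
    apply one_div_lt_one_div_of_lt <;> linarith [(Nat.cast_nonneg k : (0 : ℝ) ≤ k)]

variable (μ) in
/-- The mollifications of a function. -/
noncomputable def mollify (k : ℕ) (f : V → F) : V → F :=
  (bump V k).normed μ ⋆[lsmul ℝ ℝ, μ] f

theorem integrable_mollify {f : V → F} (hf : Integrable f μ) (k : ℕ) :
    Integrable (mollify μ k f) μ :=
  (bump V k).integrable_normed.integrable_convolution _ hf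

theorem contDiff_mollify {f : V → F} (hf : Integrable f μ) (k : ℕ) :
    ContDiff ℝ ∞ (mollify μ k f) :=
  (bump V k).hasCompactSupport_normed.contDiff_convolution_left _ (bump V k).contDiff_normed
    hf.locallyIntegrable

theorem ae_tendsto_mollify {f : V → F} (hf : Integrable f μ) :
    ∀ᵐ x ∂μ, Tendsto (fun k => mollify μ k f x) atTop (𝓝 (f x)) := by
  -- Lebesgue differentiation needs a bound on the ratio of the outer to the inner radius of the
  -- bumps; `bump` keeps it equal to `2`.
  refine ContDiffBump.ae_convolution_tendsto_right_of_locallyIntegrable (K := 2) ?_ ?_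
    hf.locallyIntegrable
  · exact tendsto_one_div_add_atTop_nhds_zero_nat
  · refine Eventually.of_forall fun k => le_of_eq ?_
    simp only [bump]
    field_simp

theorem eLpNorm_mollify_le {f : V → F} (hf : Integrable f μ) (k : ℕ) {p : ℝ≥0} (hp : 1 ≤ p) :
    eLpNorm (mollify μ k f) p μ ≤ eLpNorm f p μ :=
  eLpNorm_normed_convolution_le _ hf hp

theorem tendsto_mollify {f : V → F} (hf : Integrable f μ) :
    Tendsto (fun k => ∫⁻ x, ‖mollify μ k f x - f x‖ₑ ∂μ) atTop (𝓝 0) := by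
  refine tendsto_lintegral_enorm_sub (integrable_mollify hf) hf (fun k => ?_)
    (ae_tendsto_mollify hf)
  have := eLpNorm_mollify_le hf k le_rfl
  simpa [eLpNorm_one_eq_lintegral_enorm] using this

/-- All bumps have radius at most `1`, so one ball contains the supports of all mollifications. The
Sobolev constant, which depends on that ball, is then the same for all of them. -/
theorem support_mollify_subset {f : V → F} {R : ℝ} (hf : Function.support f ⊆ Metric.ball 0 R)
    (k : ℕ) : Function.support (mollify μ k f) ⊆ Metric.ball 0 (R + 1) := by
  refine (support_convolution_subset _).trans ?_
  rw [ContDiffBump.support_normed_eq]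
  rintro _ ⟨a, ha, b, hb, rfl⟩
  have h1 := hf hb
  have h2 : (bump V k).rOut ≤ 1 := by
    simp only [bump]
    rw [div_le_one (by positivity)]
    linarith [(Nat.cast_nonneg k : (0 : ℝ) ≤ k)]
  simp only [mem_ball_zero_iff] at ha h1 ⊢
  calc ‖a + b‖ ≤ ‖a‖ + ‖b‖ := norm_add_le _ _
    _ < R + 1 := by linarith

variable (μ) in
/-- `G` is the weak derivative of `f` on the whole space, both being integrable. -/
structure HasWeakFDeriv (f : V → F) (G : V → V →L[ℝ] F) : Prop where
  integrable : Integrable f μ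
  integrable_deriv : Integrable G μ
  integral_eq : ∀ φ : V → ℝ, ContDiff ℝ ∞ φ → HasCompactSupport φ → ∀ v,
    ∫ x, fderiv ℝ φ x v • f x ∂μ = -∫ x, φ x • G x v ∂μ

/-- Differentiating the convolution puts the derivative on the bump. The reflected translate `y ↦ ρ
(x - y)` is itself a test function, so the definition of the weak derivative moves it to `G`. -/
theorem HasWeakFDeriv.fderiv_mollify {f : V → F} {G : V → V →L[ℝ] F} (h : HasWeakFDeriv μ f G)
    (k : ℕ) : fderiv ℝ (mollify μ k f) = mollify μ k G := by
  ext x v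
  set ρ := (bump V k).normed μ
  have hρ : ContDiff ℝ ∞ ρ := (bump V k).contDiff_normed
  have hρc : HasCompactSupport ρ := (bump V k).hasCompactSupport_normed
  have h1 := hρc.hasFDerivAt_convolution_left (lsmul ℝ ℝ) (hρ.of_le (by simp))
    h.integrable.locallyIntegrable x (μ := μ)
  change fderiv ℝ (ρ ⋆[lsmul ℝ ℝ, μ] f) x v = (ρ ⋆[lsmul ℝ ℝ, μ] G) x v
  rw [h1.fderiv]
  set φ : V → ℝ := fun y => ρ (x - y) with hφ
  have hφs : ContDiff ℝ ∞ φ := hρ.comp (contDiff_const.sub contDiff_id)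
  have hφc : HasCompactSupport φ := by
    have := hρc.comp_homeomorph (Homeomorph.subLeft x)
    exact this
  have hφd : ∀ y, fderiv ℝ φ y v = -(fderiv ℝ ρ (x - y) v) := by
    intro y
    have h2 : HasFDerivAt φ ((fderiv ℝ ρ (x - y)).comp (-ContinuousLinearMap.id ℝ V)) y := by
      refine HasFDerivAt.comp y (hρ.differentiable (by simp) _).hasFDerivAt ?_
      simpa using (hasFDerivAt_id y).const_sub x
    rw [h2.fderiv]; simp
  have hi1 : Integrable (fun t => (lsmul ℝ ℝ).precompL V (fderiv ℝ ρ (x - t)) (f t)) μ := by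
    have := HasCompactSupport.convolutionExists_left ((lsmul ℝ ℝ : ℝ →L[ℝ] F →L[ℝ] F).precompL V)
      (hρc.fderiv ℝ)
      (hρ.continuous_fderiv (by simp)) h.integrable.locallyIntegrable x (μ := μ)
    exact this.integrable_swap
  have hi2 : Integrable (fun t => (lsmul ℝ ℝ) (ρ (x - t)) (G t)) μ := by
    have := HasCompactSupport.convolutionExists_left
      (lsmul ℝ ℝ : ℝ →L[ℝ] (V →L[ℝ] F) →L[ℝ] (V →L[ℝ] F)) hρc
      hρ.continuous h.integrable_deriv.locallyIntegrable x (μ := μ)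
    exact this.integrable_swap
  rw [convolution_eq_swap, convolution_eq_swap, ContinuousLinearMap.integral_apply hi1,
    ContinuousLinearMap.integral_apply hi2]
  have := h.integral_eq φ hφs hφc v
  simp only [hφd, neg_smul, integral_neg, neg_inj] at this
  simpa [hφ] using this

end WeakDeriv

/-! ### Localization, chain rule and Sobolev inequality for weak derivatives -/

namespace WeakDeriv

open Filter Topology ContinuousLinearMap
open scoped Convolution NNReal

variable {V : Type*} [NormedAddCommGroup V] [NormedSpace ℝ V] [FiniteDimensional ℝ V]
  [MeasurableSpace V] [BorelSpace V] {μ : Measure V} [μ.IsAddHaarMeasure]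
  {F : Type*} [NormedAddCommGroup F] [NormedSpace ℝ F] [CompleteSpace F]

theorem integrable_smul_of_tsupport_subset {U : Set V} {f : V → F} {χ : V → ℝ}
    (hf : LocallyIntegrableOn f U μ) (hχ : Continuous χ) (hc : HasCompactSupport χ)
    (hU : tsupport χ ⊆ U) : Integrable (fun x => χ x • f x) μ := by
  have h1 : IntegrableOn f (tsupport χ) μ := hf.integrableOn_compact_subset hU hc
  have h2 : IntegrableOn (fun x => χ x • f x) (tsupport χ) μ :=
    h1.continuousOn_smul hχ.continuousOn hc
  refine (integrableOn_iff_integrable_of_support_subset ?_).1 h2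
  intro x hx
  exact subset_tsupport χ (fun h => hx (by simp [h]))

theorem integrable_clm_smul_of_tsupport_subset {U : Set V} {f : V → F} {χ : V → V →L[ℝ] ℝ}
    (hf : LocallyIntegrableOn f U μ) (hχ : Continuous χ) (hc : HasCompactSupport χ)
    (hU : tsupport χ ⊆ U) : Integrable (fun x => (χ x).smulRight (f x)) μ := by
  have h1 : IntegrableOn f (tsupport χ) μ := hf.integrableOn_compact_subset hU hc
  have hind : Integrable ((tsupport χ).indicator f) μ :=
    (integrable_indicator_iff (isClosed_tsupport χ).measurableSet).2 h1
  have he : (fun x => (χ x).smulRight (f x)) =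
      fun x => (χ x).smulRight ((tsupport χ).indicator f x) := by
    funext x
    by_cases hx : x ∈ tsupport χ
    · rw [Set.indicator_of_mem hx]
    · ext; simp [image_eq_zero_of_notMem_tsupport hx]
  obtain ⟨C, hC⟩ := hc.exists_bound_of_continuous hχ
  rw [he]
  refine Integrable.mono' (hind.norm.const_mul C)
    ((ContinuousLinearMap.smulRightL ℝ V F).aestronglyMeasurable_comp₂
      hχ.aestronglyMeasurable hind.aestronglyMeasurable) (Eventually.of_forall fun x => ?_)
  rw [ContinuousLinearMap.norm_smulRight_apply]
  exact mul_le_mul_of_nonneg_right (hC x) (norm_nonneg _)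

variable (μ) in
/-- `G` is the weak derivative of `f` on `U`. -/
structure HasWeakFDerivOn (U : Set V) (f : V → F) (G : V → V →L[ℝ] F) : Prop where
  locallyIntegrableOn : LocallyIntegrableOn f U μ
  locallyIntegrableOn_deriv : LocallyIntegrableOn G U μ
  integral_eq : ∀ φ : V → ℝ, ContDiff ℝ ∞ φ → HasCompactSupport φ → tsupport φ ⊆ U → ∀ v,
    ∫ x, fderiv ℝ φ x v • f x ∂μ = -∫ x, φ x • G x v ∂μ

theorem HasWeakFDeriv.hasWeakFDerivOn {f : V → F} {G : V → V →L[ℝ] F}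
    (h : HasWeakFDeriv μ f G) : HasWeakFDerivOn μ Set.univ f G :=
  ⟨h.integrable.locallyIntegrable.locallyIntegrableOn _,
    h.integrable_deriv.locallyIntegrable.locallyIntegrableOn _,
    fun φ hφ hc _ v => h.integral_eq φ hφ hc v⟩

/-- Testing with `χ φ`, whose support lies in `U`, gives the product rule. The cutoff turns a local
weak derivative into one on the whole space, which is what mollification requires. -/
theorem HasWeakFDerivOn.smul {U : Set V} {f : V → F} {G : V → V →L[ℝ] F}
    (h : HasWeakFDerivOn μ U f G) {χ : V → ℝ} (hχ : ContDiff ℝ ∞ χ) (hc : HasCompactSupport χ)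
    (hU : tsupport χ ⊆ U) :
    HasWeakFDeriv μ (fun x => χ x • f x)
      (fun x => χ x • G x + (fderiv ℝ χ x).smulRight (f x)) := by
  have hχ' : Continuous (fderiv ℝ χ) := hχ.continuous_fderiv (by simp)
  have hU' : tsupport (fderiv ℝ χ) ⊆ U := (tsupport_fderiv_subset ℝ).trans hU
  have i1 := integrable_smul_of_tsupport_subset h.locallyIntegrableOn hχ.continuous hc hU
  have i2 := integrable_smul_of_tsupport_subset h.locallyIntegrableOn_deriv hχ.continuous hc hU
  have i3 := integrable_clm_smul_of_tsupport_subset h.locallyIntegrableOn hχ' (hc.fderiv ℝ) hU'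
  refine ⟨i1, i2.add i3, fun φ hφ hφc v => ?_⟩
  have hφ' : Continuous (fderiv ℝ φ) := hφ.continuous_fderiv (by simp)
  have e := h.integral_eq (fun x => χ x * φ x) (hχ.mul hφ) hc.mul_right
    ((tsupport_mul_subset_left).trans hU) v
  have hd : ∀ x, fderiv ℝ (fun x => χ x * φ x) x v =
      χ x * fderiv ℝ φ x v + φ x * fderiv ℝ χ x v := by
    intro x
    rw [fderiv_fun_mul (hχ.differentiable (by simp) x) (hφ.differentiable (by simp) x)]
    simp
  have j1 : Integrable (fun x => fderiv ℝ φ x v • χ x • f x) μ := by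
    obtain ⟨C, hC⟩ := (hφc.fderiv_apply ℝ v).exists_bound_of_continuous
      (hφ'.clm_apply continuous_const)
    exact i1.bdd_smul C (hφ'.clm_apply continuous_const).aestronglyMeasurable
      (Eventually.of_forall hC)
  have j2 : Integrable (fun x => φ x • fderiv ℝ χ x v • f x) μ := by
    obtain ⟨C, hC⟩ := hφc.exists_bound_of_continuous hφ.continuous
    have := i3.apply_continuousLinearMap v
    exact this.bdd_smul C hφ.continuous.aestronglyMeasurable (Eventually.of_forall hC)
  have j3 : Integrable (fun x => φ x • χ x • G x v) μ := by
    obtain ⟨C, hC⟩ := hφc.exists_bound_of_continuous hφ.continuous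
    have := i2.apply_continuousLinearMap v
    exact this.bdd_smul C hφ.continuous.aestronglyMeasurable (Eventually.of_forall hC)
  have e1 : ∫ x, fderiv ℝ (fun x => χ x * φ x) x v • f x ∂μ =
      ∫ x, fderiv ℝ φ x v • χ x • f x ∂μ + ∫ x, φ x • fderiv ℝ χ x v • f x ∂μ := by
    rw [← integral_add j1 j2]
    refine integral_congr_ae (Eventually.of_forall fun x => ?_)
    simp only [hd, add_smul, mul_smul]
    rw [smul_comm]
  have e2 : ∫ x, φ x • (χ x • G x + (fderiv ℝ χ x).smulRight (f x)) v ∂μ =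
      ∫ x, φ x • χ x • G x v ∂μ + ∫ x, φ x • fderiv ℝ χ x v • f x ∂μ := by
    rw [← integral_add j3 j2]
    refine integral_congr_ae (Eventually.of_forall fun x => ?_)
    simp
  have e3 : ∫ x, (χ x * φ x) • G x v ∂μ = ∫ x, φ x • χ x • G x v ∂μ := by
    refine integral_congr_ae (Eventually.of_forall fun x => ?_)
    simp only [mul_smul]
    rw [smul_comm]
  rw [e2]
  rw [e1, e3] at e
  rw [eq_sub_of_add_eq e]
  abel

/-- The chain rule for the weak derivative of a composition with a `C¹` Lipschitz function. -/
theorem HasWeakFDeriv.comp {f : V → F} {G : V → V →L[ℝ] F} (h : HasWeakFDeriv μ f G)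
    {Φ : F → ℝ} (hΦ : ContDiff ℝ 1 Φ) (hΦ0 : Φ 0 = 0) {C : ℝ≥0} (hC : ∀ ξ, ‖fderiv ℝ Φ ξ‖ ≤ C) :
    HasWeakFDeriv μ (fun x => Φ (f x)) (fun x => (fderiv ℝ Φ (f x)).comp (G x)) := by
  have hΦ' : Continuous (fderiv ℝ Φ) := hΦ.continuous_fderiv (by simp)
  have hlip : ∀ ξ η, ‖Φ ξ - Φ η‖ ≤ C * ‖ξ - η‖ := fun ξ η =>
    Convex.norm_image_sub_le_of_norm_fderiv_le (𝕜 := ℝ) (s := Set.univ)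
      (fun x _ => hΦ.differentiable (by simp) x) (fun x _ => hC x) convex_univ
      (Set.mem_univ _) (Set.mem_univ _)
  have measComp : ∀ {u : V → F} {D : V → V →L[ℝ] F}, AEStronglyMeasurable u μ →
      AEStronglyMeasurable D μ →
      AEStronglyMeasurable (fun x => (fderiv ℝ Φ (u x)).comp (D x)) μ := fun hu hD =>
    (ContinuousLinearMap.compL ℝ V F ℝ).aestronglyMeasurable_comp₂
      (hΦ'.comp_aestronglyMeasurable hu) hD
  have intComp : ∀ {u : V → F} {D : V → V →L[ℝ] F}, Integrable u μ → Integrable D μ →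
      Integrable (fun x => (fderiv ℝ Φ (u x)).comp (D x)) μ := fun {u D} hu hD =>
    Integrable.mono' (hD.norm.const_mul C) (measComp hu.1 hD.1) (Eventually.of_forall fun x =>
      (ContinuousLinearMap.opNorm_comp_le _ _).trans
        (mul_le_mul_of_nonneg_right (hC _) (norm_nonneg _)))
  have intΦ : ∀ {u : V → F}, Integrable u μ → Integrable (fun x => Φ (u x)) μ := fun {u} hu =>
    Integrable.mono' (hu.norm.const_mul C) (hΦ.continuous.comp_aestronglyMeasurable hu.1)
      (Eventually.of_forall fun x => by simpa [hΦ0] using hlip (u x) 0)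
  refine ⟨intΦ h.integrable, intComp h.integrable h.integrable_deriv, fun φ hφ hφc v => ?_⟩
  set fk : ℕ → V → F := fun k => mollify μ k f with hfk
  set Gk : ℕ → V → V →L[ℝ] F := fun k => mollify μ k G with hGk
  have hφ' : Continuous (fun x => fderiv ℝ φ x v) :=
    (hφ.continuous_fderiv (by simp)).clm_apply continuous_const
  obtain ⟨M, hM⟩ := hφc.exists_bound_of_continuous hφ.continuous
  obtain ⟨N, hN⟩ := (hφc.fderiv_apply ℝ v).exists_bound_of_continuous hφ'
  -- the identity for the mollified functions
  have hk : ∀ k, ∫ x, fderiv ℝ φ x v • Φ (fk k x) ∂μ =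
      -∫ x, φ x • (fderiv ℝ Φ (fk k x)).comp (Gk k x) v ∂μ := by
    intro k
    have hs : ContDiff ℝ 1 (fun x => Φ (fk k x)) :=
      hΦ.comp ((contDiff_mollify h.integrable k).of_le (by simp))
    have hd : ∀ x, fderiv ℝ (fun x => Φ (fk k x)) x = (fderiv ℝ Φ (fk k x)).comp (Gk k x) := by
      intro x
      have := fderiv_comp x (hΦ.differentiable (by simp) (fk k x))
        ((contDiff_mollify h.integrable k (μ := μ)).differentiable (by simp) x)
      rw [h.fderiv_mollify] at this
      exact this
    have hs' : Continuous (fun x => fderiv ℝ (fun x => Φ (fk k x)) x v) :=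
      (hs.continuous_fderiv (by simp)).clm_apply continuous_const
    have := integral_mul_fderiv_eq_neg_fderiv_mul_of_integrable (μ := μ)
      (f := φ) (g := fun x => Φ (fk k x)) (v := v)
      ((hφ'.mul hs.continuous).integrable_of_hasCompactSupport
        (hφc.fderiv_apply ℝ v).mul_right)
      ((hφ.continuous.mul hs').integrable_of_hasCompactSupport hφc.mul_right)
      ((hφ.continuous.mul hs.continuous).integrable_of_hasCompactSupport hφc.mul_right)
      (fun x _ => hφ.differentiable (by simp) x) (fun x _ => hs.differentiable (by simp) x)
    simp only [hd] at this
    simp only [smul_eq_mul]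
    rw [this, neg_neg]
  have hf0 := tendsto_mollify h.integrable
  have hG0 := tendsto_mollify h.integrable_deriv
  -- convergence of both sides
  have l1 : Tendsto (fun k => ∫ x, fderiv ℝ φ x v • Φ (fk k x) ∂μ) atTop
      (𝓝 (∫ x, fderiv ℝ φ x v • Φ (f x) ∂μ)) := by
    refine tendsto_integral_of_L1 _
      ((intΦ h.integrable).bdd_smul N hφ'.aestronglyMeasurable (Eventually.of_forall hN)).1
      (Eventually.of_forall fun k => (intΦ (integrable_mollify h.integrable k)).bdd_smul N
        hφ'.aestronglyMeasurable (Eventually.of_forall hN)) ?_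
    have hz : Tendsto (fun k => ENNReal.ofReal (N * C) * ∫⁻ x, ‖fk k x - f x‖ₑ ∂μ) atTop
        (𝓝 (ENNReal.ofReal (N * C) * 0)) :=
      ENNReal.Tendsto.const_mul hf0 (Or.inr ENNReal.ofReal_ne_top)
    rw [mul_zero] at hz
    refine tendsto_of_tendsto_of_tendsto_of_le_of_le tendsto_const_nhds hz (fun _ => bot_le) ?_
    intro k
    dsimp only
    rw [← lintegral_const_mul' _ _ ENNReal.ofReal_ne_top]
    refine lintegral_mono fun x => ?_
    change ‖fderiv ℝ φ x v • Φ (fk k x) - fderiv ℝ φ x v • Φ (f x)‖ₑ ≤ _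
    rw [← smul_sub, ← ofReal_norm, ← ofReal_norm,
      ← ENNReal.ofReal_mul' (norm_nonneg _), norm_smul, mul_assoc]
    exact ENNReal.ofReal_le_ofReal (mul_le_mul (hN x) (hlip _ _) (norm_nonneg _)
      ((norm_nonneg _).trans (hN x)))
  -- The difference splits into `Φ'(f k)` applied to `G k - G`, controlled by the bound on `Φ'` and
  -- `L¹` convergence, and `Φ'(f k) - Φ'(f)` applied to `G`. The second part converges only almost
  -- everywhere, and dominated convergence with majorant `2C‖G‖` handles it.
  have hcomp : Tendsto (fun k => ∫⁻ x, ‖(fderiv ℝ Φ (fk k x)).comp (Gk k x) -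
      (fderiv ℝ Φ (f x)).comp (G x)‖ₑ ∂μ) atTop (𝓝 0) := by
    have hdom : Tendsto (fun k => ∫⁻ x, ‖fderiv ℝ Φ (fk k x) - fderiv ℝ Φ (f x)‖ₑ * ‖G x‖ₑ ∂μ)
        atTop (𝓝 (∫⁻ _x, 0 ∂μ)) := by
      refine tendsto_lintegral_of_dominated_convergence' (fun x => 2 * C * ‖G x‖ₑ)
        (fun k => ?_) (fun k => Eventually.of_forall fun x => ?_) ?_ ?_
      · exact ((hΦ'.comp_aestronglyMeasurable (integrable_mollify h.integrable k).1).sub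
          (hΦ'.comp_aestronglyMeasurable h.integrable.1)).enorm.mul h.integrable_deriv.1.enorm
      · dsimp only
        gcongr
        have hb : ∀ ξ, ‖fderiv ℝ Φ ξ‖ₑ ≤ C := fun ξ => by
          rw [← ofReal_norm]
          exact ENNReal.ofReal_le_of_le_toReal (by simpa using hC ξ)
        calc _ ≤ ‖fderiv ℝ Φ (fk k x)‖ₑ + ‖fderiv ℝ Φ (f x)‖ₑ := enorm_sub_le
          _ ≤ C + C := add_le_add (hb _) (hb _)
          _ = 2 * C := by ring
      · rw [lintegral_const_mul'' _ h.integrable_deriv.1.enorm]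
        exact ENNReal.mul_ne_top (by finiteness) h.integrable_deriv.2.ne
      · filter_upwards [ae_tendsto_mollify h.integrable] with x hx
        have h1 : Tendsto (fun k => ‖fderiv ℝ Φ (fk k x) - fderiv ℝ Φ (f x)‖ₑ) atTop (𝓝 0) := by
          have := ENNReal.tendsto_ofReal
            (tendsto_iff_norm_sub_tendsto_zero.1 ((hΦ'.tendsto (f x)).comp hx))
          simpa [hfk, ofReal_norm, Function.comp_def] using this
        simpa using ENNReal.Tendsto.mul_const h1 (Or.inr (by simp : ‖G x‖ₑ ≠ ⊤))
    have hz : Tendsto (fun k => (C : ℝ≥0∞) * ∫⁻ x, ‖Gk k x - G x‖ₑ ∂μ +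
        ∫⁻ x, ‖fderiv ℝ Φ (fk k x) - fderiv ℝ Φ (f x)‖ₑ * ‖G x‖ₑ ∂μ) atTop (𝓝 (C * 0 + 0)) :=
      (ENNReal.Tendsto.const_mul hG0 (Or.inr (by simp))).add (by simpa using hdom)
    simp only [mul_zero, add_zero] at hz
    refine tendsto_of_tendsto_of_tendsto_of_le_of_le tendsto_const_nhds hz (fun _ => bot_le) ?_
    intro k
    dsimp only
    rw [← lintegral_const_mul' _ _ (by simp), ← lintegral_add_left'
      (f := fun x => (C : ℝ≥0∞) * ‖Gk k x - G x‖ₑ)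
      (((integrable_mollify h.integrable_deriv k).1.sub h.integrable_deriv.1).enorm.const_mul _)]
    refine lintegral_mono fun x => ?_
    have e : (fderiv ℝ Φ (fk k x)).comp (Gk k x) - (fderiv ℝ Φ (f x)).comp (G x) =
        (fderiv ℝ Φ (fk k x)).comp (Gk k x - G x) +
          (fderiv ℝ Φ (fk k x) - fderiv ℝ Φ (f x)).comp (G x) := by
      ext w; simp
    have b : ∀ (A : F →L[ℝ] ℝ) (B : V →L[ℝ] F), ‖A.comp B‖ₑ ≤ ‖A‖ₑ * ‖B‖ₑ := fun A B => by
      simp only [← ofReal_norm]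
      rw [← ENNReal.ofReal_mul (norm_nonneg _)]
      exact ENNReal.ofReal_le_ofReal (A.opNorm_comp_le B)
    have t : ∀ A B : V →L[ℝ] ℝ, ‖A + B‖ₑ ≤ ‖A‖ₑ + ‖B‖ₑ := fun A B => enorm_add_le A B
    rw [e]
    refine (t _ _).trans (add_le_add ((b _ _).trans ?_) (b _ _))
    gcongr
    rw [← ofReal_norm]
    exact ENNReal.ofReal_le_of_le_toReal (by simpa using hC _)
  have l2 : Tendsto (fun k => ∫ x, φ x • (fderiv ℝ Φ (fk k x)).comp (Gk k x) v ∂μ) atTop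
      (𝓝 (∫ x, φ x • (fderiv ℝ Φ (f x)).comp (G x) v ∂μ)) := by
    have ii : ∀ {u : V → F} {D : V → V →L[ℝ] F}, Integrable u μ → Integrable D μ →
        Integrable (fun x => φ x • (fderiv ℝ Φ (u x)).comp (D x) v) μ := fun hu hD =>
      ((intComp hu hD).apply_continuousLinearMap v).bdd_smul M
        hφ.continuous.aestronglyMeasurable (Eventually.of_forall hM)
    refine tendsto_integral_of_L1 _ (ii h.integrable h.integrable_deriv).1
      (Eventually.of_forall fun k => ii (integrable_mollify h.integrable k)
        (integrable_mollify h.integrable_deriv k)) ?_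
    have hz := ENNReal.Tendsto.const_mul (a := ENNReal.ofReal (M * ‖v‖)) hcomp
      (Or.inr ENNReal.ofReal_ne_top)
    rw [mul_zero] at hz
    refine tendsto_of_tendsto_of_tendsto_of_le_of_le tendsto_const_nhds hz (fun _ => bot_le) ?_
    intro k
    dsimp only
    rw [← lintegral_const_mul' _ _ ENNReal.ofReal_ne_top]
    refine lintegral_mono fun x => ?_
    rw [← smul_sub, ← _root_.sub_apply, ← ofReal_norm,
      ← ofReal_norm, ← ENNReal.ofReal_mul' (norm_nonneg _), norm_smul, mul_assoc,
      mul_comm ‖v‖]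
    exact ENNReal.ofReal_le_ofReal (mul_le_mul (hM x) (ContinuousLinearMap.le_opNorm _ _)
      (norm_nonneg _) ((norm_nonneg _).trans (hM x)))
  exact tendsto_nhds_unique l1 (by simpa only [hk] using l2.neg)

/-- The Gagliardo-Nirenberg-Sobolev inequality for weak derivatives. -/
theorem HasWeakFDeriv.eLpNorm_lt_top {f : V → ℝ} {G : V → V →L[ℝ] ℝ} (h : HasWeakFDeriv μ f G)
    (hf : Bornology.IsBounded (Function.support f)) {s q : ℝ≥0} (hs : 1 ≤ s)
    (hs' : s < Module.finrank ℝ V) (hq : (s : ℝ)⁻¹ - (Module.finrank ℝ V : ℝ)⁻¹ ≤ (q : ℝ)⁻¹)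
    (hG : eLpNorm G s μ < ⊤) : eLpNorm f q μ < ⊤ := by
  obtain ⟨R, hR⟩ := hf.subset_ball 0
  set K := eLpNormLESNormFDerivOfLeConst ℝ μ (Metric.ball (0 : V) (R + 1)) s q
  have h1 : ∀ k, eLpNorm (mollify μ k f) q μ ≤ K * eLpNorm G s μ := by
    intro k
    refine (eLpNorm_le_eLpNorm_fderiv_of_le μ ((contDiff_mollify h.integrable k).of_le (by simp))
      (support_mollify_subset hR k) hs hs' (by exact_mod_cast hq) Metric.isBounded_ball).trans ?_
    rw [h.fderiv_mollify]
    gcongr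
    exact eLpNorm_mollify_le h.integrable_deriv k hs
  -- The bound for the mollifications is uniform in `k`, so Fatou transfers it to the almost
  -- everywhere limit `f`.
  refine lt_of_le_of_lt (Lp.eLpNorm_lim_le_liminf_eLpNorm
    (fun k => (integrable_mollify h.integrable k).1) f (ae_tendsto_mollify h.integrable))
    (lt_of_le_of_lt ?_ (ENNReal.mul_lt_top (b := eLpNorm G s μ) (a := K) (by simp) hG))
  refine liminf_le_of_le (by isBoundedDefault) fun b hb => ?_
  obtain ⟨k, hk⟩ := hb.exists
  exact hk.trans (h1 k)

end WeakDeriv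

/-! ### The square-root substitution and the gain of integrability -/

namespace WeakDeriv

open Filter Topology ContinuousLinearMap
open scoped NNReal

section Root

variable {F : Type*} [NormedAddCommGroup F] [InnerProductSpace ℝ F]

/-- A smooth function on a Euclidean space that grows like the square root of the norm. -/
noncomputable def rootNorm (ξ : F) : ℝ := √(√(1 + ‖ξ‖ ^ 2)) - 1

theorem rootNorm_zero : rootNorm (0 : F) = 0 := by simp [rootNorm]

theorem one_le_sqrt_one_add (ξ : F) : 1 ≤ √(1 + ‖ξ‖ ^ 2) :=
  Real.one_le_sqrt.2 (by nlinarith [sq_nonneg ‖ξ‖])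

theorem norm_le_sqrt_one_add (ξ : F) : ‖ξ‖ ≤ √(1 + ‖ξ‖ ^ 2) :=
  Real.le_sqrt_of_sq_le (by linarith)

theorem sqrt_one_add_le (ξ : F) : √(1 + ‖ξ‖ ^ 2) ≤ 1 + ‖ξ‖ :=
  Real.sqrt_le_iff.2 ⟨by positivity, by nlinarith [norm_nonneg ξ]⟩

theorem contDiff_rootNorm : ContDiff ℝ 1 (rootNorm : F → ℝ) := by
  have h : ContDiff ℝ 1 fun ξ : F => 1 + ‖ξ‖ ^ 2 := contDiff_const.add (contDiff_norm_sq ℝ)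
  have h1 : ContDiff ℝ 1 fun ξ : F => √(1 + ‖ξ‖ ^ 2) := h.sqrt fun ξ => by positivity
  refine (h1.sqrt fun ξ => ?_).sub contDiff_const
  linarith [one_le_sqrt_one_add ξ]

/-- With `a = √(1+‖ξ‖²)` and `b = √a`, the chain rule gives norm `‖ξ‖/(2ab)`, and `‖ξ‖ ≤ a`. -/
theorem norm_fderiv_rootNorm_le (ξ : F) :
    ‖fderiv ℝ (rootNorm : F → ℝ) ξ‖ ≤ 1 / (2 * √(√(1 + ‖ξ‖ ^ 2))) := by
  set a := √(1 + ‖ξ‖ ^ 2) with ha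
  have ha1 : 1 ≤ a := one_le_sqrt_one_add ξ
  set b := √a with hb
  have hb1 : 1 ≤ b := Real.one_le_sqrt.2 ha1
  have h : HasFDerivAt (fun ξ : F => 1 + ‖ξ‖ ^ 2) (2 • innerSL ℝ ξ) ξ :=
    (hasStrictFDerivAt_norm_sq ξ).hasFDerivAt.const_add 1
  have h1 := (h.sqrt (by positivity)).sqrt (by positivity)
  have h2 := (h1.sub_const 1).fderiv
  change fderiv ℝ (rootNorm : F → ℝ) ξ = _ at h2
  rw [h2, ← ha, ← hb, norm_smul, norm_smul, two_smul, ← two_smul ℝ, norm_smul, innerSL_apply_norm,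
    Real.norm_of_nonneg (by positivity), Real.norm_of_nonneg (by positivity),
    Real.norm_of_nonneg (by positivity)]
  have hx : ‖ξ‖ ≤ a := norm_le_sqrt_one_add ξ
  have : 1 / (2 * a) * (2 * ‖ξ‖) ≤ 1 := by
    rw [div_mul_eq_mul_div, div_le_one (by positivity)]; linarith
  calc _ ≤ 1 / (2 * b) * 1 := by gcongr
    _ = _ := mul_one _

theorem norm_fderiv_rootNorm_le_one (ξ : F) : ‖fderiv ℝ (rootNorm : F → ℝ) ξ‖ ≤ 1 := by
  refine (norm_fderiv_rootNorm_le ξ).trans ?_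
  have := Real.one_le_sqrt.2 (one_le_sqrt_one_add ξ)
  rw [div_le_one (by positivity)]
  linarith

/-- This is why the fourth root is chosen: the squared derivative is exactly of the order of the
weight in `∫ |Df|²/(1+|f|)`. The constant uses `1 + ‖ξ‖ ≤ 4√(1+‖ξ‖²)`. -/
theorem norm_fderiv_rootNorm_sq_le (ξ : F) :
    ‖fderiv ℝ (rootNorm : F → ℝ) ξ‖ ^ 2 ≤ 1 / (1 + ‖ξ‖) := by
  have h1 := one_le_sqrt_one_add ξ
  have hx := norm_le_sqrt_one_add ξ
  calc _ ≤ (1 / (2 * √(√(1 + ‖ξ‖ ^ 2)))) ^ 2 := by gcongr; exact norm_fderiv_rootNorm_le ξ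
    _ = 1 / (4 * √(1 + ‖ξ‖ ^ 2)) := by
      rw [div_pow, mul_pow, Real.sq_sqrt (by positivity)]; norm_num
    _ ≤ _ := by
      apply one_div_le_one_div_of_le
      · positivity
      · linarith

/-- Controls the term in which a cutoff is differentiated: only `|f|`, which is locally integrable,
appears after squaring. -/
theorem rootNorm_sq_le (ξ : F) : rootNorm ξ ^ 2 ≤ ‖ξ‖ := by
  have h1 := one_le_sqrt_one_add ξ
  have h2 := sqrt_one_add_le ξ
  have h3 := Real.one_le_sqrt.2 h1
  have h4 := Real.sq_sqrt (zero_le_one.trans h1)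
  rw [rootNorm]
  nlinarith

theorem norm_le_rootNorm_add_one_sq (ξ : F) : ‖ξ‖ ≤ (|rootNorm ξ| + 1) ^ 2 := by
  have h1 := one_le_sqrt_one_add ξ
  have h3 := Real.one_le_sqrt.2 h1
  have h4 := Real.sq_sqrt (zero_le_one.trans h1)
  rw [rootNorm, abs_of_nonneg (by linarith), sub_add_cancel, h4]
  exact norm_le_sqrt_one_add ξ

end Root

variable {V : Type*} [NormedAddCommGroup V] [NormedSpace ℝ V] [FiniteDimensional ℝ V]
  [MeasurableSpace V] [BorelSpace V] {μ : Measure V} [μ.IsAddHaarMeasure]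
  {F : Type*} [NormedAddCommGroup F] [InnerProductSpace ℝ F] [CompleteSpace F]

/-- A function whose weak derivative satisfies `∫ |Df|² / (1 + |f|) < ∞` has the integrability of
the square of a function in `W^{1,2}`. -/
theorem HasWeakFDerivOn.eLpNorm_lt_top_of_lintegral {U : Set V} {f : V → F} {G : V → V →L[ℝ] F}
    (h : HasWeakFDerivOn μ U f G) {y₀ : V} {R : ℝ} (hR : 0 < R)
    (hU : Metric.closedBall y₀ (4 * R) ⊆ U)
    (hE : ∫⁻ x in Metric.closedBall y₀ (2 * R), ENNReal.ofReal (‖G x‖ ^ 2 / (1 + ‖f x‖)) ∂μ < ⊤)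
    {s q : ℝ≥0} (hs : 1 ≤ s) (hs2 : s ≤ 2) (hs' : s < Module.finrank ℝ V)
    (hq : (s : ℝ)⁻¹ - (Module.finrank ℝ V : ℝ)⁻¹ ≤ (q : ℝ)⁻¹) :
    eLpNorm f (q / 2 : ℝ≥0∞) (μ.restrict (Metric.closedBall y₀ R)) < ⊤ := by
  -- Two cutoffs are needed. `χ₁`, equal to `1` near the ball of radius `2R`, only makes `f`
  -- globally integrable so that the chain rule applies. `χ₂` cuts off after the root has been
  -- taken, where `χ₁ = 1`. Cutting off `f` alone would produce `|f|²/(1+|χf|)` where `χ` is small,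
  -- which is not controlled.
  let χ₁ : ContDiffBump y₀ := ⟨3 * R, 4 * R, by positivity, by linarith⟩
  let χ₂ : ContDiffBump y₀ := ⟨R, 2 * R, hR, by linarith⟩
  have hχ₂ : ContDiff ℝ ∞ χ₂ := χ₂.contDiff
  have h1 := h.smul (χ := χ₁) χ₁.contDiff χ₁.hasCompactSupport (by rw [χ₁.tsupport_eq]; exact hU)
  have h2 := h1.comp contDiff_rootNorm rootNorm_zero (C := 1)
    (fun ξ => by simpa using norm_fderiv_rootNorm_le_one ξ)
  have h3 := h2.hasWeakFDerivOn.smul (χ := χ₂) hχ₂ χ₂.hasCompactSupport (Set.subset_univ _)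
  set B₂ := Metric.closedBall y₀ (2 * R) with hB₂
  have hone : ∀ x ∈ B₂, χ₁ x = 1 ∧ fderiv ℝ χ₁ x = 0 := by
    intro x hx
    have hx' : x ∈ Metric.ball y₀ (3 * R) := Metric.closedBall_subset_ball (by linarith) hx
    have hev : (χ₁ : V → ℝ) =ᶠ[𝓝 x] fun _ => 1 := by
      filter_upwards [Metric.isOpen_ball.mem_nhds hx'] with z hz
      exact χ₁.one_of_mem_closedBall (Metric.ball_subset_closedBall hz)
    exact ⟨hev.eq_of_nhds, by rw [hev.fderiv_eq]; simp⟩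
  obtain ⟨B, hB⟩ := (χ₂.hasCompactSupport.fderiv ℝ).exists_bound_of_continuous
    (hχ₂.continuous_fderiv (by simp))
  set k : V → ℝ := fun x => χ₂ x • rootNorm (χ₁ x • f x) with hk
  set D : V → V →L[ℝ] ℝ := fun x => χ₂ x • (fderiv ℝ rootNorm (χ₁ x • f x)).comp
    (χ₁ x • G x + (fderiv ℝ χ₁ x).smulRight (f x)) +
      (fderiv ℝ χ₂ x).smulRight (rootNorm (χ₁ x • f x)) with hD
  have hDsupp : Function.support D ⊆ B₂ := by
    intro x hx
    by_contra hne
    have hts : x ∉ tsupport χ₂ := by rwa [χ₂.tsupport_eq]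
    have e1 : χ₂ x = 0 := image_eq_zero_of_notMem_tsupport hts
    have e2 : fderiv ℝ χ₂ x = 0 :=
      image_eq_zero_of_notMem_tsupport fun hh => hts (tsupport_fderiv_subset ℝ hh)
    apply hx
    simp [hD, e1, e2]
  have hDle : ∀ x ∈ B₂, ‖D x‖ ^ 2 ≤ 2 * (‖G x‖ ^ 2 / (1 + ‖f x‖)) + 2 * B ^ 2 * ‖f x‖ := by
    intro x hx
    obtain ⟨e1, e2⟩ := hone x hx
    have e3 : D x = χ₂ x • (fderiv ℝ rootNorm (f x)).comp (G x) +
        (fderiv ℝ χ₂ x).smulRight (rootNorm (f x)) := by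
      simp [hD, e1, e2]
    have b1 : ‖χ₂ x • (fderiv ℝ rootNorm (f x)).comp (G x)‖ ≤
        ‖fderiv ℝ (rootNorm : F → ℝ) (f x)‖ * ‖G x‖ := by
      rw [norm_smul, Real.norm_of_nonneg χ₂.nonneg]
      calc _ ≤ 1 * (‖fderiv ℝ (rootNorm : F → ℝ) (f x)‖ * ‖G x‖) :=
            mul_le_mul χ₂.le_one (ContinuousLinearMap.opNorm_comp_le _ _) (norm_nonneg _)
              zero_le_one
        _ = _ := one_mul _
    have b2 : ‖(fderiv ℝ χ₂ x).smulRight (rootNorm (f x))‖ ≤ B * |rootNorm (f x)| := by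
      rw [ContinuousLinearMap.norm_smulRight_apply, Real.norm_eq_abs]
      exact mul_le_mul_of_nonneg_right (hB x) (abs_nonneg _)
    have b3 : ‖D x‖ ≤ ‖fderiv ℝ (rootNorm : F → ℝ) (f x)‖ * ‖G x‖ + B * |rootNorm (f x)| := by
      rw [e3]; exact (norm_add_le _ _).trans (add_le_add b1 b2)
    have b4 : (‖fderiv ℝ (rootNorm : F → ℝ) (f x)‖ * ‖G x‖) ^ 2 ≤ ‖G x‖ ^ 2 / (1 + ‖f x‖) := by
      rw [mul_pow]
      calc _ ≤ 1 / (1 + ‖f x‖) * ‖G x‖ ^ 2 := by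
            gcongr; exact norm_fderiv_rootNorm_sq_le _
        _ = _ := by ring
    have b5 : (B * |rootNorm (f x)|) ^ 2 ≤ B ^ 2 * ‖f x‖ := by
      rw [mul_pow, sq_abs]
      gcongr; exact rootNorm_sq_le _
    calc ‖D x‖ ^ 2 ≤ (‖fderiv ℝ (rootNorm : F → ℝ) (f x)‖ * ‖G x‖ + B * |rootNorm (f x)|) ^ 2 := by
          gcongr
      _ ≤ 2 * (‖fderiv ℝ (rootNorm : F → ℝ) (f x)‖ * ‖G x‖) ^ 2 +
          2 * (B * |rootNorm (f x)|) ^ 2 := by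
          nlinarith [sq_nonneg (‖fderiv ℝ (rootNorm : F → ℝ) (f x)‖ * ‖G x‖ -
            B * |rootNorm (f x)|)]
      _ ≤ _ := by linarith
  have hfin : IsFiniteMeasure (μ.restrict B₂) :=
    ⟨by simpa using (isCompact_closedBall y₀ (2 * R)).measure_lt_top⟩
  have hfB : IntegrableOn f B₂ μ := h.locallyIntegrableOn.integrableOn_compact_subset
    ((Metric.closedBall_subset_closedBall (by linarith)).trans hU) (isCompact_closedBall _ _)
  -- The pointwise bound leaves the assumed energy integral plus the `L¹` norm of `f` on the ball,
  -- both finite.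
  have hD2 : eLpNorm D 2 (μ.restrict B₂) < ⊤ := by
    rw [eLpNorm_lt_top_iff_lintegral_rpow_enorm_lt_top (by simp) (by simp)]
    calc ∫⁻ x in B₂, ‖D x‖ₑ ^ (2 : ℝ≥0∞).toReal ∂μ
        ≤ ∫⁻ x in B₂, (2 * ENNReal.ofReal (‖G x‖ ^ 2 / (1 + ‖f x‖)) +
            ENNReal.ofReal (2 * B ^ 2) * ‖f x‖ₑ) ∂μ := by
          refine setLIntegral_mono' Metric.isClosed_closedBall.measurableSet fun x hx => ?_
          rw [ENNReal.toReal_ofNat, ENNReal.rpow_ofNat, ← ofReal_norm, ← ofReal_norm,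
            ← ENNReal.ofReal_pow (norm_nonneg _), ← ENNReal.ofReal_mul (by positivity),
            show (2 : ℝ≥0∞) = ENNReal.ofReal 2 by simp, ← ENNReal.ofReal_mul (by positivity),
            ← ENNReal.ofReal_add (by positivity) (by positivity)]
          exact ENNReal.ofReal_le_ofReal (hDle x hx)
      _ = 2 * ∫⁻ x in B₂, ENNReal.ofReal (‖G x‖ ^ 2 / (1 + ‖f x‖)) ∂μ +
            ENNReal.ofReal (2 * B ^ 2) * ∫⁻ x in B₂, ‖f x‖ₑ ∂μ := by
          rw [lintegral_add_right' _ (hfB.1.enorm.const_mul _),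
            lintegral_const_mul' _ _ (by simp), lintegral_const_mul' _ _ ENNReal.ofReal_ne_top]
      _ < ⊤ := ENNReal.add_lt_top.2 ⟨ENNReal.mul_lt_top (by simp) hE,
          ENNReal.mul_lt_top ENNReal.ofReal_lt_top hfB.2⟩
  -- On a bounded set the exponent `2` may be lowered to `s`. The Sobolev inequality needs `s` below
  -- the real dimension, which excludes `s = 2` in dimension `2`.
  have hDs : eLpNorm D s μ < ⊤ := by
    have hDn : Function.support (fun x => ‖D x‖) ⊆ B₂ := fun x hx =>
      hDsupp fun hh => hx (by simp [hh])
    rw [← eLpNorm_norm, ← eLpNorm_restrict_eq_of_support_subset hDn, eLpNorm_norm]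
    exact (MemLp.mono_exponent (q := 2) ⟨h3.integrable_deriv.1.restrict, hD2⟩
      (by exact_mod_cast hs2)).2
  have hkb : Bornology.IsBounded (Function.support k) := by
    refine (Metric.isBounded_closedBall (x := y₀) (r := 2 * R)).subset ?_
    rw [← χ₂.tsupport_eq]
    exact fun x hx => subset_tsupport _ fun hh => hx (by simp [hk, hh])
  have hkq := h3.eLpNorm_lt_top hkb hs hs' hq hDs
  set B₁ := Metric.closedBall y₀ R with hB₁
  have hfin' : IsFiniteMeasure (μ.restrict B₁) :=
    ⟨by simpa using (isCompact_closedBall y₀ R).measure_lt_top⟩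
  have hk1 : MemLp (fun x => |k x| + 1) q (μ.restrict B₁) :=
    (MemLp.norm ⟨h3.integrable.1.restrict, (eLpNorm_mono_measure k Measure.restrict_le_self).trans_lt
      hkq⟩).add (memLp_const 1)
  have hle : eLpNorm f (q / 2 : ℝ≥0∞) (μ.restrict B₁) ≤
      eLpNorm (fun x => ‖|k x| + 1‖ ^ (2 : ℝ)) (q / 2 : ℝ≥0∞) (μ.restrict B₁) := by
    refine eLpNorm_mono_ae_real ?_
    filter_upwards [ae_restrict_mem Metric.isClosed_closedBall.measurableSet] with x hx
    have e1 := (hone x (Metric.closedBall_subset_closedBall (by linarith) hx)).1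
    have e2 : χ₂ x = 1 := χ₂.one_of_mem_closedBall hx
    have := norm_le_rootNorm_add_one_sq (f x)
    rw [Real.norm_of_nonneg (by positivity)]
    simpa [hk, e1, e2] using this
  refine hle.trans_lt ?_
  -- As `‖f‖ ≤ (|k|+1)²` on the small ball, the `L^{q/2}` norm of `f` is at most the square of the
  -- `L^q` norm of `|k|+1`.
  rw [eLpNorm_norm_rpow _ (by norm_num)]
  refine ENNReal.rpow_lt_top_of_nonneg (by norm_num) ?_
  have : (q / 2 : ℝ≥0∞) * ENNReal.ofReal 2 = q := by
    rw [ENNReal.ofReal_ofNat, ENNReal.div_mul_cancel (by simp) (by simp)]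
  rw [this]
  exact hk1.2.ne

end WeakDeriv

/-! ### Hermitian linear algebra in the fibres and the pointwise energy estimate -/

namespace HermBundle

open Matrix

section Fibre

variable {V : Type*} [AddCommGroup V] [Module ℂ V] {r : ℕ}
  {B : V →ₗ⋆[ℂ] V →ₗ[ℂ] ℂ}

/-- The matrix of an endomorphism in a unitary family. -/
def unitaryMatrix (B : V →ₗ⋆[ℂ] V →ₗ[ℂ] ℂ) (e e' : Fin r → V) (T : V →ₗ[ℂ] V) :
    Matrix (Fin r) (Fin r) ℂ :=
  Matrix.of fun i j => B (e i) (T (e' j))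

/-- Pairing with `e j` recovers coefficients, so the family is independent, and by its cardinality
it is a basis. -/
theorem eq_sum_of_unitary [FiniteDimensional ℂ V] (hV : Module.finrank ℂ V = r) {e : Fin r → V}
    (he : ∀ i j, B (e i) (e j) = if i = j then 1 else 0) (u : V) :
    u = ∑ i, B (e i) u • e i := by
  have hB : ∀ (c : Fin r → ℂ) j, B (e j) (∑ i, c i • e i) = c j := by
    intro c j
    simp [map_sum, he]
  have hli : LinearIndependent ℂ e := by
    rw [Fintype.linearIndependent_iff]
    intro c hc j
    have := hB c j
    rw [hc, map_zero] at this
    exact this.symm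
  have hspan : ⊤ ≤ Submodule.span ℂ (Set.range e) :=
    (hli.span_eq_top_of_card_eq_finrank' (by simp [hV])).ge
  obtain ⟨c, hc⟩ := (Submodule.mem_span_range_iff_exists_fun ℂ).1 (hspan (Submodule.mem_top (x := u)))
  simp only [← hc, hB]

theorem unitaryMatrix_mul [FiniteDimensional ℂ V] (hV : Module.finrank ℂ V = r)
    {e f g : Fin r → V} (hf : ∀ i j, B (f i) (f j) = if i = j then 1 else 0)
    (S T : V →ₗ[ℂ] V) :
    unitaryMatrix B e g (S ∘ₗ T) = unitaryMatrix B e f S * unitaryMatrix B f g T := by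
  ext i j
  simp only [unitaryMatrix, Matrix.of_apply, Matrix.mul_apply, LinearMap.comp_apply]
  conv_lhs => rw [eq_sum_of_unitary hV hf (T (g j))]
  simp [map_sum, mul_comm]

theorem unitaryMatrix_conjTranspose (hB : ∀ u v, conj (B u v) = B v u) (e f : Fin r → V) :
    (unitaryMatrix B e f LinearMap.id)ᴴ = unitaryMatrix B f e LinearMap.id := by
  ext i j
  simp [unitaryMatrix, Matrix.conjTranspose_apply, ← hB (e j) (f i)]

theorem unitaryMatrix_id {e : Fin r → V} (he : ∀ i j, B (e i) (e j) = if i = j then 1 else 0) :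
    unitaryMatrix B e e LinearMap.id = 1 := by
  ext i j
  simp [unitaryMatrix, he, Matrix.one_apply]

theorem sum_norm_sq_eq_trace {n : ℕ} (M : Matrix (Fin n) (Fin n) ℂ) :
    ((∑ i, ∑ j, ‖M i j‖ ^ 2 : ℝ) : ℂ) = (Mᴴ * M).trace := by
  simp only [Matrix.trace, Matrix.diag, Matrix.mul_apply, Matrix.conjTranspose_apply]
  rw [Finset.sum_comm]
  push_cast
  refine Finset.sum_congr rfl fun i _ => Finset.sum_congr rfl fun j _ => ?_
  rw [Complex.star_def, Complex.conj_mul']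

/-- The Hilbert-Schmidt norm does not depend on the unitary basis. -/
theorem sum_norm_sq_unitary [FiniteDimensional ℂ V] (hV : Module.finrank ℂ V = r)
    (hB : ∀ u v, conj (B u v) = B v u) {e f : Fin r → V}
    (he : ∀ i j, B (e i) (e j) = if i = j then 1 else 0)
    (hf : ∀ i j, B (f i) (f j) = if i = j then 1 else 0) (T : V →ₗ[ℂ] V) :
    ∑ i, ∑ j, ‖B (e i) (T (e j))‖ ^ 2 = ∑ i, ∑ j, ‖B (f i) (T (f j))‖ ^ 2 := by
  set P := unitaryMatrix B e f LinearMap.id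
  have hP : P * Pᴴ = 1 := by
    rw [unitaryMatrix_conjTranspose hB, ← unitaryMatrix_mul hV hf, LinearMap.id_comp,
      unitaryMatrix_id he]
  have hM : unitaryMatrix B f f T = Pᴴ * unitaryMatrix B e e T * P := by
    rw [unitaryMatrix_conjTranspose hB, ← unitaryMatrix_mul hV he, ← unitaryMatrix_mul hV he,
      -- The two matrices are conjugate by the unitary matrix `P`, and the trace of `M* M` is
      -- invariant under such a conjugation.
      LinearMap.id_comp, LinearMap.comp_id]
  have h1 := sum_norm_sq_eq_trace (unitaryMatrix B e e T)
  have h2 := sum_norm_sq_eq_trace (unitaryMatrix B f f T)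
  have h3 : ((unitaryMatrix B f f T)ᴴ * unitaryMatrix B f f T).trace =
      ((unitaryMatrix B e e T)ᴴ * unitaryMatrix B e e T).trace := by
    set M := unitaryMatrix B e e T
    rw [hM, Matrix.conjTranspose_mul, Matrix.conjTranspose_mul, Matrix.conjTranspose_conjTranspose]
    rw [show Pᴴ * (Mᴴ * P) * (Pᴴ * M * P) = Pᴴ * (Mᴴ * (P * Pᴴ) * M * P) by
      simp only [Matrix.mul_assoc]]
    rw [hP, Matrix.mul_one, Matrix.trace_mul_comm, Matrix.mul_assoc, hP, Matrix.mul_one]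
  rw [h3, ← h1] at h2
  exact (Complex.ofReal_injective h2).symm

/-- The spectral theorem for a self-adjoint endomorphism of a Hermitian space. -/
theorem exists_unitary_eigenvectors [FiniteDimensional ℂ V] (hV : Module.finrank ℂ V = r)
    (hB : ∀ u v, conj (B u v) = B v u) (hpos : ∀ u, u ≠ 0 → 0 < (B u u).re)
    {T : V →ₗ[ℂ] V} (hT : ∀ u v, B (T u) v = B u (T v)) :
    ∃ (e : Fin r → V) (l : Fin r → ℝ), (∀ i j, B (e i) (e j) = if i = j then 1 else 0) ∧
      ∀ i, T (e i) = (l i : ℂ) • e i := by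
  let c : InnerProductSpace.Core ℂ V :=
    { inner := fun u v => B u v
      conj_inner_symm := fun u v => hB v u
      re_inner_nonneg := fun u => by
        by_cases hu : u = 0
        · simp [hu]
        · exact (hpos u hu).le
      add_left := fun u v w => by simp
      smul_left := fun u v t => by simp
      definite := fun u hu => by
        by_contra hne
        have := hpos u hne
        rw [hu] at this
        simp at this }
  let _ : NormedAddCommGroup V := @InnerProductSpace.Core.toNormedAddCommGroup ℂ V _ _ _ c
  let _ : InnerProductSpace ℂ V := InnerProductSpace.ofCore c.toCore
  have hs : T.IsSymmetric := fun u v => hT u v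
  refine ⟨fun i => hs.eigenvectorBasis hV i, hs.eigenvalues hV, fun i j => ?_, fun i => ?_⟩
  · exact (orthonormal_iff_ite.1 (hs.eigenvectorBasis hV).orthonormal) i j
  · exact hs.apply_eigenvectorBasis hV i

end Fibre

/-- Three ranges of `t`. For `t ≥ 0` the quadratic Taylor bound gives `phi t ≥ 1/2`. For `-2 ≤ t <
0` squaring `e^{t/2} ≥ 1 + t/2 ≥ 0` gives `phi t ≥ 1/4`. For `t < -2` the exponential is dropped,
and `(|t|-1)/t²` is still large enough. -/
theorem phi_ge (t : ℝ) : 1 / (4 * (1 + |t|)) ≤ phi t := by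
  rw [phi]
  split_ifs with h
  · subst h; norm_num
  · have ht : 0 < |t| := abs_pos.2 h
    rw [div_le_div_iff₀ (by positivity) (by positivity), one_mul]
    rcases le_or_gt 0 t with h0 | h0
    · have h1 := Real.quadratic_le_exp_of_nonneg h0
      rw [abs_of_nonneg h0]
      have : t ^ 2 / 2 ≤ Real.exp t - t - 1 := by linarith
      nlinarith [mul_nonneg (sq_nonneg t) h0]
    · rw [abs_of_neg h0]
      rcases le_or_gt (-2) t with h2 | h2
      · have h3 := Real.add_one_le_exp (t / 2)
        have h4 : Real.exp t = Real.exp (t / 2) * Real.exp (t / 2) := by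
          rw [← Real.exp_add]; ring_nf
        have h5 : (t / 2 + 1) * (t / 2 + 1) ≤ Real.exp t := by
          rw [h4]; exact mul_le_mul h3 h3 (by linarith) (Real.exp_pos _).le
        have h6 : t ^ 2 / 4 ≤ Real.exp t - t - 1 := by nlinarith
        nlinarith [sq_nonneg t]
      · have h3 : -t - 1 ≤ Real.exp t - t - 1 := by linarith [Real.exp_pos t]
        nlinarith

variable {n r : ℕ} {X : Type*} [TopologicalSpace X] [ChartedSpace (Fin n → ℂ) X]
  {E : X → Type*} [∀ x, AddCommGroup (E x)] [∀ x, Module ℂ (E x)] [∀ x, TopologicalSpace (E x)]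
  [TopologicalSpace (TotalSpace (Fin r → ℂ) E)] [FiberBundle (Fin r → ℂ) E]
  [VectorBundle ℂ (Fin r → ℂ) E]

theorem finiteDimensional_fibre (r : ℕ) {X : Type*} [TopologicalSpace X] (E : X → Type*)
    [∀ x, AddCommGroup (E x)] [∀ x, Module ℂ (E x)] [∀ x, TopologicalSpace (E x)]
    [TopologicalSpace (TotalSpace (Fin r → ℂ) E)] [FiberBundle (Fin r → ℂ) E]
    [VectorBundle ℂ (Fin r → ℂ) E] (x : X) : FiniteDimensional ℂ (E x) :=
  LinearEquiv.finiteDimensional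
    ((trivializationAt (Fin r → ℂ) E x).continuousLinearEquivAt ℂ x
      (FiberBundle.mem_baseSet_trivializationAt' x)).toLinearEquiv.symm

variable (r E) in
theorem finrank_fibre (x : X) : Module.finrank ℂ (E x) = r := by
  rw [((trivializationAt (Fin r → ℂ) E x).continuousLinearEquivAt ℂ x
      (FiberBundle.mem_baseSet_trivializationAt' x)).toLinearEquiv.finrank_eq]
  simp

namespace HermitianMetric

theorem isUnitary_unitaryFrame (h : HermitianMetric n r E) (x : X) :
    h.IsUnitary x (h.unitaryFrame x) :=
  (h.exists_isUnitary x).choose_spec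

theorem IsUnitary.eq_sum {h : HermitianMetric n r E} {x : X} {e : Fin r → E x}
    (he : h.IsUnitary x e) (u : E x) : u = ∑ i, h.form x (e i) u • e i :=
  have := finiteDimensional_fibre r E x
  eq_sum_of_unitary (finrank_fibre r E x) he u

end HermitianMetric

theorem endNorm_nonneg (h : HermitianMetric n r E) (x : X) (T : E x →ₗ[ℂ] E x) :
    0 ≤ endNorm h x T := Real.sqrt_nonneg _

theorem endNorm_sq (h : HermitianMetric n r E) (x : X) (T : E x →ₗ[ℂ] E x) {e : Fin r → E x}
    (he : h.IsUnitary x e) : endNorm h x T ^ 2 = ∑ i, ∑ j, ‖h.form x (e i) (T (e j))‖ ^ 2 := by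
  have := finiteDimensional_fibre r E x
  rw [endNorm, Real.sq_sqrt (by positivity)]
  exact sum_norm_sq_unitary (finrank_fibre r E x) (h.conj_symm x) (h.isUnitary_unitaryFrame x) he T

theorem norm_form_le_endNorm (h : HermitianMetric n r E) (x : X) (T : E x →ₗ[ℂ] E x)
    {e : Fin r → E x} (he : h.IsUnitary x e) (i j : Fin r) :
    ‖h.form x (e i) (T (e j))‖ ≤ endNorm h x T := by
  refine abs_le_of_sq_le_sq' ?_ (endNorm_nonneg h x T) |>.2
  rw [endNorm_sq h x T he]
  calc ‖h.form x (e i) (T (e j))‖ ^ 2 ≤ ∑ j, ‖h.form x (e i) (T (e j))‖ ^ 2 :=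
        Finset.single_le_sum (f := fun j => ‖h.form x (e i) (T (e j))‖ ^ 2)
          (fun _ _ => by positivity) (Finset.mem_univ j)
    _ ≤ _ := Finset.single_le_sum (f := fun i => ∑ j, ‖h.form x (e i) (T (e j))‖ ^ 2)
          (fun _ _ => by positivity) (Finset.mem_univ i)

/-- In a unitary frame the adjoint has the conjugate transpose matrix, which has the same
Hilbert-Schmidt norm. -/
theorem endNorm_adjoint (h : HermitianMetric n r E) (x : X) {S T : E x →ₗ[ℂ] E x}
    (hST : ∀ u v, h.form x (S u) v = h.form x u (T v)) : endNorm h x S = endNorm h x T := by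
  rw [endNorm, endNorm]
  congr 1
  rw [Finset.sum_comm]
  refine Finset.sum_congr rfl fun i _ => Finset.sum_congr rfl fun j _ => ?_
  rw [← hST, ← h.conj_symm, RCLike.norm_conj]

/-- The spectral theorem guarantees that the default value `0` in `energyDensity` is not taken where
`w` is self-adjoint. -/
theorem exists_isEigenframe (h : HermitianMetric n r E) (x : X) {T : E x →ₗ[ℂ] E x}
    (hT : ∀ u v, h.form x (T u) v = h.form x u (T v)) : ∃ b, IsEigenframe h x T b := by
  have := finiteDimensional_fibre r E x
  obtain ⟨e, l, he, hl⟩ := exists_unitary_eigenvectors (finrank_fibre r E x) (h.conj_symm x)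
    (h.pos x) hT
  exact ⟨(e, l), he, hl⟩

theorem abs_eigenvalue_le_endNorm {h : HermitianMetric n r E} {x : X} {T : E x →ₗ[ℂ] E x}
    {b : (Fin r → E x) × (Fin r → ℝ)} (hb : IsEigenframe h x T b) (i : Fin r) :
    |b.2 i| ≤ endNorm h x T := by
  have := norm_form_le_endNorm h x T hb.1 i i
  rw [hb.2, map_smul, hb.1 i i, if_pos rfl] at this
  simpa using this

section Density

variable [IsManifold 𝓘(ℂ, Fin n → ℂ) ω X]
  (g : HermitianMetric n n (HolTangent n X)) (h : HermitianMetric n r E)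

/-- The pointwise squared norm of the `(0,1)`-part of the weak derivative. -/
noncomputable def antiNormSq (w : EndSection E) (x : X) : ℝ :=
  ∑ k, endNorm h x ((weakDerivative h w).anti x (g.unitaryFrame x k)) ^ 2

theorem phi_nonneg (t : ℝ) : 0 ≤ phi t := le_trans (by positivity) (phi_ge t)

theorem energyDensity_nonneg (w : EndSection E) (x : X) : 0 ≤ energyDensity g h w x := by
  rw [energyDensity]
  split_ifs with hx
  · exact Finset.sum_nonneg fun i _ => Finset.sum_nonneg fun j _ =>
      mul_nonneg (phi_nonneg _) (Finset.sum_nonneg fun k _ => sq_nonneg _)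
  · exact le_rfl

/-- Each eigenvalue is at most `|w|` in absolute value, so each difference is at most `2|w|`, and by
`phi_ge` every weight in `f_w` is at least `1/(4(1+2|w|))`. The unweighted sum over the eigenframe
is `|∂̄w|²`, since the Hilbert-Schmidt norm may be computed in any unitary frame. -/
theorem antiNormSq_le_energyDensity (w : EndSection E) (x : X)
    (hw : ∀ u v, h.form x (w x u) v = h.form x u (w x v)) :
    antiNormSq g h w x ≤ 4 * (1 + 2 * endNorm h x (w x)) * energyDensity g h w x := by
  have hx := exists_isEigenframe h x hw
  rw [energyDensity, dif_pos hx]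
  have hb := hx.choose_spec
  set b := hx.choose
  have hN := endNorm_nonneg h x (w x)
  set N := endNorm h x (w x)
  have h1 : antiNormSq g h w x = ∑ i, ∑ j, ∑ k,
      ‖h.form x (b.1 i) ((weakDerivative h w).anti x (g.unitaryFrame x k) (b.1 j))‖ ^ 2 := by
    rw [antiNormSq]
    simp only [endNorm_sq h x _ hb.1]
    rw [Finset.sum_comm]
    exact Finset.sum_congr rfl fun i _ => Finset.sum_comm
  rw [h1, Finset.mul_sum]
  refine Finset.sum_le_sum fun i _ => ?_
  rw [Finset.mul_sum]
  refine Finset.sum_le_sum fun j _ => ?_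
  rw [← mul_assoc]
  refine le_mul_of_one_le_left (by positivity) ?_
  have h2 : |b.2 i - b.2 j| ≤ 2 * N := by
    have := abs_sub (b.2 i) (b.2 j)
    have h3 := abs_eigenvalue_le_endNorm hb i
    have h4 := abs_eigenvalue_le_endNorm hb j
    linarith
  have h3 := phi_ge (b.2 i - b.2 j)
  have h4 : 1 / (4 * (1 + 2 * N)) ≤ phi (b.2 i - b.2 j) := by
    refine le_trans ?_ h3
    apply one_div_le_one_div_of_le <;> [positivity; gcongr]
  calc (1 : ℝ) = 4 * (1 + 2 * N) * (1 / (4 * (1 + 2 * N))) := by field_simp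
    _ ≤ _ := by gcongr

end Density

end HermBundle

/-! ### Changes of frame and of chart -/

namespace HermBundle

open Matrix Topology
open scoped ComplexOrder

variable {n r : ℕ} {X : Type*} [TopologicalSpace X] [ChartedSpace (Fin n → ℂ) X]
  {E : X → Type*} [∀ x, AddCommGroup (E x)] [∀ x, Module ℂ (E x)] [∀ x, TopologicalSpace (E x)]
  [TopologicalSpace (TotalSpace (Fin r → ℂ) E)] [FiberBundle (Fin r → ℂ) E]
  [VectorBundle ℂ (Fin r → ℂ) E]

section Frames

variable (r E) in
/-- The domain of the frame attached to `a`. -/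
abbrev frameSet (a : X) : Set X := (trivializationAt (Fin r → ℂ) E a).baseSet

variable (r E) in
/-- The matrix that converts coordinates in the frame attached to `a` to coordinates in the frame
attached to `b`. -/
noncomputable def transition (a b x : X) : Matrix (Fin r) (Fin r) ℂ :=
  LinearMap.toMatrix' ((trivializationAt (Fin r → ℂ) E b).linearMapAt ℂ x ∘ₗ
    (trivializationAt (Fin r → ℂ) E a).symmₗ ℂ x)

theorem localVector_localCoord {a x : X} (hx : x ∈ frameSet r E a) (u : E x) :
    localVector r E a x (localCoord r a x u) = u :=
  (trivializationAt (Fin r → ℂ) E a).symmₗ_linearMapAt hx u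

theorem localCoord_localVector {a x : X} (hx : x ∈ frameSet r E a) (c : Fin r → ℂ) :
    localCoord r a x (localVector r E a x c) = c :=
  (trivializationAt (Fin r → ℂ) E a).linearMapAt_symmₗ hx c

theorem transition_mulVec (a b x : X) (c : Fin r → ℂ) :
    transition r E a b x *ᵥ c = localCoord r b x (localVector r E a x c) := by
  rw [transition, LinearMap.toMatrix'_mulVec]; rfl

theorem transition_mul_transition {a b c x : X} (hx : x ∈ frameSet r E b) :
    transition r E b c x * transition r E a b x = transition r E a c x := by
  rw [transition, transition, ← LinearMap.toMatrix'_comp, transition]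
  congr 1
  refine LinearMap.ext fun u => ?_
  simp [(trivializationAt (Fin r → ℂ) E b).symmₗ_linearMapAt hx]

theorem transition_self {a x : X} (hx : x ∈ frameSet r E a) : transition r E a a x = 1 := by
  rw [transition, ← LinearMap.toMatrix'_id]
  congr 1
  exact LinearMap.ext fun u => (trivializationAt (Fin r → ℂ) E a).linearMapAt_symmₗ hx u

theorem localMatrix_mulVec {a x : X} (hx : x ∈ frameSet r E a) (T : E x →ₗ[ℂ] E x) (u : E x) :
    localMatrix r a x T *ᵥ localCoord r a x u = localCoord r a x (T u) := by
  rw [localMatrix, LinearMap.toMatrix'_mulVec]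
  simp [localCoord, (trivializationAt (Fin r → ℂ) E a).symmₗ_linearMapAt hx]

theorem localMatrix_eq_transition {a b x : X} (hx : x ∈ frameSet r E b) (T : E x →ₗ[ℂ] E x) :
    localMatrix r a x T = transition r E b a x * localMatrix r b x T * transition r E a b x := by
  rw [localMatrix, transition, localMatrix, transition, ← LinearMap.toMatrix'_comp,
    ← LinearMap.toMatrix'_comp]
  congr 1
  refine LinearMap.ext fun u => ?_
  simp [(trivializationAt (Fin r → ℂ) E b).symmₗ_linearMapAt hx]

/-- The Gram matrix of the frame attached to `a` at a point. -/
noncomputable def HermitianMetric.gramAt (h : HermitianMetric n r E) (a x : X) :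
    Matrix (Fin r) (Fin r) ℂ :=
  Matrix.of fun i j => h.form x (localVector r E a x (Pi.single i 1))
    (localVector r E a x (Pi.single j 1))

theorem localVector_eq_sum (a x : X) (c : Fin r → ℂ) :
    localVector r E a x c = ∑ i, c i • localVector r E a x (Pi.single i 1) := by
  conv_lhs => rw [pi_eq_sum_univ' c]
  simp only [localVector, map_sum, map_smul]

theorem HermitianMetric.form_localVector (h : HermitianMetric n r E) (a x : X)
    (c d : Fin r → ℂ) :
    h.form x (localVector r E a x c) (localVector r E a x d) =
      star c ⬝ᵥ (h.gramAt a x *ᵥ d) := by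
  rw [localVector_eq_sum a x c, localVector_eq_sum a x d]
  simp only [map_sum, LinearMap.map_smulₛₗ, LinearMap.sum_apply, LinearMap.smul_apply,
    dotProduct, mulVec, gramAt, Matrix.of_apply, smul_eq_mul, Pi.star_apply, RingHom.id_apply,
    Finset.mul_sum]
  refine (Finset.sum_comm).trans ?_
  refine Finset.sum_congr rfl fun i _ => Finset.sum_congr rfl fun j _ => ?_
  simp only [Complex.star_def]
  ring

theorem HermitianMetric.form_eq (h : HermitianMetric n r E) {a x : X} (hx : x ∈ frameSet r E a)
    (u v : E x) : h.form x u v =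
      star (localCoord r a x u) ⬝ᵥ (h.gramAt a x *ᵥ localCoord r a x v) := by
  rw [← h.form_localVector, localVector_localCoord hx, localVector_localCoord hx]

theorem HermitianMetric.gramAt_conjTranspose (h : HermitianMetric n r E) (a x : X) :
    (h.gramAt a x)ᴴ = h.gramAt a x := by
  ext i j
  rw [Matrix.conjTranspose_apply]
  simp only [gramAt, Matrix.of_apply]
  exact h.conj_symm _ _ _

theorem HermitianMetric.gramAt_posDef (h : HermitianMetric n r E) {a x : X}
    (hx : x ∈ frameSet r E a) : (h.gramAt a x).PosDef := by
  refine Matrix.PosDef.of_dotProduct_mulVec_pos (h.gramAt_conjTranspose a x) fun c hc => ?_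
  rw [← h.form_localVector]
  have hne : localVector r E a x c ≠ 0 := fun h0 => hc (by
    rw [← localCoord_localVector hx c, h0, localCoord, map_zero])
  have him : (h.form x (localVector r E a x c) (localVector r E a x c)).im = 0 := by
    have := h.conj_symm x (localVector r E a x c) (localVector r E a x c)
    exact Complex.conj_eq_iff_im.1 this
  rw [Complex.pos_iff]
  exact ⟨h.pos x _ hne, him.symm⟩

/-- A Hermitian form changes by `T* H T`. For the tangent bundle this is the transformation law of
`ωⁿ`; for `E` it is the source of the gauge law of the connection. -/
theorem HermitianMetric.gramAt_eq_transition (h : HermitianMetric n r E) {a b x : X}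
    (hx : x ∈ frameSet r E b) :
    h.gramAt a x = (transition r E a b x)ᴴ * h.gramAt b x * transition r E a b x := by
  ext i j
  change h.form x _ _ = _
  rw [h.form_eq hx, ← transition_mulVec, ← transition_mulVec]
  simp only [mulVec_single_one, Matrix.mul_assoc]
  rfl

theorem HermitianMetric.isUnit_det_gramAt (h : HermitianMetric n r E) {a x : X}
    (hx : x ∈ frameSet r E a) : IsUnit (h.gramAt a x).det :=
  (h.gramAt_posDef hx).det_pos.ne'.isUnit

end Frames

section Charts

variable (n) in
/-- The change of coordinates from the chart at `a` to the chart at `b`. -/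
noncomputable def chartChange (a b : X) (y : Fin n → ℂ) : Fin n → ℂ :=
  chartAt (Fin n → ℂ) b ((chartAt (Fin n → ℂ) a).symm y)

variable (n) in
/-- The domain of the change of coordinates. -/
def overlap (a b : X) : Set (Fin n → ℂ) :=
  (chartAt (Fin n → ℂ) a).target ∩
    (chartAt (Fin n → ℂ) a).symm ⁻¹' (chartAt (Fin n → ℂ) b).source

theorem isOpen_overlap (a b : X) : IsOpen (overlap n a b) :=
  (chartAt (Fin n → ℂ) a).symm.isOpen_inter_preimage (chartAt (Fin n → ℂ) b).open_source

theorem symm_chartChange {a b : X} {y : Fin n → ℂ} (hy : y ∈ overlap n a b) :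
    (chartAt (Fin n → ℂ) b).symm (chartChange n a b y) = (chartAt (Fin n → ℂ) a).symm y :=
  (chartAt (Fin n → ℂ) b).left_inv hy.2

theorem chartChange_mem {a b : X} {y : Fin n → ℂ} (hy : y ∈ overlap n a b) :
    chartChange n a b y ∈ overlap n b a := by
  refine ⟨(chartAt (Fin n → ℂ) b).map_source hy.2, ?_⟩
  rw [Set.mem_preimage, symm_chartChange hy]
  exact (chartAt (Fin n → ℂ) a).map_target hy.1

theorem chartChange_chartChange {a b : X} {y : Fin n → ℂ} (hy : y ∈ overlap n a b) :
    chartChange n b a (chartChange n a b y) = y := by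
  rw [chartChange, symm_chartChange hy, (chartAt (Fin n → ℂ) a).right_inv hy.1]

theorem isOpen_localDomain (a : X) : IsOpen (localDomain n r E a) :=
  (chartAt (Fin n → ℂ) a).symm.isOpen_inter_preimage
    (trivializationAt (Fin r → ℂ) E a).open_baseSet

variable [IsManifold 𝓘(ℂ, Fin n → ℂ) ω X]

theorem contDiffOn_chartChange (a b : X) :
    ContDiffOn ℂ ω (chartChange n a b) (overlap n a b) := by
  have h1 : ContMDiffOn 𝓘(ℂ, Fin n → ℂ) 𝓘(ℂ, Fin n → ℂ) ω (chartChange n a b) (overlap n a b) :=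
    (contMDiffOn_chart (x := b)).comp
      ((contMDiffOn_chart_symm (x := a)).mono Set.inter_subset_left) fun y hy => hy.2
  exact contMDiffOn_iff_contDiffOn.1 h1

theorem differentiableAt_chartChange {a b : X} {y : Fin n → ℂ} (hy : y ∈ overlap n a b) :
    DifferentiableAt ℂ (chartChange n a b) y :=
  ((contDiffOn_chartChange a b).contDiffAt ((isOpen_overlap a b).mem_nhds hy)).differentiableAt
    (by simp)

theorem frameSet_tangent (a : X) :
    frameSet n (HolTangent n X) a = (chartAt (Fin n → ℂ) a).source :=
  TangentBundle.trivializationAt_baseSet a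

/-- The transition matrix of the tangent bundle is the Jacobian matrix of the change of
coordinates. -/
theorem transition_tangent_mulVec {a b : X} {y : Fin n → ℂ} (hy : y ∈ overlap n a b)
    (v : Fin n → ℂ) :
    transition n (HolTangent n X) a b ((chartAt (Fin n → ℂ) a).symm y) *ᵥ v =
      fderiv ℂ (chartChange n a b) y v := by
  set x := (chartAt (Fin n → ℂ) a).symm y with hx
  have hxa : x ∈ (chartAt (Fin n → ℂ) a).source := (chartAt (Fin n → ℂ) a).map_target hy.1
  have hxb : x ∈ (chartAt (Fin n → ℂ) b).source := hy.2
  have e1 := TangentBundle.symmL_trivializationAt_eq_core (I := 𝓘(ℂ, Fin n → ℂ)) hxa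
  have e2 := TangentBundle.continuousLinearMapAt_trivializationAt_eq_core
    (I := 𝓘(ℂ, Fin n → ℂ)) hxb
  rw [transition_mulVec]
  have e3 : localVector n (HolTangent n X) a x v =
      tangentCoordChange 𝓘(ℂ, Fin n → ℂ) a x x v := congrArg (fun L => L v) e1
  have e4 : ∀ u : HolTangent n X x, localCoord n b x u =
      tangentCoordChange 𝓘(ℂ, Fin n → ℂ) x b x u := fun u => congrArg (fun L => L u) e2
  rw [e3]
  refine (e4 _).trans ((tangentCoordChange_comp (I := 𝓘(ℂ, Fin n → ℂ)) ⟨⟨?_, ?_⟩, ?_⟩).trans ?_)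
  · simpa using hxa
  · simp
  · simpa using hxb
  · rw [tangentCoordChange_def]
    simp only [modelWithCornersSelf_coe, Set.range_id, fderivWithin_univ]
    have : extChartAt 𝓘(ℂ, Fin n → ℂ) a x = y := by
      simpa [hx] using (chartAt (Fin n → ℂ) a).right_inv hy.1
    rw [this]
    rfl

theorem transition_tangent_eq {a b : X} {y : Fin n → ℂ} (hy : y ∈ overlap n a b) :
    transition n (HolTangent n X) a b ((chartAt (Fin n → ℂ) a).symm y) =
      LinearMap.toMatrix' (fderiv ℂ (chartChange n a b) y : (Fin n → ℂ) →ₗ[ℂ] (Fin n → ℂ)) := by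
  apply Matrix.toLin'.injective
  refine LinearMap.ext fun v => ?_
  rw [Matrix.toLin'_apply, Matrix.toLin'_toMatrix', transition_tangent_mulVec hy]
  rfl

variable [ContMDiffVectorBundle ω (Fin r → ℂ) E 𝓘(ℂ, Fin n → ℂ)]

/-- The transition functions of a holomorphic bundle are holomorphic in every chart. -/
theorem contDiffAt_transition (a b c : X) {y : Fin n → ℂ}
    (hy : y ∈ (chartAt (Fin n → ℂ) c).target)
    (hya : (chartAt (Fin n → ℂ) c).symm y ∈ frameSet r E a)
    (hyb : (chartAt (Fin n → ℂ) c).symm y ∈ frameSet r E b) (i j : Fin r) :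
    ContDiffAt ℂ ω
      (fun z => transition r E a b ((chartAt (Fin n → ℂ) c).symm z) i j) y := by
  set s := (chartAt (Fin n → ℂ) c).symm
  set e := trivializationAt (Fin r → ℂ) E a
  set e' := trivializationAt (Fin r → ℂ) E b
  set U : Set (Fin n → ℂ) := (chartAt (Fin n → ℂ) c).target ∩ s ⁻¹' (e.baseSet ∩ e'.baseSet)
  have hU : IsOpen U := s.isOpen_inter_preimage (e.open_baseSet.inter e'.open_baseSet)
  have h1 : ContMDiffOn 𝓘(ℂ, Fin n → ℂ) 𝓘(ℂ, (Fin r → ℂ) →L[ℂ] (Fin r → ℂ)) ω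
      (fun z => (e.coordChangeL ℂ e' (s z) : (Fin r → ℂ) →L[ℂ] (Fin r → ℂ))) U :=
    (contMDiffOn_coordChangeL (IB := 𝓘(ℂ, Fin n → ℂ)) e e').comp
      ((contMDiffOn_chart_symm (x := c)).mono Set.inter_subset_left) fun z hz => hz.2
  have h2 := contMDiffOn_iff_contDiffOn.1 h1
  have hyU : y ∈ U := ⟨hy, hya, hyb⟩
  have h3 := h2.contDiffAt (hU.mem_nhds hyU)
  have h4 : ContDiffAt ℂ ω (fun z => (e.coordChangeL ℂ e' (s z) :
      (Fin r → ℂ) →L[ℂ] (Fin r → ℂ)) (Pi.single j 1) i) y :=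
    contDiffAt_pi.1 (h3.clm_apply contDiffAt_const) i
  refine h4.congr_of_eventuallyEq ?_
  filter_upwards [hU.mem_nhds hyU] with z hz
  rw [transition, LinearMap.toMatrix'_apply]
  rw [ContinuousLinearEquiv.coe_coe, Trivialization.coordChangeL_apply e e' hz.2]
  simp only [LinearMap.comp_apply, Trivialization.linearMapAt_apply]
  rw [if_pos (show s z ∈ (trivializationAt (Fin r → ℂ) E b).baseSet from hz.2.2), Trivialization.coe_symmₗ]
  exact hz.2.1

end Charts

end HermBundle

/-! ### The measure of the Kähler volume, compared with Lebesgue measure in charts -/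

namespace HermBundle

open Matrix Topology
open scoped ComplexOrder

theorem measurableSet_inter_preimage_of_continuousOn {α β : Type*} [TopologicalSpace α]
    [MeasurableSpace α] [OpensMeasurableSpace α] [TopologicalSpace β] [MeasurableSpace β]
    [BorelSpace β] {f : α → β} {t : Set α} (hf : ContinuousOn f t) (ht : MeasurableSet t)
    {S : Set β} (hS : MeasurableSet S) : MeasurableSet (t ∩ f ⁻¹' S) := by
  have h := (continuousOn_iff_continuous_domRestrict.1 hf).measurable hS
  have := ht.subtype_image h
  convert this using 1
  ext x
  simp [and_comm]

/-- The real determinant of a complex linear map is the norm, from `ℂ` to `ℝ`, of its complex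
determinant. -/
theorem det_restrictScalars_eq_normSq {n : ℕ} (L : (Fin n → ℂ) →L[ℂ] (Fin n → ℂ)) :
    (L.restrictScalars ℝ).det =
      Complex.normSq (LinearMap.toMatrix' (L : (Fin n → ℂ) →ₗ[ℂ] (Fin n → ℂ))).det := by
  rw [LinearMap.det_toMatrix', ← Algebra.norm_complex_apply]
  exact LinearMap.det_restrictScalars (R := ℝ) (S := ℂ) (f := (L : (Fin n → ℂ) →ₗ[ℂ] (Fin n → ℂ)))

variable {n r : ℕ} {X : Type*} [TopologicalSpace X] [ChartedSpace (Fin n → ℂ) X]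
  {E : X → Type*} [∀ x, AddCommGroup (E x)] [∀ x, Module ℂ (E x)] [∀ x, TopologicalSpace (E x)]
  [TopologicalSpace (TotalSpace (Fin r → ℂ) E)] [FiberBundle (Fin r → ℂ) E]
  [VectorBundle ℂ (Fin r → ℂ) E]

section Cover

/-- The image of a closed ball in the chart at `a`. -/
def chartBall (n : ℕ) {X : Type*} [TopologicalSpace X] [ChartedSpace (Fin n → ℂ) X]
    (a : X) (R : ℝ) : Set X :=
  (chartAt (Fin n → ℂ) a).symm '' Metric.closedBall (chartAt (Fin n → ℂ) a a) R

theorem mem_localDomain_self (a : X) :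
    chartAt (Fin n → ℂ) a a ∈ localDomain n r E a := by
  refine ⟨mem_chart_target _ a, ?_⟩
  rw [Set.mem_preimage, (chartAt (Fin n → ℂ) a).left_inv (mem_chart_source _ a)]
  exact FiberBundle.mem_baseSet_trivializationAt' a

theorem localDomain_subset_target (a : X) :
    localDomain n r E a ⊆ (chartAt (Fin n → ℂ) a).target := Set.inter_subset_left

theorem isCompact_chartBall {a : X} {R : ℝ}
    (h : Metric.closedBall (chartAt (Fin n → ℂ) a a) R ⊆ (chartAt (Fin n → ℂ) a).target) :
    IsCompact (chartBall n a R) :=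
  (isCompact_closedBall _ _).image_of_continuousOn
    ((chartAt (Fin n → ℂ) a).continuousOn_symm.mono h)

theorem chartBall_subset_source {a : X} {R : ℝ}
    (h : Metric.closedBall (chartAt (Fin n → ℂ) a a) R ⊆ (chartAt (Fin n → ℂ) a).target) :
    chartBall n a R ⊆ (chartAt (Fin n → ℂ) a).source := by
  rintro _ ⟨y, hy, rfl⟩
  exact (chartAt (Fin n → ℂ) a).map_target (h hy)

variable (n r E) in
/-- Finitely many coordinate balls over which the frames exist cover a compact manifold. -/
theorem exists_chartBall_cover [CompactSpace X] : ∃ (I : Finset X) (R : X → ℝ),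
    (∀ a, 0 < R a ∧ Metric.closedBall (chartAt (Fin n → ℂ) a a) (4 * R a) ⊆ localDomain n r E a) ∧
    ∀ x, ∃ a ∈ I, x ∈ chartBall n a (R a) := by
  have h1 : ∀ a : X, ∃ R : ℝ, 0 < R ∧
      Metric.closedBall (chartAt (Fin n → ℂ) a a) (4 * R) ⊆ localDomain n r E a := by
    intro a
    obtain ⟨ε, hε, hs⟩ := Metric.nhds_basis_closedBall.mem_iff.1
      ((isOpen_localDomain (n := n) (r := r) (E := E) a).mem_nhds (mem_localDomain_self a))
    exact ⟨ε / 4, by positivity, by convert hs using 2; ring⟩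
  choose R hR hs using h1
  have h2 : ∀ a : X, chartBall n a (R a) ∈ 𝓝 a := by
    intro a
    have h3 : (chartAt (Fin n → ℂ) a).source ∩ chartAt (Fin n → ℂ) a ⁻¹'
        Metric.ball (chartAt (Fin n → ℂ) a a) (R a) ∈ 𝓝 a :=
      ((chartAt (Fin n → ℂ) a).isOpen_inter_preimage Metric.isOpen_ball).mem_nhds
        ⟨mem_chart_source _ a, Metric.mem_ball_self (hR a)⟩
    refine Filter.mem_of_superset h3 fun x hx => ?_
    exact ⟨_, Metric.ball_subset_closedBall hx.2, (chartAt (Fin n → ℂ) a).left_inv hx.1⟩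
  obtain ⟨I, hI⟩ := CompactSpace.elim_nhds_subcover (fun a => chartBall n a (R a)) h2
  refine ⟨I, R, fun a => ⟨hR a, hs a⟩, fun x => ?_⟩
  have : x ∈ ⋃ a ∈ I, chartBall n a (R a) := by rw [hI]; trivial
  simpa using this

end Cover

section Volume

theorem gram_eq_gramAt (h : HermitianMetric n r E) (a : X) (y : Fin n → ℂ) :
    h.gram a y = h.gramAt a ((chartAt (Fin n → ℂ) a).symm y) := rfl

theorem continuousOn_gram (h : HermitianMetric n r E) (a : X) :
    ContinuousOn (h.gram a) (localDomain n r E a) := by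
  refine continuousOn_pi.2 fun i => continuousOn_pi.2 fun j => ?_
  exact (h.smooth a i j).continuousOn

variable [IsManifold 𝓘(ℂ, Fin n → ℂ) ω X]

theorem symm_mem_frameSet_tangent {a : X} {y : Fin n → ℂ}
    (hy : y ∈ (chartAt (Fin n → ℂ) a).target) :
    (chartAt (Fin n → ℂ) a).symm y ∈ frameSet n (HolTangent n X) a := by
  rw [frameSet_tangent]
  exact (chartAt (Fin n → ℂ) a).map_target hy

theorem localDomain_tangent (a : X) :
    localDomain n n (HolTangent n X) a = (chartAt (Fin n → ℂ) a).target := by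
  refine Set.inter_eq_left.2 fun y hy => ?_
  exact symm_mem_frameSet_tangent hy

variable [MeasurableSpace X] [BorelSpace X] (g : HermitianMetric n n (HolTangent n X))

/-- The density of `ωⁿ` with respect to Lebesgue measure in the chart at `a`. -/
noncomputable def volumeDensity (a : X) (y : Fin n → ℂ) : ℝ :=
  (n.factorial : ℝ) * 2 ^ n * (g.gram a y).det.re

theorem volumeDensity_pos {a : X} {y : Fin n → ℂ} (hy : y ∈ (chartAt (Fin n → ℂ) a).target) :
    0 < volumeDensity g a y := by
  have := (g.gramAt_posDef (symm_mem_frameSet_tangent hy)).det_pos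
  rw [← gram_eq_gramAt, Complex.pos_iff] at this
  have := this.1
  rw [volumeDensity]
  positivity

theorem continuousOn_volumeDensity (a : X) :
    ContinuousOn (volumeDensity g a) (chartAt (Fin n → ℂ) a).target := by
  have h := continuousOn_gram g a
  rw [localDomain_tangent] at h
  refine continuousOn_const.mul (Complex.continuous_re.comp_continuousOn ?_)
  exact (Continuous.matrix_det continuous_id).comp_continuousOn h

/-- The Gram matrix changes by `J* G J` with `J` the complex Jacobian matrix, so its determinant
picks up `|det J|²`, the real Jacobian of the change of coordinates. -/
theorem volumeDensity_chartChange {a b : X} {y : Fin n → ℂ} (hy : y ∈ overlap n a b) :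
    volumeDensity g a y =
      |((fderiv ℂ (chartChange n a b) y).restrictScalars ℝ).det| *
        volumeDensity g b (chartChange n a b y) := by
  have hx : (chartAt (Fin n → ℂ) a).symm y ∈ frameSet n (HolTangent n X) b := by
    rw [frameSet_tangent]; exact hy.2
  have h1 : g.gram a y = (transition n (HolTangent n X) a b ((chartAt (Fin n → ℂ) a).symm y))ᴴ *
      g.gram b (chartChange n a b y) *
        transition n (HolTangent n X) a b ((chartAt (Fin n → ℂ) a).symm y) := by
    rw [gram_eq_gramAt, gram_eq_gramAt, symm_chartChange hy]
    exact g.gramAt_eq_transition hx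
  rw [det_restrictScalars_eq_normSq, ← transition_tangent_eq hy,
    abs_of_nonneg (Complex.normSq_nonneg _), volumeDensity, volumeDensity, h1]
  set J := transition n (HolTangent n X) a b ((chartAt (Fin n → ℂ) a).symm y)
  rw [Matrix.det_mul, Matrix.det_mul, Matrix.det_conjTranspose]
  have : star J.det * (g.gram b (chartChange n a b y)).det * J.det =
      (Complex.normSq J.det : ℂ) * (g.gram b (chartChange n a b y)).det := by
    rw [Complex.normSq_eq_conj_mul_self, Complex.star_def]; ring
  rw [this, Complex.re_ofReal_mul]
  ring

theorem chartVolume_apply (a : X) {S : Set X} (hS : MeasurableSet S) :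
    chartVolume g a S = ∫⁻ y in (chartAt (Fin n → ℂ) a).target ∩
      (chartAt (Fin n → ℂ) a).symm ⁻¹' S, ENNReal.ofReal (volumeDensity g a y) := by
  have ht : MeasurableSet (chartAt (Fin n → ℂ) a).target :=
    (chartAt (Fin n → ℂ) a).open_target.measurableSet
  rw [chartVolume, Measure.map_apply_of_aemeasurable
    ((chartAt (Fin n → ℂ) a).continuousOn_symm.aemeasurable ht) hS,
    Measure.restrict_apply' ht, Set.inter_comm, withDensity_apply']
  rfl

/-- The local volume measures agree on overlaps. -/
theorem chartVolume_le_of_subset {a b : X} {S : Set X} (hS : MeasurableSet S)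
    (hSb : S ⊆ (chartAt (Fin n → ℂ) b).source) : chartVolume g a S ≤ chartVolume g b S := by
  rw [chartVolume_apply g a hS, chartVolume_apply g b hS]
  set A := (chartAt (Fin n → ℂ) a).target ∩ (chartAt (Fin n → ℂ) a).symm ⁻¹' S with hA
  have hAo : A ⊆ overlap n a b := fun y hy => ⟨hy.1, hSb hy.2⟩
  have hAm : MeasurableSet A := measurableSet_inter_preimage_of_continuousOn
    (chartAt (Fin n → ℂ) a).continuousOn_symm
    (chartAt (Fin n → ℂ) a).open_target.measurableSet hS
  have hinj : Set.InjOn (chartChange n a b) A := fun y hy z hz hyz => by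
    rw [← chartChange_chartChange (hAo hy), hyz, chartChange_chartChange (hAo hz)]
  have himg : chartChange n a b '' A ⊆ (chartAt (Fin n → ℂ) b).target ∩
      (chartAt (Fin n → ℂ) b).symm ⁻¹' S := by
    rintro _ ⟨y, hy, rfl⟩
    refine ⟨(chartChange_mem (hAo hy)).1, ?_⟩
    rw [Set.mem_preimage, symm_chartChange (hAo hy)]
    exact hy.2
  have hd : ∀ y ∈ A, HasFDerivWithinAt (chartChange n a b)
      ((fderiv ℂ (chartChange n a b) y).restrictScalars ℝ) A y := fun y hy =>
    ((differentiableAt_chartChange (hAo hy)).hasFDerivAt.restrictScalars ℝ).hasFDerivWithinAt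
  calc ∫⁻ y in A, ENNReal.ofReal (volumeDensity g a y)
      = ∫⁻ y in A, ENNReal.ofReal |((fderiv ℂ (chartChange n a b) y).restrictScalars ℝ).det| *
          ENNReal.ofReal (volumeDensity g b (chartChange n a b y)) := by
        refine setLIntegral_congr_fun hAm fun y hy => ?_
        rw [← ENNReal.ofReal_mul (abs_nonneg _), ← volumeDensity_chartChange g (hAo hy)]
    _ = ∫⁻ y in chartChange n a b '' A, ENNReal.ofReal (volumeDensity g b y) :=
        (lintegral_image_eq_lintegral_abs_det_fderiv_mul volume hAm hd hinj
          fun y => ENNReal.ofReal (volumeDensity g b y)).symm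
    _ ≤ _ := lintegral_mono_set himg

theorem chartVolume_le_kahlerVolume (a : X) : chartVolume g a ≤ kahlerVolume g :=
  le_iSup (chartVolume g) a

/-- Every chart measure is split along the cover, and on the piece `B a` it is at most the measure
of the chart at `a`. The bound does not depend on the chart, so it passes to the supremum. -/
theorem kahlerVolume_le_sum {I : Finset X} {B : X → Set X} (hB : ∀ a ∈ I, MeasurableSet (B a))
    (hsub : ∀ a ∈ I, B a ⊆ (chartAt (Fin n → ℂ) a).source) (hcov : ∀ x, ∃ a ∈ I, x ∈ B a) :
    kahlerVolume g ≤ ∑ a ∈ I, (chartVolume g a).restrict (B a) := by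
  refine iSup_le fun b => Measure.le_iff.2 fun S hS => ?_
  rw [Measure.finsetSum_apply]
  calc chartVolume g b S ≤ chartVolume g b (⋃ a ∈ I, S ∩ B a) := by
        refine measure_mono fun x hx => ?_
        obtain ⟨a, ha, hxa⟩ := hcov x
        exact Set.mem_biUnion ha ⟨hx, hxa⟩
    _ ≤ ∑ a ∈ I, chartVolume g b (S ∩ B a) := measure_biUnion_finset_le _ _
    _ ≤ ∑ a ∈ I, (chartVolume g a).restrict (B a) S := by
        refine Finset.sum_le_sum fun a ha => ?_
        rw [Measure.restrict_apply hS]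
        exact chartVolume_le_of_subset g (hS.inter (hB a ha))
          (Set.inter_subset_right.trans (hsub a ha))

theorem aemeasurable_symm {a : X} {K : Set (Fin n → ℂ)} (hK : MeasurableSet K)
    (hKt : K ⊆ (chartAt (Fin n → ℂ) a).target) :
    AEMeasurable (chartAt (Fin n → ℂ) a).symm (volume.restrict K) :=
  ((chartAt (Fin n → ℂ) a).continuousOn_symm.mono hKt).aemeasurable hK

/-- On compact subsets of a chart, Lebesgue measure is dominated by `ωⁿ`. -/
theorem exists_map_volume_le {a : X} {K : Set (Fin n → ℂ)} (hK : IsCompact K)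
    (hKt : K ⊆ (chartAt (Fin n → ℂ) a).target) : ∃ C : ℝ≥0∞, C ≠ ⊤ ∧
      (volume.restrict K).map (chartAt (Fin n → ℂ) a).symm ≤ C • chartVolume g a := by
  obtain ⟨c, hc, hcle⟩ : ∃ c : ℝ, 0 < c ∧ ∀ y ∈ K, c ≤ volumeDensity g a y := by
    rcases K.eq_empty_or_nonempty with rfl | hne
    · exact ⟨1, one_pos, by simp⟩
    · obtain ⟨z, hz, hmin⟩ := hK.exists_isMinOn hne ((continuousOn_volumeDensity g a).mono hKt)
      exact ⟨_, volumeDensity_pos g (hKt hz), fun y hy => hmin hy⟩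
  refine ⟨(ENNReal.ofReal c)⁻¹, ENNReal.inv_ne_top.2 (by simpa using hc), ?_⟩
  refine Measure.le_iff.2 fun S hS => ?_
  rw [Measure.map_apply_of_aemeasurable (aemeasurable_symm hK.measurableSet hKt) hS,
    Measure.restrict_apply' hK.measurableSet, Measure.smul_apply, chartVolume_apply g a hS,
    smul_eq_mul]
  have hc0 : ENNReal.ofReal c ≠ 0 := by simpa using hc
  calc volume ((chartAt (Fin n → ℂ) a).symm ⁻¹' S ∩ K)
      = (ENNReal.ofReal c)⁻¹ * ∫⁻ _ in K ∩ (chartAt (Fin n → ℂ) a).symm ⁻¹' S,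
          ENNReal.ofReal c := by
        rw [setLIntegral_const, ← mul_assoc, ENNReal.inv_mul_cancel hc0 ENNReal.ofReal_ne_top,
          one_mul, Set.inter_comm]
    _ ≤ (ENNReal.ofReal c)⁻¹ * ∫⁻ y in K ∩ (chartAt (Fin n → ℂ) a).symm ⁻¹' S,
          ENNReal.ofReal (volumeDensity g a y) := by
        gcongr 1
        refine setLIntegral_mono' ?_ fun y hy => ENNReal.ofReal_le_ofReal (hcle y hy.1)
        exact measurableSet_inter_preimage_of_continuousOn
          ((chartAt (Fin n → ℂ) a).continuousOn_symm.mono hKt) hK.measurableSet hS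
    _ ≤ _ := by
        gcongr 1
        exact lintegral_mono_set (Set.inter_subset_inter_left _ hKt)

/-- On compact subsets of a chart, `ωⁿ` is dominated by Lebesgue measure. -/
theorem exists_chartVolume_le [T2Space X] {a : X} {K : Set (Fin n → ℂ)} (hK : IsCompact K)
    (hKt : K ⊆ (chartAt (Fin n → ℂ) a).target) : ∃ C : ℝ≥0∞, C ≠ ⊤ ∧
      (chartVolume g a).restrict ((chartAt (Fin n → ℂ) a).symm '' K) ≤
        C • (volume.restrict K).map (chartAt (Fin n → ℂ) a).symm := by
  obtain ⟨c, hcle⟩ := hK.exists_bound_of_continuousOn ((continuousOn_volumeDensity g a).mono hKt)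
  refine ⟨ENNReal.ofReal c, ENNReal.ofReal_ne_top, ?_⟩
  have hm : MeasurableSet ((chartAt (Fin n → ℂ) a).symm '' K) :=
    (hK.image_of_continuousOn ((chartAt (Fin n → ℂ) a).continuousOn_symm.mono hKt)).measurableSet
  refine Measure.le_iff.2 fun S hS => ?_
  rw [Measure.restrict_apply hS, chartVolume_apply g a (hS.inter hm), Measure.smul_apply,
    Measure.map_apply_of_aemeasurable (aemeasurable_symm hK.measurableSet hKt) hS,
    Measure.restrict_apply' hK.measurableSet, smul_eq_mul]
  have hsub : (chartAt (Fin n → ℂ) a).target ∩ (chartAt (Fin n → ℂ) a).symm ⁻¹'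
      (S ∩ (chartAt (Fin n → ℂ) a).symm '' K) ⊆ K ∩ (chartAt (Fin n → ℂ) a).symm ⁻¹' S := by
    rintro y ⟨hy, hyS, z, hz, hzy⟩
    have : z = y := (chartAt (Fin n → ℂ) a).symm.injOn (hKt hz) hy hzy
    exact ⟨this ▸ hz, hyS⟩
  refine (lintegral_mono_set hsub).trans ?_
  rw [Set.inter_comm _ K]
  calc ∫⁻ y in K ∩ (chartAt (Fin n → ℂ) a).symm ⁻¹' S, ENNReal.ofReal (volumeDensity g a y)
      ≤ ∫⁻ _ in K ∩ (chartAt (Fin n → ℂ) a).symm ⁻¹' S, ENNReal.ofReal c := by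
        refine setLIntegral_mono' ?_ fun y hy =>
          ENNReal.ofReal_le_ofReal ((le_abs_self _).trans (hcle y hy.1))
        exact measurableSet_inter_preimage_of_continuousOn
          ((chartAt (Fin n → ℂ) a).continuousOn_symm.mono hKt) hK.measurableSet hS
    _ = _ := setLIntegral_const _ _

/-- `ωⁿ` is dominated by the images of Lebesgue measure on finitely many coordinate balls. -/
theorem exists_kahlerVolume_le [T2Space X] {I : Finset X} {R : X → ℝ}
    (hR : ∀ a, Metric.closedBall (chartAt (Fin n → ℂ) a a) (R a) ⊆ (chartAt (Fin n → ℂ) a).target)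
    (hcov : ∀ x, ∃ a ∈ I, x ∈ chartBall n a (R a)) : ∃ C : X → ℝ≥0∞, (∀ a, C a ≠ ⊤) ∧
      kahlerVolume g ≤ ∑ a ∈ I, C a •
        (volume.restrict (Metric.closedBall (chartAt (Fin n → ℂ) a a) (R a))).map
          (chartAt (Fin n → ℂ) a).symm := by
  choose C hC hle using fun a => exists_chartVolume_le g
    (isCompact_closedBall (chartAt (Fin n → ℂ) a a) (R a)) (hR a)
  exact ⟨C, hC, (kahlerVolume_le_sum g (fun a _ => (isCompact_chartBall (hR a)).measurableSet)
    (fun a _ => chartBall_subset_source (hR a)) hcov).trans (Finset.sum_le_sum fun a _ => hle a)⟩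

theorem isFiniteMeasure_kahlerVolume [CompactSpace X] [T2Space X] :
    IsFiniteMeasure (kahlerVolume g) := by
  obtain ⟨I, R, hR, hcov⟩ := exists_chartBall_cover n n (HolTangent n X)
  have hR' : ∀ a : X, Metric.closedBall (chartAt (Fin n → ℂ) a a) (R a) ⊆
      (chartAt (Fin n → ℂ) a).target := fun a =>
    (Metric.closedBall_subset_closedBall (by linarith [(hR a).1])).trans
      ((hR a).2.trans (localDomain_subset_target a))
  obtain ⟨C, hC, hle⟩ := exists_kahlerVolume_le g hR' hcov
  refine ⟨(hle Set.univ).trans_lt ?_⟩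
  rw [Measure.finsetSum_apply]
  refine ENNReal.sum_lt_top.2 fun a _ => ?_
  rw [Measure.smul_apply, smul_eq_mul, Measure.map_apply_of_aemeasurable
    (aemeasurable_symm Metric.isClosed_closedBall.measurableSet (hR' a)) MeasurableSet.univ]
  refine ENNReal.mul_lt_top (hC a).lt_top ?_
  simpa using (isCompact_closedBall (chartAt (Fin n → ℂ) a a) (R a)).measure_lt_top

/-- No measurability of `S` is assumed, while the formula for the chart measure needs it. A
measurable null hull in the coordinates, carried back to `X`, replaces `S`. -/
theorem chartVolume_eq_zero {a : X} {S : Set X} (hS : S ⊆ (chartAt (Fin n → ℂ) a).source)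
    (h : volume ((chartAt (Fin n → ℂ) a).target ∩ (chartAt (Fin n → ℂ) a).symm ⁻¹' S) = 0) :
    chartVolume g a S = 0 := by
  set N := toMeasurable volume
    ((chartAt (Fin n → ℂ) a).target ∩ (chartAt (Fin n → ℂ) a).symm ⁻¹' S) with hN
  have hN0 : volume N = 0 := by rw [hN, measure_toMeasurable, h]
  set S' := (chartAt (Fin n → ℂ) a).source ∩ chartAt (Fin n → ℂ) a ⁻¹' N
  have hS'm : MeasurableSet S' := measurableSet_inter_preimage_of_continuousOn
    (chartAt (Fin n → ℂ) a).continuousOn (chartAt (Fin n → ℂ) a).open_source.measurableSet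
    (measurableSet_toMeasurable _ _)
  have hSS' : S ⊆ S' := fun x hx => ⟨hS hx, subset_toMeasurable _ _
    ⟨(chartAt (Fin n → ℂ) a).map_source (hS hx), by
      rw [Set.mem_preimage, (chartAt (Fin n → ℂ) a).left_inv (hS hx)]; exact hx⟩⟩
  refine measure_mono_null hSS' ?_
  rw [chartVolume_apply g a hS'm]
  refine setLIntegral_measure_zero _ _ (measure_mono_null ?_ hN0)
  rintro y ⟨hy, hy'⟩
  have := hy'.2
  rwa [Set.mem_preimage, (chartAt (Fin n → ℂ) a).right_inv hy] at this

/-- A property that holds almost everywhere in every chart holds almost everywhere. -/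
theorem ae_kahlerVolume_of_forall [CompactSpace X] [T2Space X] {P : X → Prop}
    (h : ∀ a : X, ∀ᵐ y : Fin n → ℂ, y ∈ localDomain n r E a →
      P ((chartAt (Fin n → ℂ) a).symm y)) : ∀ᵐ x ∂kahlerVolume g, P x := by
  obtain ⟨I, R, hR, hcov⟩ := exists_chartBall_cover n r E
  have hR' : ∀ a : X, Metric.closedBall (chartAt (Fin n → ℂ) a a) (R a) ⊆ localDomain n r E a :=
    fun a => (Metric.closedBall_subset_closedBall (by linarith [(hR a).1])).trans (hR a).2
  have hRt := fun a => (hR' a).trans (localDomain_subset_target a)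
  have hle := kahlerVolume_le_sum g (I := I)
    (fun a _ => (isCompact_chartBall (hRt a)).measurableSet)
    (fun a _ => chartBall_subset_source (hRt a)) hcov
  rw [ae_iff]
  refine le_antisymm ((hle _).trans ?_) bot_le
  rw [Measure.finsetSum_apply]
  refine (Finset.sum_eq_zero fun a _ => ?_).le
  rw [Measure.restrict_apply' (isCompact_chartBall (hRt a)).measurableSet]
  refine chartVolume_eq_zero g (Set.inter_subset_right.trans (chartBall_subset_source (hRt a))) ?_
  refine measure_mono_null ?_ (ae_iff.1 (h a))
  rintro y ⟨hy, hyP, z, hz, hzy⟩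
  have : z = y := (chartAt (Fin n → ℂ) a).symm.injOn (hRt a hz) hy hzy
  simp only [Set.mem_ofPred_eq, Classical.not_imp]
  exact ⟨this ▸ hR' a hz, hyP⟩

/-- A property that holds almost everywhere holds almost everywhere in every chart. -/
theorem ae_chart_of_ae_kahlerVolume {P : X → Prop} (h : ∀ᵐ x ∂kahlerVolume g, P x) (a : X) :
    ∀ᵐ y : Fin n → ℂ, y ∈ (chartAt (Fin n → ℂ) a).target →
      P ((chartAt (Fin n → ℂ) a).symm y) := by
  have ht : MeasurableSet (chartAt (Fin n → ℂ) a).target :=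
    (chartAt (Fin n → ℂ) a).open_target.measurableSet
  have h1 : ∀ᵐ x ∂chartVolume g a, P x :=
    h.filter_mono (ae_mono (chartVolume_le_kahlerVolume g a))
  have h2 := ae_of_ae_map ((chartAt (Fin n → ℂ) a).continuousOn_symm.aemeasurable ht) h1
  rw [restrict_withDensity ht] at h2
  have hm : AEMeasurable (fun y => ENNReal.ofReal (volumeDensity g a y))
      (volume.restrict (chartAt (Fin n → ℂ) a).target) :=
    ((continuousOn_volumeDensity g a).aemeasurable ht).ennreal_ofReal
  have h3 := (ae_withDensity_iff' hm).1 h2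
  -- A measure with density ignores the points of zero density; there are none, because the Gram
  -- matrix is positive definite.
  filter_upwards [(ae_restrict_iff' ht).1 h3] with y hy hyt
  exact hy hyt (by simpa using volumeDensity_pos g hyt)

end Volume

end HermBundle

/-! ### Weak Wirtinger derivatives on open subsets of `ℂⁿ` -/

namespace HermBundle

open Topology

section Wirtinger

variable {n : ℕ}

theorem dHol_mul {f m : (Fin n → ℂ) → ℂ} {y : Fin n → ℂ} (hf : DifferentiableAt ℝ f y)
    (hm : DifferentiableAt ℝ m y) (v : Fin n → ℂ) :
    dHol (fun z => f z * m z) y v = dHol f y v * m y + f y * dHol m y v := by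
  simp only [dHol, fderiv_fun_mul hf hm, add_apply, smul_apply, smul_eq_mul]
  ring

theorem dBar_mul {f m : (Fin n → ℂ) → ℂ} {y : Fin n → ℂ} (hf : DifferentiableAt ℝ f y)
    (hm : DifferentiableAt ℝ m y) (v : Fin n → ℂ) :
    dBar (fun z => f z * m z) y v = dBar f y v * m y + f y * dBar m y v := by
  simp only [dBar, fderiv_fun_mul hf hm, add_apply, smul_apply, smul_eq_mul]
  ring

theorem dHol_add_dBar (f : (Fin n → ℂ) → ℂ) (y v : Fin n → ℂ) :
    dHol f y v + dBar f y v = fderiv ℝ f y v := by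
  rw [dHol, dBar]; ring

theorem fderiv_conj_comp (f : (Fin n → ℂ) → ℂ) (y v : Fin n → ℂ) :
    fderiv ℝ (fun z => conj (f z)) y v = conj (fderiv ℝ f y v) := by
  have := Complex.conjCLE.comp_fderiv (f := f) (x := y)
  have h2 : fderiv ℝ (fun z => conj (f z)) y =
      (Complex.conjCLE : ℂ →L[ℝ] ℂ).comp (fderiv ℝ f y) := this
  rw [h2]
  rfl

/-- Conjugation exchanges `∂` and `∂̄`; for weak derivatives this turns the equation for `∂̄W` into
one for `∂` of the conjugate transpose. -/
theorem conj_dBar_conj (f : (Fin n → ℂ) → ℂ) (y v : Fin n → ℂ) :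
    conj (dBar (fun z => conj (f z)) y v) = dHol f y v := by
  simp only [dBar, dHol, fderiv_conj_comp, map_div₀, map_add, map_mul, Complex.conj_conj,
    Complex.conj_I, map_ofNat]
  ring

theorem dHol_eq_zero {f : (Fin n → ℂ) → ℂ} {y : Fin n → ℂ} (h : y ∉ tsupport f)
    (v : Fin n → ℂ) : dHol f y v = 0 := by
  have : fderiv ℝ f y = 0 :=
    image_eq_zero_of_notMem_tsupport fun hh => h (tsupport_fderiv_subset ℝ hh)
  simp [dHol, this]

theorem dBar_eq_zero {f : (Fin n → ℂ) → ℂ} {y : Fin n → ℂ} (h : y ∉ tsupport f)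
    (v : Fin n → ℂ) : dBar f y v = 0 := by
  have : fderiv ℝ f y = 0 :=
    image_eq_zero_of_notMem_tsupport fun hh => h (tsupport_fderiv_subset ℝ hh)
  simp [dBar, this]

theorem continuousOn_dHol {Ω : Set (Fin n → ℂ)} (hΩ : IsOpen Ω) {m : (Fin n → ℂ) → ℂ}
    (hm : ContDiffOn ℝ ∞ m Ω) (v : Fin n → ℂ) : ContinuousOn (fun y => dHol m y v) Ω := by
  have h := hm.continuousOn_fderiv_of_isOpen hΩ (by simp)
  exact ((h.clm_apply continuousOn_const).sub (continuousOn_const.mul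
    (h.clm_apply continuousOn_const))).div_const 2

theorem continuous_dHol {φ : (Fin n → ℂ) → ℂ} (hφ : ContDiff ℝ ∞ φ) (v : Fin n → ℂ) :
    Continuous (fun y => dHol φ y v) := by
  rw [← continuousOn_univ]
  exact continuousOn_dHol isOpen_univ hφ.contDiffOn v

theorem continuous_dBar {φ : (Fin n → ℂ) → ℂ} (hφ : ContDiff ℝ ∞ φ) (v : Fin n → ℂ) :
    Continuous (fun y => dBar φ y v) := by
  have h : (fun y => dBar φ y v) = fun y => fderiv ℝ φ y v - dHol φ y v := by
    funext y; rw [← dHol_add_dBar]; ring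
  rw [h]
  exact ((hφ.continuous_fderiv (by simp)).clm_apply continuous_const).sub (continuous_dHol hφ v)

theorem tsupport_dHol_subset (φ : (Fin n → ℂ) → ℂ) (v : Fin n → ℂ) :
    tsupport (fun y => dHol φ y v) ⊆ tsupport φ :=
  closure_minimal (fun y hy => by
    by_contra h; exact hy (dHol_eq_zero h v)) (isClosed_tsupport φ)

theorem tsupport_dBar_subset (φ : (Fin n → ℂ) → ℂ) (v : Fin n → ℂ) :
    tsupport (fun y => dBar φ y v) ⊆ tsupport φ :=
  closure_minimal (fun y hy => by
    by_contra h; exact hy (dBar_eq_zero h v)) (isClosed_tsupport φ)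

theorem hasCompactSupport_dHol {φ : (Fin n → ℂ) → ℂ} (hφ : HasCompactSupport φ)
    (v : Fin n → ℂ) : HasCompactSupport (fun y => dHol φ y v) :=
  hφ.of_isClosed_subset (isClosed_tsupport _) (tsupport_dHol_subset φ v)

theorem hasCompactSupport_dBar {φ : (Fin n → ℂ) → ℂ} (hφ : HasCompactSupport φ)
    (v : Fin n → ℂ) : HasCompactSupport (fun y => dBar φ y v) :=
  hφ.of_isClosed_subset (isClosed_tsupport _) (tsupport_dBar_subset φ v)

theorem integrable_mul_of_tsupport_subset {Ω : Set (Fin n → ℂ)} {f χ : (Fin n → ℂ) → ℂ}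
    (hf : LocallyIntegrableOn f Ω) (hχ : Continuous χ) (hc : HasCompactSupport χ)
    (hΩ : tsupport χ ⊆ Ω) : Integrable (fun x => f x * χ x) := by
  have h1 : IntegrableOn f (tsupport χ) := hf.integrableOn_compact_subset hΩ hc
  refine (integrableOn_iff_integrable_of_support_subset ?_).1
    (h1.mul_continuousOn hχ.continuousOn hc)
  intro x hx
  exact subset_tsupport χ (fun h => hx (by simp [h]))

theorem _root_.MeasureTheory.LocallyIntegrableOn.conj {Ω : Set (Fin n → ℂ)}
    {f : (Fin n → ℂ) → ℂ} (hf : LocallyIntegrableOn f Ω) :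
    LocallyIntegrableOn (fun y => conj (f y)) Ω := fun x hx => by
  obtain ⟨s, hs, hi⟩ := hf x hx
  exact ⟨s, hs, (Complex.conjCLE : ℂ →L[ℝ] ℂ).integrable_comp hi⟩

/-- `q` is the weak derivative `∂f(v)` on `Ω`. -/
structure HasWeakHol (Ω : Set (Fin n → ℂ)) (v : Fin n → ℂ) (f q : (Fin n → ℂ) → ℂ) : Prop where
  locallyIntegrableOn : LocallyIntegrableOn f Ω
  locallyIntegrableOn_deriv : LocallyIntegrableOn q Ω
  integral_eq : ∀ φ : (Fin n → ℂ) → ℂ, ContDiff ℝ ∞ φ → HasCompactSupport φ → tsupport φ ⊆ Ω →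
    ∫ y, f y * dHol φ y v = -∫ y, q y * φ y

variable {Ω : Set (Fin n → ℂ)} {v : Fin n → ℂ}

theorem HasWeakHol.of_conj {f q : (Fin n → ℂ) → ℂ} (hf : LocallyIntegrableOn f Ω)
    (hq : LocallyIntegrableOn q Ω)
    (h : ∀ φ : (Fin n → ℂ) → ℂ, ContDiff ℝ ∞ φ → HasCompactSupport φ → tsupport φ ⊆ Ω →
      ∫ y, f y * dBar φ y v = -∫ y, q y * φ y) :
    HasWeakHol Ω v (fun y => conj (f y)) (fun y => conj (q y)) := by
  refine ⟨hf.conj, hq.conj, fun φ hφ hc hs => ?_⟩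
  have hsupp : tsupport (fun z => conj (φ z)) ⊆ tsupport φ :=
    closure_mono fun y hy hh => hy (by simp [hh])
  have := congrArg conj (h (fun z => conj (φ z)) (Complex.conjCLE.contDiff.comp hφ)
    (hc.of_isClosed_subset (isClosed_tsupport _) hsupp) (hsupp.trans hs))
  rw [map_neg, ← integral_conj, ← integral_conj] at this
  simpa only [map_mul, conj_dBar_conj, Complex.conj_conj] using this

/-- The function `φ m` serves as the test function in the equation for `f`. -/
theorem HasWeakHol.mul_smooth (hΩ : IsOpen Ω) {f q m : (Fin n → ℂ) → ℂ}
    (h : HasWeakHol Ω v f q) (hm : ContDiffOn ℝ ∞ m Ω) :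
    HasWeakHol Ω v (fun y => f y * m y) (fun y => q y * m y + f y * dHol m y v) := by
  have hl := hΩ.isLocallyClosed
  have i1 := h.locallyIntegrableOn.mul_continuousOn hm.continuousOn hl
  have i2 := h.locallyIntegrableOn_deriv.mul_continuousOn hm.continuousOn hl
  have i3 := h.locallyIntegrableOn.mul_continuousOn (continuousOn_dHol hΩ hm v) hl
  refine ⟨i1, i2.add i3, fun φ hφ hc hs => ?_⟩
  have hdiff : ∀ y ∈ tsupport φ, ContDiffAt ℝ ∞ m y := fun y hy =>
    hm.contDiffAt (hΩ.mem_nhds (hs hy))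
  -- The factor `m` is smooth only on `Ω`, but the product vanishes off the support of `φ`, a closed
  -- subset of `Ω`, so it is smooth everywhere.
  have hmφ : ContDiff ℝ ∞ (fun y => φ y * m y) := by
    rw [contDiff_iff_contDiffAt]
    intro y
    by_cases hy : y ∈ tsupport φ
    · exact hφ.contDiffAt.mul (hdiff y hy)
    · have : (fun y => φ y * m y) =ᶠ[𝓝 y] fun _ => 0 := by
        filter_upwards [(isClosed_tsupport φ).isOpen_compl.mem_nhds hy] with z hz
        rw [image_eq_zero_of_notMem_tsupport hz, zero_mul]
      exact contDiffAt_const.congr_of_eventuallyEq this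
  have hsub : tsupport (fun y => φ y * m y) ⊆ tsupport φ := tsupport_mul_subset_left
  have e := h.integral_eq _ hmφ (hc.of_isClosed_subset (isClosed_tsupport _) hsub)
    (hsub.trans hs)
  have hd : ∀ y, f y * dHol (fun y => φ y * m y) y v =
      f y * m y * dHol φ y v + f y * dHol m y v * φ y := by
    intro y
    by_cases hy : y ∈ tsupport φ
    · rw [dHol_mul (hφ.differentiable (by simp) y) ((hdiff y hy).differentiableAt (by simp))]
      ring
    · rw [dHol_eq_zero (fun hh => hy (hsub hh)), dHol_eq_zero hy,
        image_eq_zero_of_notMem_tsupport hy]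
      ring
  have j1 := integrable_mul_of_tsupport_subset i1 (continuous_dHol hφ v)
    (hasCompactSupport_dHol hc v) ((tsupport_dHol_subset φ v).trans hs)
  have j2 := integrable_mul_of_tsupport_subset i2 hφ.continuous hc hs
  have j3 := integrable_mul_of_tsupport_subset i3 hφ.continuous hc hs
  simp only [hd] at e
  rw [integral_add j1 j3] at e
  have e2 : ∫ y, (q y * m y + f y * dHol m y v) * φ y =
      (∫ y, q y * m y * φ y) + ∫ y, f y * dHol m y v * φ y := by
    rw [← integral_add j2 j3]
    exact integral_congr_ae (Filter.Eventually.of_forall fun y => by ring)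
  have e3 : ∫ y, q y * (φ y * m y) = ∫ y, q y * m y * φ y :=
    integral_congr_ae (Filter.Eventually.of_forall fun y => by ring)
  rw [e3] at e
  rw [e2, eq_sub_of_add_eq e]
  ring

theorem locallyIntegrableOn_finset_sum {ι F : Type*} [NormedAddCommGroup F] (s : Finset ι)
    {u : ι → (Fin n → ℂ) → F} (hu : ∀ k, LocallyIntegrableOn (u k) Ω) :
    LocallyIntegrableOn (fun y => ∑ k ∈ s, u k y) Ω := by
  intro x hx
  choose t ht hi using fun k => hu k x hx
  refine ⟨⋂ k ∈ s, t k, (Filter.biInter_finset_mem s).2 fun k _ => ht k, ?_⟩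
  exact integrable_finsetSum s fun k hk => (hi k).mono_set (Set.biInter_subset_of_mem hk)

theorem HasWeakHol.sum {ι : Type*} (s : Finset ι) {f q : ι → (Fin n → ℂ) → ℂ}
    (h : ∀ k, HasWeakHol Ω v (f k) (q k)) :
    HasWeakHol Ω v (fun y => ∑ k ∈ s, f k y) (fun y => ∑ k ∈ s, q k y) := by
  refine ⟨locallyIntegrableOn_finset_sum s fun k => (h k).1,
    locallyIntegrableOn_finset_sum s fun k => (h k).2, fun φ hφ hc hs => ?_⟩
  simp only [Finset.sum_mul]
  rw [integral_finsetSum _ fun k _ => integrable_mul_of_tsupport_subset (h k).1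
      (continuous_dHol hφ v) (hasCompactSupport_dHol hc v) ((tsupport_dHol_subset φ v).trans hs),
    integral_finsetSum _ fun k _ => integrable_mul_of_tsupport_subset (h k).2
      hφ.continuous hc hs, ← Finset.sum_neg_distrib]
  exact Finset.sum_congr rfl fun k _ => (h k).integral_eq φ hφ hc hs

/-- Both derivatives have the same integrals against test functions, and the fundamental lemma of
the calculus of variations applies to their difference. -/
theorem HasWeakHol.unique (hΩ : IsOpen Ω) {f f' q q' : (Fin n → ℂ) → ℂ}
    (h : HasWeakHol Ω v f q) (h' : HasWeakHol Ω v f' q')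
    (hff' : ∀ᵐ y, y ∈ Ω → f y = f' y) : ∀ᵐ y, y ∈ Ω → q y = q' y := by
  have hsub : LocallyIntegrableOn (fun y => q y - q' y) Ω :=
    h.locallyIntegrableOn_deriv.sub h'.locallyIntegrableOn_deriv
  have key := hΩ.ae_eq_zero_of_integral_contDiff_smul_eq_zero hsub fun φ hφ hc hs => by
    set ψ : (Fin n → ℂ) → ℂ := fun y => (φ y : ℂ) with hψ
    have hψs : ContDiff ℝ ∞ ψ := Complex.ofRealCLM.contDiff.comp hφ
    have hsupp : tsupport ψ ⊆ tsupport φ := closure_mono fun y hy hh => hy (by simp [hψ, hh])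
    have hψc : HasCompactSupport ψ := hc.of_isClosed_subset (isClosed_tsupport _) hsupp
    have e := h.integral_eq ψ hψs hψc (hsupp.trans hs)
    have e' := h'.integral_eq ψ hψs hψc (hsupp.trans hs)
    have e1 : ∫ y, f y * dHol ψ y v = ∫ y, f' y * dHol ψ y v := by
      refine integral_congr_ae ?_
      filter_upwards [hff'] with y hy
      by_cases hyΩ : y ∈ Ω
      · rw [hy hyΩ]
      · rw [dHol_eq_zero (fun hh => hyΩ (hs (hsupp hh))), mul_zero, mul_zero]
    rw [e1, e', neg_inj] at e
    have e2 : ∫ y, φ y • (q y - q' y) = ∫ y, (q y * ψ y - q' y * ψ y) :=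
      integral_congr_ae (Filter.Eventually.of_forall fun y => by
        simp only [hψ, Complex.real_smul]; ring)
    rw [e2, integral_sub (integrable_mul_of_tsupport_subset h.2 hψs.continuous hψc
      (hsupp.trans hs)) (integrable_mul_of_tsupport_subset h'.2 hψs.continuous hψc
      (hsupp.trans hs)), e, sub_self]
  filter_upwards [key] with y hy hyΩ
  exact sub_eq_zero.1 (hy hyΩ)

end Wirtinger

end HermBundle

/-! ### The Chern connection, and adjointness of the two parts of the weak derivative -/

namespace HermBundle

open Topology Matrix

section SmoothMatrix

variable {V : Type*} [NormedAddCommGroup V] [NormedSpace ℝ V] {r : ℕ} {Ω : Set V}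
  {M : V → Matrix (Fin r) (Fin r) ℂ}

theorem contDiffOn_det (hM : ∀ i j, ContDiffOn ℝ ∞ (fun y => M y i j) Ω) :
    ContDiffOn ℝ ∞ (fun y => (M y).det) Ω := by
  simp only [Matrix.det_apply]
  refine ContDiffOn.sum fun σ _ => ?_
  exact (contDiffOn_prod fun i _ => hM (σ i) i).const_smul _

theorem contDiffOn_inv (hM : ∀ i j, ContDiffOn ℝ ∞ (fun y => M y i j) Ω)
    (hdet : ∀ y ∈ Ω, (M y).det ≠ 0) (i j : Fin r) :
    ContDiffOn ℝ ∞ (fun y => (M y)⁻¹ i j) Ω := by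
  -- Cramer's rule expresses each entry of the inverse as a quotient of determinants, so smoothness
  -- follows from that of determinants.
  have h1 : ∀ y, (M y)⁻¹ i j = ((M y).det)⁻¹ * ((M y).updateRow j (Pi.single i 1)).det := by
    intro y
    rw [Matrix.inv_def, Matrix.smul_apply, Matrix.adjugate_apply, Ring.inverse_eq_inv', smul_eq_mul]
  simp only [h1]
  refine ((contDiffOn_det hM).inv hdet).mul (contDiffOn_det fun k l => ?_)
  simp only [Matrix.updateRow_apply]
  split_ifs
  · exact contDiffOn_const
  · exact hM k l

theorem contDiffOn_matrix_mul {N : V → Matrix (Fin r) (Fin r) ℂ}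
    (hM : ∀ i j, ContDiffOn ℝ ∞ (fun y => M y i j) Ω)
    (hN : ∀ i j, ContDiffOn ℝ ∞ (fun y => N y i j) Ω) (i j : Fin r) :
    ContDiffOn ℝ ∞ (fun y => (M y * N y) i j) Ω := by
  simp only [Matrix.mul_apply]
  exact ContDiffOn.sum fun k _ => (hM i k).mul (hN k j)

end SmoothMatrix

theorem contDiffOn_dHol {n : ℕ} {Ω : Set (Fin n → ℂ)} (hΩ : IsOpen Ω) {m : (Fin n → ℂ) → ℂ}
    (hm : ContDiffOn ℝ ∞ m Ω) (v : Fin n → ℂ) : ContDiffOn ℝ ∞ (fun y => dHol m y v) Ω := by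
  have h := hm.fderiv_of_isOpen hΩ (m := ∞) (by simp)
  exact ((h.clm_apply contDiffOn_const).sub (contDiffOn_const.mul
    (h.clm_apply contDiffOn_const))).div_const 2

theorem contDiffOn_dBar {n : ℕ} {Ω : Set (Fin n → ℂ)} (hΩ : IsOpen Ω) {m : (Fin n → ℂ) → ℂ}
    (hm : ContDiffOn ℝ ∞ m Ω) (v : Fin n → ℂ) : ContDiffOn ℝ ∞ (fun y => dBar m y v) Ω := by
  have h := hm.fderiv_of_isOpen hΩ (m := ∞) (by simp)
  exact ((h.clm_apply contDiffOn_const).add (contDiffOn_const.mul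
    (h.clm_apply contDiffOn_const))).div_const 2

variable {n r : ℕ} {X : Type*} [TopologicalSpace X] [ChartedSpace (Fin n → ℂ) X]
  {E : X → Type*} [∀ x, AddCommGroup (E x)] [∀ x, Module ℂ (E x)] [∀ x, TopologicalSpace (E x)]
  [TopologicalSpace (TotalSpace (Fin r → ℂ) E)] [FiberBundle (Fin r → ℂ) E]
  [VectorBundle ℂ (Fin r → ℂ) E]

namespace HermitianMetric

theorem contDiffOn_gram (h : HermitianMetric n r E) (a : X) (i j : Fin r) :
    ContDiffOn ℝ ∞ (fun y => h.gram a y i j) (localDomain n r E a) := h.smooth a i j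

theorem isUnit_det_gram (h : HermitianMetric n r E) {a : X} {y : Fin n → ℂ}
    (hy : y ∈ localDomain n r E a) : IsUnit (h.gram a y).det :=
  h.isUnit_det_gramAt hy.2

/-- The entries of `∂H`. -/
noncomputable def dGram (h : HermitianMetric n r E) (a : X) (y v : Fin n → ℂ) :
    Matrix (Fin r) (Fin r) ℂ :=
  Matrix.of fun i j => dHol (fun z => h.gram a z i j) y v

theorem contDiffOn_connection (h : HermitianMetric n r E) (a : X) (v : Fin n → ℂ) (i j : Fin r) :
    ContDiffOn ℝ ∞ (fun y => h.connection a y v i j) (localDomain n r E a) :=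
  contDiffOn_matrix_mul (contDiffOn_inv (h.contDiffOn_gram a)
    fun _ hy => (h.isUnit_det_gram hy).ne_zero)
    (fun i j => contDiffOn_dHol (isOpen_localDomain a) (h.contDiffOn_gram a i j) v) i j

/-- The defining relation `H A = ∂H`, free of the inverse; the computations with the connection use
it in this form. -/
theorem gram_mul_connection (h : HermitianMetric n r E) {a : X} {y : Fin n → ℂ}
    (hy : y ∈ localDomain n r E a) (v : Fin n → ℂ) :
    h.gram a y * h.connection a y v = h.dGram a y v := by
  rw [connection, ← Matrix.mul_assoc, Matrix.mul_nonsing_inv _ (h.isUnit_det_gram hy),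
    Matrix.one_mul]
  rfl

theorem form_apply_left (h : HermitianMetric n r E) {a x : X} (hx : x ∈ frameSet r E a)
    (T : E x →ₗ[ℂ] E x) (u v : E x) : h.form x (T u) v =
      star (localCoord r a x u) ⬝ᵥ
        (((localMatrix r a x T)ᴴ * h.gramAt a x) *ᵥ localCoord r a x v) := by
  rw [h.form_eq hx, ← localMatrix_mulVec hx, Matrix.star_mulVec, Matrix.dotProduct_mulVec,
    Matrix.vecMul_vecMul, ← Matrix.dotProduct_mulVec]

theorem form_apply_right (h : HermitianMetric n r E) {a x : X} (hx : x ∈ frameSet r E a)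
    (T : E x →ₗ[ℂ] E x) (u v : E x) : h.form x u (T v) =
      star (localCoord r a x u) ⬝ᵥ
        ((h.gramAt a x * localMatrix r a x T) *ᵥ localCoord r a x v) := by
  rw [h.form_eq hx, ← localMatrix_mulVec hx, Matrix.mulVec_mulVec]

theorem adjoint_iff (h : HermitianMetric n r E) {a x : X} (hx : x ∈ frameSet r E a)
    (S T : E x →ₗ[ℂ] E x) : (∀ u v, h.form x (S u) v = h.form x u (T v)) ↔
      (localMatrix r a x S)ᴴ * h.gramAt a x = h.gramAt a x * localMatrix r a x T := by
  refine ⟨fun hST => ?_, fun hST u v => ?_⟩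
  · ext i j
    have := hST (localVector r E a x (Pi.single i 1)) (localVector r E a x (Pi.single j 1))
    rw [h.form_apply_left hx, h.form_apply_right hx, localCoord_localVector hx,
      localCoord_localVector hx] at this
    simpa [Pi.star_single] using this
  · rw [h.form_apply_left hx, h.form_apply_right hx, hST]

end HermitianMetric

variable [IsManifold 𝓘(ℂ, Fin n → ℂ) ω X]

/-- The `(1,0)`-part of the weak derivative of a self-adjoint endomorphism is the adjoint of the
`(0,1)`-part, in a chart. -/
theorem IsWeakDerivative.ae_adjoint_chart {h : HermitianMetric n r E} {w : EndSection E}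
    {D : EndForm n E} (hD : IsWeakDerivative h w D) (a : X)
    (hw : ∀ᵐ y : Fin n → ℂ, y ∈ localDomain n r E a →
      ∀ u v, h.form ((chartAt (Fin n → ℂ) a).symm y) (w ((chartAt (Fin n → ℂ) a).symm y) u) v =
        h.form ((chartAt (Fin n → ℂ) a).symm y) u (w ((chartAt (Fin n → ℂ) a).symm y) v)) :
    ∀ᵐ y : Fin n → ℂ, y ∈ localDomain n r E a → ∀ t u v,
      h.form ((chartAt (Fin n → ℂ) a).symm y) (D.anti ((chartAt (Fin n → ℂ) a).symm y) t u) v =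
        h.form ((chartAt (Fin n → ℂ) a).symm y) u
          (D.hol ((chartAt (Fin n → ℂ) a).symm y) t v) := by
  set Ω := localDomain n r E a with hΩdef
  have hΩ : IsOpen Ω := isOpen_localDomain a
  have hl := hΩ.isLocallyClosed
  set s : (Fin n → ℂ) → X := fun y => (chartAt (Fin n → ℂ) a).symm y with hs
  set W : (Fin n → ℂ) → Matrix (Fin r) (Fin r) ℂ := fun y => localMatrix r a (s y) (w (s y))
  set P : (Fin n → ℂ) → (Fin n → ℂ) → Matrix (Fin r) (Fin r) ℂ := fun v y =>
      localMatrix r a (s y) (D.hol (s y) (localVector n (HolTangent n X) a (s y) v))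
  set Q : (Fin n → ℂ) → (Fin n → ℂ) → Matrix (Fin r) (Fin r) ℂ := fun v y =>
      localMatrix r a (s y) (D.anti (s y) (localVector n (HolTangent n X) a (s y) v))
  have hA : ∀ i j, LocallyIntegrableOn (fun y => W y i j) Ω ∧
      ∀ v : Fin n → ℂ,
        LocallyIntegrableOn (fun y => P v y i j) Ω ∧
        LocallyIntegrableOn (fun y => Q v y i j) Ω ∧
        ∀ φ : (Fin n → ℂ) → ℂ, ContDiff ℝ ∞ φ → HasCompactSupport φ → tsupport φ ⊆ Ω →
          ∫ y, W y i j * dHol φ y v =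
            -∫ y, (P v y - (h.connection a y v * W y - W y * h.connection a y v)) i j * φ y ∧
          ∫ y, W y i j * dBar φ y v = -∫ y, Q v y i j * φ y := hD a
  have hWH : ∀ᵐ y, y ∈ Ω → (W y)ᴴ * h.gram a y = h.gram a y * W y := by
    filter_upwards [hw] with y hy hyΩ
    exact (h.adjoint_iff hyΩ.2 _ _).1 (hy hyΩ)
  -- the identity of weak derivatives, entry by entry
  have key : ∀ (k : Fin n) (i j : Fin r), ∀ᵐ y, y ∈ Ω →
      ∑ l, (conj (Q (Pi.single k 1) y l i) * h.gram a y l j +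
        conj (W y l i) * dHol (fun z => h.gram a z l j) y (Pi.single k 1)) =
      ∑ l, ((P (Pi.single k 1) y - (h.connection a y (Pi.single k 1) * W y -
        W y * h.connection a y (Pi.single k 1))) l j * h.gram a y i l +
        W y l j * dHol (fun z => h.gram a z i l) y (Pi.single k 1)) := by
    intro k i j
    set v : Fin n → ℂ := Pi.single k 1
    have hA' : ∀ i j, ContinuousOn (fun y => h.connection a y v i j) Ω := fun i j =>
      (h.contDiffOn_connection a v i j).continuousOn
    have hcomm : ∀ l, LocallyIntegrableOn (fun y => (P v y - (h.connection a y v * W y -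
        W y * h.connection a y v)) l j) Ω := by
      intro l
      refine ((hA l j).2 v).1.sub (LocallyIntegrableOn.sub ?_ ?_)
      · simp only [Matrix.mul_apply]
        exact locallyIntegrableOn_finset_sum _ fun m => (hA m j).1.continuousOn_mul (hA' l m) hl
      · simp only [Matrix.mul_apply]
        exact locallyIntegrableOn_finset_sum _ fun m => (hA l m).1.mul_continuousOn (hA' m j) hl
    -- Since the weak `∂` of `W*` is `(∂̄W)* = Q*`, the left side of `W* H = H W` has the weak
    -- derivative `Q* H + W* ∂H`. The right side is treated with the equation for `∂W = P - [A, W]`,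
    -- and uniqueness identifies the two.
    have h1 := HasWeakHol.sum (Ω := Ω) (v := v) Finset.univ fun l =>
      (HasWeakHol.of_conj (hA l i).1 ((hA l i).2 v).2.1 fun φ hφ hc hsub =>
        (((hA l i).2 v).2.2 φ hφ hc hsub).2).mul_smooth hΩ (h.contDiffOn_gram a l j)
    have h2 := HasWeakHol.sum (Ω := Ω) (v := v) Finset.univ fun l =>
      (HasWeakHol.mk (hA l j).1 (hcomm l) fun φ hφ hc hsub =>
        (((hA l j).2 v).2.2 φ hφ hc hsub).1).mul_smooth hΩ (h.contDiffOn_gram a i l)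
    refine h1.unique hΩ h2 ?_
    filter_upwards [hWH] with y hy hyΩ
    have := congrFun (congrFun (hy hyΩ) i) j
    simp only [Matrix.mul_apply, Matrix.conjTranspose_apply, Complex.star_def] at this
    rw [this]
    exact Finset.sum_congr rfl fun l _ => mul_comm _ _
  have key' := ae_all_iff.2 fun k => ae_all_iff.2 fun i => ae_all_iff.2 fun j => key k i j
  filter_upwards [key', hWH] with y hy hyW hyΩ
  have hW := hyW hyΩ
  have hPQ : ∀ k : Fin n, (Q (Pi.single k 1) y)ᴴ * h.gram a y = h.gram a y * P (Pi.single k 1) y := by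
    intro k
    set v : Fin n → ℂ := Pi.single k 1
    have e : (Q v y)ᴴ * h.gram a y + (W y)ᴴ * h.dGram a y v =
        h.gram a y * (P v y - (h.connection a y v * W y - W y * h.connection a y v)) +
          h.dGram a y v * W y := by
      ext i j
      have := hy k i j hyΩ
      simp only [Finset.sum_add_distrib] at this
      simp only [Matrix.add_apply, Matrix.mul_apply (M := (Q v y)ᴴ), Matrix.mul_apply (M := (W y)ᴴ),
        Matrix.mul_apply (M := h.gram a y), Matrix.mul_apply (M := h.dGram a y v),
        Matrix.conjTranspose_apply, Complex.star_def]
      refine this.trans ?_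
      congr 1
      · exact Finset.sum_congr rfl fun l _ => mul_comm _ _
      · exact Finset.sum_congr rfl fun l _ => mul_comm _ _
    -- Inserting `∂H = H A` and `W* H = H W`, all terms with the connection cancel and `Q* H = H P`
    -- remains, which is the asserted adjointness along a coordinate direction.
    rw [← h.gram_mul_connection hyΩ v, ← Matrix.mul_assoc, hW, Matrix.mul_sub, Matrix.mul_sub] at e
    simp only [Matrix.mul_assoc] at e
    have e2 : (Q v y)ᴴ * h.gram a y = h.gram a y * P v y := by
      have := eq_sub_of_add_eq e
      rw [this]; abel
    exact e2
  intro t u u'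
  have hx : s y ∈ frameSet n (HolTangent n X) a :=
    symm_mem_frameSet_tangent (localDomain_subset_target a hyΩ)
  have hform : ∀ k : Fin n, ∀ u u', h.form (s y)
      (D.anti (s y) (localVector n (HolTangent n X) a (s y) (Pi.single k 1)) u) u' =
      h.form (s y) u (D.hol (s y) (localVector n (HolTangent n X) a (s y) (Pi.single k 1)) u') :=
    fun k => (h.adjoint_iff hyΩ.2 _ _).2 (hPQ k)
  -- Both sides are complex linear in `t`: on the left the conjugate linearity of the `(0,1)`-part
  -- is undone by that of the form in its first argument. Hence coordinate directions suffice.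
  rw [← localVector_localCoord hx t, localVector_eq_sum]
  simp only [map_sum, LinearMap.map_smulₛₗ, LinearMap.sum_apply, LinearMap.smul_apply,
    RingHom.id_apply, Complex.conj_conj, smul_eq_mul]
  exact Finset.sum_congr rfl fun k _ => congrArg _ (hform k u u')

theorem IsWeakDerivative.ae_adjoint [MeasurableSpace X] [BorelSpace X] [CompactSpace X]
    [T2Space X] (g : HermitianMetric n n (HolTangent n X)) {h : HermitianMetric n r E}
    {w : EndSection E} {D : EndForm n E} (hD : IsWeakDerivative h w D)
    (hw : ∀ᵐ x ∂kahlerVolume g, ∀ u v, h.form x (w x u) v = h.form x u (w x v)) :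
    ∀ᵐ x ∂kahlerVolume g, ∀ t u v, h.form x (D.anti x t u) v = h.form x u (D.hol x t v) := by
  refine ae_kahlerVolume_of_forall (r := r) (E := E) g fun a => hD.ae_adjoint_chart a ?_
  filter_upwards [ae_chart_of_ae_kahlerVolume g hw a] with y hy hyΩ
  exact hy (localDomain_subset_target a hyΩ)

/-- Adjoint endomorphisms have equal norm, so the `(1,0)` and `(0,1)` parts contribute equally to
`|Dw|²`. -/
theorem formNorm_sq_eq (g : HermitianMetric n n (HolTangent n X)) (h : HermitianMetric n r E)
    (w : EndSection E) (x : X)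
    (hx : ∀ t u v, h.form x ((weakDerivative h w).anti x t u) v =
      h.form x u ((weakDerivative h w).hol x t v)) :
    formNorm g h (weakDerivative h w) x ^ 2 = 2 * antiNormSq g h w x := by
  rw [formNorm, Real.sq_sqrt (by positivity), antiNormSq, Finset.mul_sum]
  refine Finset.sum_congr rfl fun k _ => ?_
  rw [endNorm_adjoint h x (hx (g.unitaryFrame x k))]
  ring

end HermBundle

/-! ### Unitary frames against holomorphic frames, uniformly on compact sets -/

namespace HermBundle

open Topology Matrix
open scoped ComplexOrder

variable {n r : ℕ} {X : Type*} [TopologicalSpace X] [ChartedSpace (Fin n → ℂ) X]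
  {E : X → Type*} [∀ x, AddCommGroup (E x)] [∀ x, Module ℂ (E x)] [∀ x, TopologicalSpace (E x)]
  [TopologicalSpace (TotalSpace (Fin r → ℂ) E)] [FiberBundle (Fin r → ℂ) E]
  [VectorBundle ℂ (Fin r → ℂ) E]

theorem norm_mulVec_le_sum {r : ℕ} (M : Matrix (Fin r) (Fin r) ℂ) (c : Fin r → ℂ) :
    ‖M *ᵥ c‖ ≤ (∑ i, ∑ j, ‖M i j‖) * ‖c‖ := by
  refine (pi_norm_le_iff_of_nonneg (by positivity)).2 fun i => ?_
  rw [Finset.sum_mul]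
  refine le_trans ?_ (Finset.single_le_sum (f := fun i => (∑ j, ‖M i j‖) * ‖c‖)
    (fun _ _ => by positivity) (Finset.mem_univ i))
  rw [Matrix.mulVec, dotProduct, Finset.sum_mul]
  refine (norm_sum_le _ _).trans (Finset.sum_le_sum fun j _ => ?_)
  rw [norm_mul]
  exact mul_le_mul_of_nonneg_left (norm_le_pi_norm c j) (norm_nonneg _)

theorem norm_dotProduct_le {r : ℕ} (c d : Fin r → ℂ) : ‖c ⬝ᵥ d‖ ≤ r * ‖c‖ * ‖d‖ := by
  refine (norm_sum_le _ _).trans ?_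
  calc ∑ i, ‖c i * d i‖ ≤ ∑ _i : Fin r, ‖c‖ * ‖d‖ := Finset.sum_le_sum fun i _ => by
        rw [norm_mul]
        exact mul_le_mul (norm_le_pi_norm c i) (norm_le_pi_norm d i) (norm_nonneg _)
          (norm_nonneg _)
    _ = r * ‖c‖ * ‖d‖ := by simp [mul_assoc]

/-- `C` bounds the coordinates of unitary frames at `x` with respect to the frame attached to `a`,
and the coordinates the other way around. -/
def HermitianMetric.FrameBound (h : HermitianMetric n r E) (a x : X) (C : ℝ) : Prop :=
  ∀ e, h.IsUnitary x e → (∀ i, ‖localCoord r a x (e i)‖ ≤ C) ∧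
    ∀ c i, ‖h.form x (e i) (localVector r E a x c)‖ ≤ C * ‖c‖

/-- The form is positive and continuous on the compact product of `K` with the unit sphere, so it
has a positive lower bound there; homogeneity extends it to all vectors. -/
theorem HermitianMetric.exists_le_re_form (h : HermitianMetric n r E) {a : X}
    {K : Set (Fin n → ℂ)} (hK : IsCompact K) (hKs : K ⊆ localDomain n r E a) :
    ∃ c : ℝ, 0 < c ∧ ∀ y ∈ K, ∀ u : Fin r → ℂ,
      c * ‖u‖ ^ 2 ≤ (star u ⬝ᵥ (h.gram a y *ᵥ u)).re := by
  have hcont : ContinuousOn (fun q : (Fin n → ℂ) × (Fin r → ℂ) =>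
      (star q.2 ⬝ᵥ (h.gram a q.1 *ᵥ q.2)).re) (K ×ˢ Metric.sphere 0 1) := by
    refine Complex.continuous_re.comp_continuousOn ?_
    have hg : ∀ i j, ContinuousOn (fun q : (Fin n → ℂ) × (Fin r → ℂ) => h.gram a q.1 i j)
        (K ×ˢ Metric.sphere 0 1) := fun i j =>
      (h.contDiffOn_gram a i j).continuousOn.comp continuousOn_fst fun q hq => hKs hq.1
    simp only [dotProduct, mulVec]
    refine continuousOn_finsetSum _ fun i _ => ContinuousOn.mul ?_
      (continuousOn_finsetSum _ fun j _ => (hg i j).mul ?_)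
    · exact (continuous_star.comp ((continuous_apply i).comp continuous_snd)).continuousOn
    · exact ((continuous_apply j).comp continuous_snd).continuousOn
  have hpos : ∀ y ∈ K, ∀ u : Fin r → ℂ, u ≠ 0 → 0 < (star u ⬝ᵥ (h.gram a y *ᵥ u)).re := by
    intro y hy u hu
    have := (h.gramAt_posDef (hKs hy).2).dotProduct_mulVec_pos hu
    exact (Complex.pos_iff.1 this).1
  obtain ⟨c, hc, hle⟩ := (hK.prod (isCompact_sphere (0 : Fin r → ℂ) 1)).exists_forall_le' hcont
    (a := 0) fun q hq => hpos q.1 hq.1 q.2 fun h0 => by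
      have := hq.2; simp [h0] at this
  refine ⟨c, hc, fun y hy u => ?_⟩
  by_cases hu : u = 0
  · simp [hu]
  have hn : 0 < ‖u‖ := norm_pos_iff.2 hu
  have h1 := hle (y, ((‖u‖⁻¹ : ℝ) : ℂ) • u) ⟨hy, by simp [norm_smul, hn.ne']⟩
  simp only [star_smul, smul_dotProduct, mulVec_smul, dotProduct_smul, Complex.star_def,
    Complex.conj_ofReal, smul_eq_mul, Complex.re_ofReal_mul] at h1
  calc c * ‖u‖ ^ 2 ≤ (‖u‖⁻¹ * (‖u‖⁻¹ * (star u ⬝ᵥ (h.gram a y *ᵥ u)).re)) * ‖u‖ ^ 2 :=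
        mul_le_mul_of_nonneg_right h1 (by positivity)
    _ = _ := by field_simp

/-- A lower bound `c` for the Gram matrix makes the coordinates of a unit vector at most `√(1/c)`.
Together with an upper bound for its entries this also bounds pairings with unitary vectors. -/
theorem HermitianMetric.exists_frameBound (h : HermitianMetric n r E) {a : X}
    {K : Set (Fin n → ℂ)} (hK : IsCompact K) (hKs : K ⊆ localDomain n r E a) :
    ∃ C : ℝ, 0 < C ∧ ∀ y ∈ K, h.FrameBound a ((chartAt (Fin n → ℂ) a).symm y) C := by
  obtain ⟨c, hc, hle⟩ := h.exists_le_re_form hK hKs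
  obtain ⟨B, hB⟩ := hK.exists_bound_of_continuousOn
    (f := fun y => ∑ i, ∑ j, ‖h.gram a y i j‖) (continuousOn_finsetSum _ fun i _ =>
      continuousOn_finsetSum _ fun j _ =>
        ((h.contDiffOn_gram a i j).continuousOn.mono hKs).norm)
  have hB' : ∀ y ∈ K, ∑ i, ∑ j, ‖h.gram a y i j‖ ≤ |B| := fun y hy =>
    (le_abs_self _).trans ((hB y hy).trans (le_abs_self B))
  set A := √(1 / c) with hA
  have hA0 : 0 < A := Real.sqrt_pos.2 (by positivity)
  refine ⟨A + r * A * |B|, by positivity, fun y hy e he => ?_⟩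
  have hx := (hKs hy).2
  have h1 : ∀ i, ‖localCoord r a ((chartAt (Fin n → ℂ) a).symm y) (e i)‖ ≤ A := by
    intro i
    have h2 := hle y hy (localCoord r a ((chartAt (Fin n → ℂ) a).symm y) (e i))
    have h3 := he i i
    rw [h.form_eq hx, if_pos rfl] at h3
    rw [gram_eq_gramAt, h3, Complex.one_re] at h2
    rw [hA]
    refine Real.le_sqrt_of_sq_le ?_
    rw [le_div_iff₀ hc]
    linarith
  refine ⟨fun i => (h1 i).trans (le_add_of_nonneg_right (by positivity)), fun d i => ?_⟩
  rw [h.form_eq hx, localCoord_localVector hx]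
  calc ‖star (localCoord r a ((chartAt (Fin n → ℂ) a).symm y) (e i)) ⬝ᵥ (h.gramAt a _ *ᵥ d)‖
      ≤ r * A * (|B| * ‖d‖) := by
        refine (norm_dotProduct_le _ _).trans ?_
        rw [norm_star]
        refine mul_le_mul (mul_le_mul_of_nonneg_left (h1 i) (by positivity)) ?_ (norm_nonneg _)
          (by positivity)
        exact (norm_mulVec_le_sum _ _).trans
          (mul_le_mul_of_nonneg_right (hB' y hy) (norm_nonneg _))
    _ ≤ (A + r * A * |B|) * ‖d‖ := by
        rw [add_mul, ← mul_assoc]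
        exact le_add_of_nonneg_left (by positivity)

/-- Expand in a unitary frame both the argument and the value of `T`; each of the `r²` terms carries
two changes of frame and hence `C²`. The value of the constant is irrelevant, only its uniformity on
compact sets matters. -/
theorem norm_localMatrix_le {h : HermitianMetric n r E} {a x : X} (hx : x ∈ frameSet r E a)
    {C : ℝ} (hC : 0 ≤ C) (hb : h.FrameBound a x C) (T : E x →ₗ[ℂ] E x) (i j : Fin r) :
    ‖localMatrix r a x T i j‖ ≤ r ^ 2 * C ^ 2 * endNorm h x T := by
  have hu := h.isUnitary_unitaryFrame x
  obtain ⟨h1, h2⟩ := hb _ hu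
  have hcol : localMatrix r a x T i j =
      localCoord r a x (T (localVector r E a x (Pi.single j 1))) i := by
    rw [← localMatrix_mulVec hx, localCoord_localVector hx]
    simp
  have hT : T (localVector r E a x (Pi.single j 1)) = ∑ k, ∑ l,
      (h.form x (h.unitaryFrame x k) (localVector r E a x (Pi.single j 1)) *
        h.form x (h.unitaryFrame x l) (T (h.unitaryFrame x k))) • h.unitaryFrame x l := by
    conv_lhs => rw [hu.eq_sum (localVector r E a x (Pi.single j 1))]
    rw [map_sum]
    refine Finset.sum_congr rfl fun k _ => ?_
    rw [map_smul]
    conv_lhs => rw [hu.eq_sum (T (h.unitaryFrame x k))]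
    rw [Finset.smul_sum]
    exact Finset.sum_congr rfl fun l _ => smul_smul _ _ _
  have hterm : ∀ k l, ‖(h.form x (h.unitaryFrame x k) (localVector r E a x (Pi.single j 1)) *
        h.form x (h.unitaryFrame x l) (T (h.unitaryFrame x k))) *
        localCoord r a x (h.unitaryFrame x l) i‖ ≤ C ^ 2 * endNorm h x T := by
    intro k l
    have e1 : ‖h.form x (h.unitaryFrame x k) (localVector r E a x (Pi.single j 1))‖ ≤ C := by
      simpa [Pi.norm_single] using h2 (Pi.single j 1) k
    have e2 := norm_form_le_endNorm h x T hu l k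
    have e3 := (norm_le_pi_norm _ i).trans (h1 l)
    rw [norm_mul, norm_mul]
    calc _ ≤ C * endNorm h x T * C :=
          mul_le_mul (mul_le_mul e1 e2 (norm_nonneg _) hC) e3 (norm_nonneg _)
            (mul_nonneg hC (endNorm_nonneg _ _ _))
      _ = _ := by ring
  rw [hcol, hT]
  simp only [localCoord, map_sum, map_smul, Finset.sum_apply, Pi.smul_apply, smul_eq_mul]
  calc _ ≤ ∑ _k : Fin r, ∑ _l : Fin r, C ^ 2 * endNorm h x T :=
        (norm_sum_le _ _).trans (Finset.sum_le_sum fun k _ =>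
          (norm_sum_le _ _).trans (Finset.sum_le_sum fun l _ => hterm k l))
    _ = _ := by simp only [Finset.sum_const, Finset.card_univ, Fintype.card_fin, nsmul_eq_mul]; ring

theorem endNorm_le_sum {h : HermitianMetric n r E} {a x : X} (hx : x ∈ frameSet r E a)
    {C : ℝ} (hC : 0 ≤ C) (hb : h.FrameBound a x C) (T : E x →ₗ[ℂ] E x) :
    endNorm h x T ≤ r ^ 2 * C ^ 2 * ∑ i, ∑ j, ‖localMatrix r a x T i j‖ := by
  have hu := h.isUnitary_unitaryFrame x
  obtain ⟨h1, h2⟩ := hb _ hu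
  set S := ∑ i, ∑ j, ‖localMatrix r a x T i j‖ with hS
  have hterm : ∀ i j, ‖h.form x (h.unitaryFrame x i) (T (h.unitaryFrame x j))‖ ≤ C ^ 2 * S := by
    intro i j
    rw [← localVector_localCoord hx (T (h.unitaryFrame x j)), ← localMatrix_mulVec hx]
    refine (h2 _ i).trans ?_
    calc _ ≤ C * (S * C) := mul_le_mul_of_nonneg_left ((norm_mulVec_le_sum _ _).trans
          (mul_le_mul_of_nonneg_left (h1 j) (by positivity))) hC
      _ = _ := by ring
  refine (Real.sqrt_le_sqrt (Finset.sum_le_sum fun i _ => Finset.sum_le_sum fun j _ =>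
    pow_le_pow_left₀ (norm_nonneg _) (hterm i j) 2)).trans ?_
  simp only [Finset.sum_const, Finset.card_univ, Fintype.card_fin, nsmul_eq_mul]
  rw [show (r : ℝ) * (r * (C ^ 2 * S) ^ 2) = (r * (C ^ 2 * S)) ^ 2 by ring,
    Real.sqrt_sq (by positivity)]
  have hS0 : 0 ≤ S := by positivity
  have : (r : ℝ) ≤ r ^ 2 := by exact_mod_cast Nat.le_self_pow two_ne_zero r
  nlinarith [mul_nonneg (sub_nonneg.2 this) (mul_nonneg (sq_nonneg C) hS0)]

section Form

variable [IsManifold 𝓘(ℂ, Fin n → ℂ) ω X] {g : HermitianMetric n n (HolTangent n X)}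
  {h : HermitianMetric n r E}

theorem endNorm_hol_le_formNorm (D : EndForm n E) (x : X) (k : Fin n) :
    endNorm h x (D.hol x (g.unitaryFrame x k)) ≤ formNorm g h D x := by
  refine Real.le_sqrt_of_sq_le ?_
  refine le_trans ?_ (Finset.single_le_sum (f := fun k =>
    endNorm h x (D.hol x (g.unitaryFrame x k)) ^ 2 +
      endNorm h x (D.anti x (g.unitaryFrame x k)) ^ 2) (fun _ _ => by positivity)
    (Finset.mem_univ k))
  exact le_add_of_nonneg_right (sq_nonneg _)

theorem endNorm_anti_le_formNorm (D : EndForm n E) (x : X) (k : Fin n) :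
    endNorm h x (D.anti x (g.unitaryFrame x k)) ≤ formNorm g h D x := by
  refine Real.le_sqrt_of_sq_le ?_
  refine le_trans ?_ (Finset.single_le_sum (f := fun k =>
    endNorm h x (D.hol x (g.unitaryFrame x k)) ^ 2 +
      endNorm h x (D.anti x (g.unitaryFrame x k)) ^ 2) (fun _ _ => by positivity)
    (Finset.mem_univ k))
  exact le_add_of_nonneg_left (sq_nonneg _)

theorem localMatrix_sum_smul {ι : Type*} (s : Finset ι) (a x : X) (c : ι → ℂ)
    (T : ι → E x →ₗ[ℂ] E x) (i j : Fin r) :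
    localMatrix r a x (∑ k ∈ s, c k • T k) i j = ∑ k ∈ s, c k * localMatrix r a x (T k) i j := by
  simp [localMatrix, LinearMap.toMatrix'_apply]

theorem norm_localMatrix_hol_le {a x : X} (hx : x ∈ frameSet r E a)
    {C C' : ℝ} (hC : 0 ≤ C) (hb : h.FrameBound a x C) (hb' : g.FrameBound a x C')
    (D : EndForm n E) (v : Fin n → ℂ) (i j : Fin r) :
    ‖localMatrix r a x (D.hol x (localVector n (HolTangent n X) a x v)) i j‖ ≤
      n * (C' * ‖v‖) * (r ^ 2 * C ^ 2) * formNorm g h D x := by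
  have hu := g.isUnitary_unitaryFrame x
  have h2 := (hb' _ hu).2
  rw [hu.eq_sum (localVector n (HolTangent n X) a x v), map_sum]
  simp only [map_smul]
  rw [localMatrix_sum_smul]
  calc _ ≤ ∑ _k : Fin n, (C' * ‖v‖) * (r ^ 2 * C ^ 2 * formNorm g h D x) :=
        (norm_sum_le _ _).trans (Finset.sum_le_sum fun k _ => by
          rw [norm_mul]
          exact mul_le_mul (h2 v k) ((norm_localMatrix_le hx hC hb _ i j).trans
            (mul_le_mul_of_nonneg_left (endNorm_hol_le_formNorm D x k) (by positivity)))
            (norm_nonneg _) ((norm_nonneg _).trans (h2 v k)))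
    _ = _ := by simp only [Finset.sum_const, Finset.card_univ, Fintype.card_fin, nsmul_eq_mul]; ring

theorem norm_localMatrix_anti_le {a x : X} (hx : x ∈ frameSet r E a)
    {C C' : ℝ} (hC : 0 ≤ C) (hb : h.FrameBound a x C) (hb' : g.FrameBound a x C')
    (D : EndForm n E) (v : Fin n → ℂ) (i j : Fin r) :
    ‖localMatrix r a x (D.anti x (localVector n (HolTangent n X) a x v)) i j‖ ≤
      n * (C' * ‖v‖) * (r ^ 2 * C ^ 2) * formNorm g h D x := by
  have hu := g.isUnitary_unitaryFrame x
  have h2 := (hb' _ hu).2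
  rw [hu.eq_sum (localVector n (HolTangent n X) a x v), map_sum]
  simp only [LinearMap.map_smulₛₗ]
  rw [localMatrix_sum_smul]
  calc _ ≤ ∑ _k : Fin n, (C' * ‖v‖) * (r ^ 2 * C ^ 2 * formNorm g h D x) :=
        (norm_sum_le _ _).trans (Finset.sum_le_sum fun k _ => by
          rw [norm_mul, RCLike.norm_conj]
          exact mul_le_mul (h2 v k) ((norm_localMatrix_le hx hC hb _ i j).trans
            (mul_le_mul_of_nonneg_left (endNorm_anti_le_formNorm D x k) (by positivity)))
            (norm_nonneg _) ((norm_nonneg _).trans (h2 v k)))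
    _ = _ := by simp only [Finset.sum_const, Finset.card_univ, Fintype.card_fin, nsmul_eq_mul]; ring

end Form

end HermBundle

/-! ### Transformation laws of the connection and of the curvature -/

namespace HermBundle

open Topology Matrix
open scoped ComplexOrder

section Calculus

variable {n r : ℕ}

theorem dHol_congr {f f' : (Fin n → ℂ) → ℂ} {y : Fin n → ℂ} (h : f =ᶠ[𝓝 y] f')
    (v : Fin n → ℂ) : dHol f y v = dHol f' y v := by
  rw [dHol, dHol, h.fderiv_eq]

theorem dBar_congr {f f' : (Fin n → ℂ) → ℂ} {y : Fin n → ℂ} (h : f =ᶠ[𝓝 y] f')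
    (v : Fin n → ℂ) : dBar f y v = dBar f' y v := by
  rw [dBar, dBar, h.fderiv_eq]

theorem dHol_sum {ι : Type*} (s : Finset ι) {f : ι → (Fin n → ℂ) → ℂ} {y : Fin n → ℂ}
    (hf : ∀ k, DifferentiableAt ℝ (f k) y) (v : Fin n → ℂ) :
    dHol (fun z => ∑ k ∈ s, f k z) y v = ∑ k ∈ s, dHol (f k) y v := by
  simp only [dHol, fderiv_fun_sum fun k _ => hf k, _root_.sum_apply, Finset.mul_sum,
    ← Finset.sum_sub_distrib, Finset.sum_div]

theorem dBar_sum {ι : Type*} (s : Finset ι) {f : ι → (Fin n → ℂ) → ℂ} {y : Fin n → ℂ}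
    (hf : ∀ k, DifferentiableAt ℝ (f k) y) (v : Fin n → ℂ) :
    dBar (fun z => ∑ k ∈ s, f k z) y v = ∑ k ∈ s, dBar (f k) y v := by
  simp only [dBar, fderiv_fun_sum fun k _ => hf k, _root_.sum_apply, Finset.mul_sum,
    ← Finset.sum_add_distrib, Finset.sum_div]

theorem dBar_add {f m : (Fin n → ℂ) → ℂ} {y : Fin n → ℂ} (hf : DifferentiableAt ℝ f y)
    (hm : DifferentiableAt ℝ m y) (v : Fin n → ℂ) :
    dBar (fun z => f z + m z) y v = dBar f y v + dBar m y v := by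
  simp only [dBar, fderiv_fun_add hf hm, _root_.add_apply]
  ring

theorem dHol_sum_mul {ι : Type*} (s : Finset ι) {f m : ι → (Fin n → ℂ) → ℂ} {y : Fin n → ℂ}
    (hf : ∀ k, DifferentiableAt ℝ (f k) y) (hm : ∀ k, DifferentiableAt ℝ (m k) y)
    (v : Fin n → ℂ) : dHol (fun z => ∑ k ∈ s, f k z * m k z) y v =
      ∑ k ∈ s, (dHol (f k) y v * m k y + f k y * dHol (m k) y v) := by
  rw [dHol_sum (f := fun k z => f k z * m k z) s fun k => (hf k).mul (hm k)]
  exact Finset.sum_congr rfl fun k _ => dHol_mul (hf k) (hm k) v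

theorem dBar_sum_mul {ι : Type*} (s : Finset ι) {f m : ι → (Fin n → ℂ) → ℂ} {y : Fin n → ℂ}
    (hf : ∀ k, DifferentiableAt ℝ (f k) y) (hm : ∀ k, DifferentiableAt ℝ (m k) y)
    (v : Fin n → ℂ) : dBar (fun z => ∑ k ∈ s, f k z * m k z) y v =
      ∑ k ∈ s, (dBar (f k) y v * m k y + f k y * dBar (m k) y v) := by
  rw [dBar_sum (f := fun k z => f k z * m k z) s fun k => (hf k).mul (hm k)]
  exact Finset.sum_congr rfl fun k _ => dBar_mul (hf k) (hm k) v

theorem fderiv_real_eq {f : (Fin n → ℂ) → ℂ} {y : Fin n → ℂ} (hf : DifferentiableAt ℂ f y)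
    (v : Fin n → ℂ) : fderiv ℝ f y v = fderiv ℂ f y v := by
  rw [hf.fderiv_restrictScalars ℝ]; rfl

theorem dBar_holomorphic {f : (Fin n → ℂ) → ℂ} {y : Fin n → ℂ} (hf : DifferentiableAt ℂ f y)
    (v : Fin n → ℂ) : dBar f y v = 0 := by
  rw [dBar, fderiv_real_eq hf, fderiv_real_eq hf, map_smul, smul_eq_mul, ← mul_assoc,
    Complex.I_mul_I]
  ring

theorem dBar_sum_holomorphic_mul {ι : Type*} (s : Finset ι) {f m : ι → (Fin n → ℂ) → ℂ}
    {y : Fin n → ℂ} (hf : ∀ k, DifferentiableAt ℂ (f k) y)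
    (hm : ∀ k, DifferentiableAt ℝ (m k) y) (v : Fin n → ℂ) :
    dBar (fun z => ∑ k ∈ s, f k z * m k z) y v = ∑ k ∈ s, f k y * dBar (m k) y v := by
  rw [dBar_sum_mul s (fun k => (hf k).restrictScalars ℝ) hm]
  exact Finset.sum_congr rfl fun k _ => by rw [dBar_holomorphic (hf k), zero_mul, zero_add]

theorem dHol_holomorphic {f : (Fin n → ℂ) → ℂ} {y : Fin n → ℂ} (hf : DifferentiableAt ℂ f y)
    (v : Fin n → ℂ) : dHol f y v = fderiv ℂ f y v := by
  rw [dHol, fderiv_real_eq hf, fderiv_real_eq hf, map_smul, smul_eq_mul, ← mul_assoc,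
    Complex.I_mul_I]
  ring

theorem dHol_conj_holomorphic {f : (Fin n → ℂ) → ℂ} {y : Fin n → ℂ}
    (hf : DifferentiableAt ℂ f y) (v : Fin n → ℂ) : dHol (fun z => conj (f z)) y v = 0 := by
  rw [← conj_dBar_conj]
  simp only [Complex.conj_conj, dBar_holomorphic hf, map_zero]

theorem smul_eq_re_add_im (c : ℂ) (v : Fin n → ℂ) :
    c • v = c.re • v + c.im • (Complex.I • v) := by
  funext i
  simp only [Pi.smul_apply, Pi.add_apply, smul_eq_mul, Complex.real_smul]
  conv_lhs => rw [← Complex.re_add_im c]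
  ring

theorem dHol_smul_right (f : (Fin n → ℂ) → ℂ) (y : Fin n → ℂ) (c : ℂ) (v : Fin n → ℂ) :
    dHol f y (c • v) = c * dHol f y v := by
  have hI : Complex.I • c • v = c.re • (Complex.I • v) + (-c.im) • v := by
    funext i
    simp only [Pi.smul_apply, Pi.add_apply, smul_eq_mul, Complex.real_smul]
    conv_lhs => rw [← Complex.re_add_im c]
    push_cast
    linear_combination (c.im : ℂ) * v i * Complex.I_mul_I
  rw [dHol, dHol, hI, smul_eq_re_add_im c v]
  simp only [map_add, map_smul, Complex.real_smul]
  conv_rhs => rw [← Complex.re_add_im c]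
  push_cast
  linear_combination ((c.im : ℂ) * fderiv ℝ f y (Complex.I • v) / 2) * Complex.I_mul_I

theorem dBar_smul_right (f : (Fin n → ℂ) → ℂ) (y : Fin n → ℂ) (c : ℂ) (v : Fin n → ℂ) :
    dBar f y (c • v) = conj c * dBar f y v := by
  have h1 := dHol_smul_right (fun z => conj (f z)) y c v
  rw [← conj_dBar_conj, ← conj_dBar_conj] at h1
  simp only [Complex.conj_conj] at h1
  rw [← Complex.conj_conj (dBar f y (c • v)), h1, map_mul, Complex.conj_conj]

theorem dHol_sum_right {ι : Type*} (s : Finset ι) (f : (Fin n → ℂ) → ℂ) (y : Fin n → ℂ)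
    (v : ι → Fin n → ℂ) : dHol f y (∑ k ∈ s, v k) = ∑ k ∈ s, dHol f y (v k) := by
  simp only [dHol, Finset.smul_sum, map_sum, Finset.mul_sum, ← Finset.sum_sub_distrib,
    Finset.sum_div]

theorem dBar_sum_right {ι : Type*} (s : Finset ι) (f : (Fin n → ℂ) → ℂ) (y : Fin n → ℂ)
    (v : ι → Fin n → ℂ) : dBar f y (∑ k ∈ s, v k) = ∑ k ∈ s, dBar f y (v k) := by
  simp only [dBar, Finset.smul_sum, map_sum, Finset.mul_sum, ← Finset.sum_add_distrib,
    Finset.sum_div]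

section Comp

variable {f : (Fin n → ℂ) → ℂ} {ψ : (Fin n → ℂ) → Fin n → ℂ} {y : Fin n → ℂ}

theorem fderiv_comp_holomorphic (hf : DifferentiableAt ℝ f (ψ y)) (hψ : DifferentiableAt ℂ ψ y)
    (v : Fin n → ℂ) :
    fderiv ℝ (fun z => f (ψ z)) y v = fderiv ℝ f (ψ y) (fderiv ℂ ψ y v) := by
  have h : fderiv ℝ (fun z => f (ψ z)) y = (fderiv ℝ f (ψ y)).comp (fderiv ℝ ψ y) :=
    fderiv_comp y hf (hψ.restrictScalars ℝ)
  rw [h, hψ.fderiv_restrictScalars ℝ]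
  rfl

theorem dHol_comp (hf : DifferentiableAt ℝ f (ψ y)) (hψ : DifferentiableAt ℂ ψ y)
    (v : Fin n → ℂ) :
    dHol (fun z => f (ψ z)) y v = dHol f (ψ y) (fderiv ℂ ψ y v) := by
  rw [dHol, dHol, fderiv_comp_holomorphic hf hψ, fderiv_comp_holomorphic hf hψ, map_smul]

theorem dBar_comp (hf : DifferentiableAt ℝ f (ψ y)) (hψ : DifferentiableAt ℂ ψ y)
    (v : Fin n → ℂ) :
    dBar (fun z => f (ψ z)) y v = dBar f (ψ y) (fderiv ℂ ψ y v) := by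
  rw [dBar, dBar, fderiv_comp_holomorphic hf hψ, fderiv_comp_holomorphic hf hψ, map_smul]

end Comp

/-- Entrywise `∂`. -/
noncomputable def matHol (M : (Fin n → ℂ) → Matrix (Fin r) (Fin r) ℂ) (y v : Fin n → ℂ) :
    Matrix (Fin r) (Fin r) ℂ :=
  Matrix.of fun i j => dHol (fun z => M z i j) y v

/-- Entrywise `∂̄`. -/
noncomputable def matBar (M : (Fin n → ℂ) → Matrix (Fin r) (Fin r) ℂ) (y v : Fin n → ℂ) :
    Matrix (Fin r) (Fin r) ℂ :=
  Matrix.of fun i j => dBar (fun z => M z i j) y v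

variable {M N : (Fin n → ℂ) → Matrix (Fin r) (Fin r) ℂ} {y : Fin n → ℂ}

theorem differentiableAt_matrix_mul (hM : ∀ i j, DifferentiableAt ℝ (fun z => M z i j) y)
    (hN : ∀ i j, DifferentiableAt ℝ (fun z => N z i j) y) (i j : Fin r) :
    DifferentiableAt ℝ (fun z => (M z * N z) i j) y := by
  simp only [Matrix.mul_apply]
  exact DifferentiableAt.fun_sum fun k _ => (hM i k).mul (hN k j)

theorem matHol_mul (hM : ∀ i j, DifferentiableAt ℝ (fun z => M z i j) y)
    (hN : ∀ i j, DifferentiableAt ℝ (fun z => N z i j) y) (v : Fin n → ℂ) :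
    matHol (fun z => M z * N z) y v = matHol M y v * N y + M y * matHol N y v := by
  ext i j
  simp only [matHol, Matrix.of_apply, Matrix.add_apply, Matrix.mul_apply]
  rw [← Finset.sum_add_distrib]
  exact dHol_sum_mul _ (fun k => hM i k) (fun k => hN k j) v

theorem matBar_mul (hM : ∀ i j, DifferentiableAt ℝ (fun z => M z i j) y)
    (hN : ∀ i j, DifferentiableAt ℝ (fun z => N z i j) y) (v : Fin n → ℂ) :
    matBar (fun z => M z * N z) y v = matBar M y v * N y + M y * matBar N y v := by
  ext i j
  simp only [matBar, Matrix.of_apply, Matrix.add_apply, Matrix.mul_apply]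
  rw [← Finset.sum_add_distrib]
  exact dBar_sum_mul _ (fun k => hM i k) (fun k => hN k j) v

theorem matHol_congr (h : M =ᶠ[𝓝 y] N) (v : Fin n → ℂ) : matHol M y v = matHol N y v := by
  ext i j
  exact dHol_congr (h.mono fun z hz => by simp only [hz]) v

theorem matBar_congr (h : M =ᶠ[𝓝 y] N) (v : Fin n → ℂ) : matBar M y v = matBar N y v := by
  ext i j
  exact dBar_congr (h.mono fun z hz => by simp only [hz]) v

theorem matBar_holomorphic (hM : ∀ i j, DifferentiableAt ℂ (fun z => M z i j) y)
    (v : Fin n → ℂ) : matBar M y v = 0 := by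
  ext i j
  exact dBar_holomorphic (hM i j) v

theorem matHol_conjTranspose (hM : ∀ i j, DifferentiableAt ℂ (fun z => M z i j) y)
    (v : Fin n → ℂ) : matHol (fun z => (M z)ᴴ) y v = 0 := by
  ext i j
  exact dHol_conj_holomorphic (hM j i) v

end Calculus

variable {n r : ℕ} {X : Type*} [TopologicalSpace X] [ChartedSpace (Fin n → ℂ) X]
  {E : X → Type*} [∀ x, AddCommGroup (E x)] [∀ x, Module ℂ (E x)] [∀ x, TopologicalSpace (E x)]
  [TopologicalSpace (TotalSpace (Fin r → ℂ) E)] [FiberBundle (Fin r → ℂ) E]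
  [VectorBundle ℂ (Fin r → ℂ) E]

namespace HermitianMetric

/-- The connection matrix is a form of type `(1,0)`, hence complex linear in the direction. -/
theorem connection_eq_sum (h : HermitianMetric n r E) (a : X) (y v : Fin n → ℂ) (i j : Fin r) :
    h.connection a y v i j = ∑ k, v k * h.connection a y (Pi.single k 1) i j := by
  simp only [connection, Matrix.mul_apply, Matrix.of_apply]
  conv_lhs => rw [pi_eq_sum_univ' v]
  simp only [dHol_sum_right, dHol_smul_right, Finset.mul_sum]
  rw [Finset.sum_comm]
  refine Finset.sum_congr rfl fun k _ => Finset.sum_congr rfl fun l _ => ?_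
  rw [mul_left_comm]

theorem differentiableAt_connection (h : HermitianMetric n r E) {a : X} {y : Fin n → ℂ}
    (hy : y ∈ localDomain n r E a) (v : Fin n → ℂ) (i j : Fin r) :
    DifferentiableAt ℝ (fun z => h.connection a z v i j) y :=
  ((h.contDiffOn_connection a v i j).contDiffAt
    ((isOpen_localDomain a).mem_nhds hy)).differentiableAt (by simp)

theorem differentiableAt_gram (h : HermitianMetric n r E) {a : X} {y : Fin n → ℂ}
    (hy : y ∈ localDomain n r E a) (i j : Fin r) :
    DifferentiableAt ℝ (fun z => h.gram a z i j) y :=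
  ((h.contDiffOn_gram a i j).contDiffAt
    ((isOpen_localDomain a).mem_nhds hy)).differentiableAt (by simp)

theorem curvature_eq_sum (h : HermitianMetric n r E) {a : X} {y : Fin n → ℂ}
    (hy : y ∈ localDomain n r E a) (u v : Fin n → ℂ) (i j : Fin r) :
    h.curvature a y u v i j =
      ∑ k, u k * ∑ l, conj (v l) * h.curvature a y (Pi.single k 1) (Pi.single l 1) i j := by
  simp only [curvature, Matrix.of_apply]
  have h1 : (fun z => h.connection a z u i j) =
      fun z => ∑ k, u k * h.connection a z (Pi.single k 1) i j := by
    funext z; exact h.connection_eq_sum a z u i j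
  rw [h1]
  refine (dBar_sum_holomorphic_mul _ (fun k => differentiableAt_const (u k))
    (fun k => h.differentiableAt_connection hy (Pi.single k 1) i j) v).trans ?_
  refine Finset.sum_congr rfl fun k _ => congrArg _ ?_
  conv_lhs => rw [pi_eq_sum_univ' v]
  rw [dBar_sum_right]
  exact Finset.sum_congr rfl fun l _ => dBar_smul_right _ _ _ _

end HermitianMetric

section Transition

variable [IsManifold 𝓘(ℂ, Fin n → ℂ) ω X]
  [ContMDiffVectorBundle ω (Fin r → ℂ) E 𝓘(ℂ, Fin n → ℂ)]

variable (n r E) in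
/-- The part of the chart at `a` where the charts and the frames attached to `a` and to `b` are
defined. -/
def frameOverlap (a b : X) : Set (Fin n → ℂ) :=
  (localDomain n r E a ∩ overlap n a b) ∩ ((chartAt (Fin n → ℂ) a).target ∩
    (chartAt (Fin n → ℂ) a).symm ⁻¹' frameSet r E b)

theorem isOpen_frameOverlap (a b : X) : IsOpen (frameOverlap n r E a b) :=
  ((isOpen_localDomain a).inter (isOpen_overlap a b)).inter
    ((chartAt (Fin n → ℂ) a).symm.isOpen_inter_preimage
      (trivializationAt (Fin r → ℂ) E b).open_baseSet)

theorem chartChange_mem_localDomain {a b : X} {y : Fin n → ℂ}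
    (hy : y ∈ frameOverlap n r E a b) : chartChange n a b y ∈ localDomain n r E b := by
  refine ⟨(chartChange_mem hy.1.2).1, ?_⟩
  rw [Set.mem_preimage, symm_chartChange hy.1.2]
  exact hy.2.2

/-- The transition matrix in the coordinates attached to `a`. -/
noncomputable def coordTransition (n r : ℕ) {X : Type*} [TopologicalSpace X]
    [ChartedSpace (Fin n → ℂ) X] (E : X → Type*) [∀ x, AddCommGroup (E x)]
    [∀ x, Module ℂ (E x)] [∀ x, TopologicalSpace (E x)]
    [TopologicalSpace (TotalSpace (Fin r → ℂ) E)] [FiberBundle (Fin r → ℂ) E]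
    [VectorBundle ℂ (Fin r → ℂ) E] (a b c : X) (y : Fin n → ℂ) :
    Matrix (Fin r) (Fin r) ℂ :=
  transition r E b c ((chartAt (Fin n → ℂ) a).symm y)

theorem HermitianMetric.gram_eq_transition (h : HermitianMetric n r E) {a b : X}
    {y : Fin n → ℂ} (hy : y ∈ frameOverlap n r E a b) :
    h.gram a y = (coordTransition n r E a a b y)ᴴ * h.gram b (chartChange n a b y) *
      coordTransition n r E a a b y := by
  rw [gram_eq_gramAt, gram_eq_gramAt, symm_chartChange hy.1.2]
  exact h.gramAt_eq_transition hy.2.2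

theorem contDiffAt_coordTransition {a b : X} {y : Fin n → ℂ}
    (hy : y ∈ frameOverlap n r E a b) (i j : Fin r) :
    ContDiffAt ℂ ω (fun z => coordTransition n r E a a b z i j) y :=
  contDiffAt_transition a b a hy.2.1 hy.1.1.2 hy.2.2 i j

theorem contDiffAt_coordTransition' {a b : X} {y : Fin n → ℂ}
    (hy : y ∈ frameOverlap n r E a b) (i j : Fin r) :
    ContDiffAt ℂ ω (fun z => coordTransition n r E a b a z i j) y :=
  contDiffAt_transition b a a hy.2.1 hy.2.2 hy.1.1.2 i j

theorem coordTransition_mul {a b : X} {y : Fin n → ℂ} (hy : y ∈ frameOverlap n r E a b) :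
    coordTransition n r E a b a y * coordTransition n r E a a b y = 1 := by
  rw [coordTransition, coordTransition, transition_mul_transition hy.2.2,
    transition_self hy.1.1.2]

/-- Apply `∂` to `H = T* H' T`. The factor `T*` is antiholomorphic and contributes nothing, and
multiplying by `H⁻¹` leaves the gauge law `A = T⁻¹ A' T + T⁻¹ ∂T`. -/
theorem HermitianMetric.connection_transition (h : HermitianMetric n r E) {a b : X}
    {y : Fin n → ℂ} (hy : y ∈ frameOverlap n r E a b) (u : Fin n → ℂ) :
    h.connection a y u = coordTransition n r E a b a y *
        h.connection b (chartChange n a b y) (fderiv ℂ (chartChange n a b) y u) *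
        coordTransition n r E a a b y +
      coordTransition n r E a b a y * matHol (coordTransition n r E a a b) y u := by
  set T := coordTransition n r E a a b
  set S := coordTransition n r E a b a
  set ψ := chartChange n a b
  have hTd : ∀ i j, DifferentiableAt ℂ (fun z => T z i j) y := fun i j =>
    (contDiffAt_coordTransition hy i j).differentiableAt (by simp)
  have hTr : ∀ i j, DifferentiableAt ℝ (fun z => T z i j) y := fun i j =>
    (hTd i j).restrictScalars ℝ
  have hTH : ∀ i j, DifferentiableAt ℝ (fun z => (T z)ᴴ i j) y := fun i j =>
    (Complex.conjCLE : ℂ →L[ℝ] ℂ).differentiableAt.comp y (hTr j i)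
  have hψ : DifferentiableAt ℂ ψ y := differentiableAt_chartChange hy.1.2
  have hyb : ψ y ∈ localDomain n r E b := chartChange_mem_localDomain hy
  have hH : ∀ i j, DifferentiableAt ℝ (fun z => h.gram b (ψ z) i j) y := fun i j =>
    (h.differentiableAt_gram hyb i j).comp y (hψ.restrictScalars ℝ)
  have hST : S y * T y = 1 := coordTransition_mul hy
  have hgram : h.gram a =ᶠ[𝓝 y] fun z => ((T z)ᴴ * h.gram b (ψ z)) * T z := by
    filter_upwards [(isOpen_frameOverlap a b).mem_nhds hy] with z hz
    exact h.gram_eq_transition hz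
  have hd : matHol (h.gram a) y u = ((T y)ᴴ * h.dGram b (ψ y) (fderiv ℂ ψ y u)) * T y +
      (T y)ᴴ * h.gram b (ψ y) * matHol T y u := by
    rw [matHol_congr hgram, matHol_mul (differentiableAt_matrix_mul hTH hH) hTr,
      matHol_mul hTH hH, matHol_conjTranspose hTd, Matrix.zero_mul, zero_add]
    congr 3
    ext i j
    exact dHol_comp (h.differentiableAt_gram hyb i j) hψ u
  have hu : IsUnit (h.gram a y).det := h.isUnit_det_gram hy.1.1
  have hmain : h.gram a y * h.connection a y u = h.gram a y *
      (S y * h.connection b (ψ y) (fderiv ℂ ψ y u) * T y + S y * matHol T y u) := by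
    have hgS : h.gram a y * S y = (T y)ᴴ * h.gram b (ψ y) := by
      rw [hgram.eq_of_nhds, Matrix.mul_assoc, mul_eq_one_comm.1 hST, Matrix.mul_one]
    have e1 : h.gram a y * h.connection a y u = matHol (h.gram a) y u :=
      h.gram_mul_connection hy.1.1 u
    rw [e1, hd, Matrix.mul_add, ← Matrix.mul_assoc, ← Matrix.mul_assoc, ← Matrix.mul_assoc,
      hgS, Matrix.mul_assoc (T y)ᴴ (h.gram b (ψ y)) (h.connection b (ψ y) _),
      h.gram_mul_connection hyb]
  have := congrArg ((h.gram a y)⁻¹ * ·) hmain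
  simpa only [← Matrix.mul_assoc, Matrix.nonsing_inv_mul _ hu, Matrix.one_mul,
    Matrix.mul_add] using this

/-- Apply `∂̄` to the gauge law. The matrices `T`, `T⁻¹` and `∂T` are holomorphic, so only `T⁻¹
(∂̄A') T` survives and the curvature is a tensor. -/
theorem HermitianMetric.curvature_transition (h : HermitianMetric n r E) {a b : X}
    {y : Fin n → ℂ} (hy : y ∈ frameOverlap n r E a b) (u v : Fin n → ℂ) :
    h.curvature a y u v = coordTransition n r E a b a y *
        h.curvature b (chartChange n a b y) (fderiv ℂ (chartChange n a b) y u)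
          (fderiv ℂ (chartChange n a b) y v) * coordTransition n r E a a b y := by
  set T := coordTransition n r E a a b
  set S := coordTransition n r E a b a
  set ψ := chartChange n a b
  have hTd : ∀ i j, DifferentiableAt ℂ (fun z => T z i j) y := fun i j =>
    (contDiffAt_coordTransition hy i j).differentiableAt (by simp)
  have hSd : ∀ i j, DifferentiableAt ℂ (fun z => S z i j) y := fun i j =>
    (contDiffAt_coordTransition' hy i j).differentiableAt (by simp)
  have hTr : ∀ i j, DifferentiableAt ℝ (fun z => T z i j) y := fun i j =>
    (hTd i j).restrictScalars ℝ
  have hSr : ∀ i j, DifferentiableAt ℝ (fun z => S z i j) y := fun i j =>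
    (hSd i j).restrictScalars ℝ
  have hψ : DifferentiableAt ℂ ψ y := differentiableAt_chartChange hy.1.2
  -- The pulled-back direction `dψ(u)` depends on the point, but holomorphically, so it is not seen
  -- by `∂̄`.
  have hψ' : ∀ k, DifferentiableAt ℂ (fun z => fderiv ℂ ψ z u k) y := by
    intro k
    have h1 : ContDiffAt ℂ ω ψ y := (contDiffOn_chartChange a b).contDiffAt
      ((isOpen_overlap a b).mem_nhds hy.1.2)
    have h2 : DifferentiableAt ℂ (fderiv ℂ ψ) y :=
      (h1.fderiv_right (m := 1) (by exact le_top)).differentiableAt (by simp)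
    exact differentiableAt_pi.1 (h2.clm_apply (differentiableAt_const u)) k
  have hTu : ∀ i j, DifferentiableAt ℂ (fun z => matHol T z u i j) y := by
    intro i j
    have h2 : DifferentiableAt ℂ (fderiv ℂ (fun z => T z i j)) y :=
      ((contDiffAt_coordTransition hy i j).fderiv_right (m := 1)
        (by exact le_top)).differentiableAt (by simp)
    refine (h2.clm_apply (differentiableAt_const u)).congr_of_eventuallyEq ?_
    filter_upwards [(isOpen_frameOverlap a b).mem_nhds hy] with z hz
    exact dHol_holomorphic ((contDiffAt_coordTransition hz i j).differentiableAt (by simp)) u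
  have hyb : ψ y ∈ localDomain n r E b := chartChange_mem_localDomain hy
  have hAk : ∀ k i j, DifferentiableAt ℝ
      (fun z => h.connection b (ψ z) (Pi.single k 1) i j) y := fun k i j =>
    (h.differentiableAt_connection hyb (Pi.single k 1) i j).comp y (hψ.restrictScalars ℝ)
  set B : (Fin n → ℂ) → Matrix (Fin r) (Fin r) ℂ := fun z =>
    h.connection b (ψ z) (fderiv ℂ ψ z u) with hBdef
  have hBsum : ∀ i j, (fun z => B z i j) =
      fun z => ∑ k, fderiv ℂ ψ z u k * h.connection b (ψ z) (Pi.single k 1) i j := by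
    intro i j; funext z; exact h.connection_eq_sum b (ψ z) _ i j
  have hB : ∀ i j, DifferentiableAt ℝ (fun z => B z i j) y := by
    intro i j
    rw [hBsum]
    exact DifferentiableAt.fun_sum fun k _ => ((hψ' k).restrictScalars ℝ).mul (hAk k i j)
  have hBbar : matBar B y v = h.curvature b (ψ y) (fderiv ℂ ψ y u) (fderiv ℂ ψ y v) := by
    ext i j
    have e1 : h.curvature b (ψ y) (fderiv ℂ ψ y u) (fderiv ℂ ψ y v) i j =
        ∑ k, fderiv ℂ ψ y u k *
          dBar (fun z => h.connection b z (Pi.single k 1) i j) (ψ y) (fderiv ℂ ψ y v) := by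
      simp only [curvature, Matrix.of_apply]
      rw [funext fun z => h.connection_eq_sum b z (fderiv ℂ ψ y u) i j]
      exact dBar_sum_holomorphic_mul _ (fun k => differentiableAt_const _)
        (fun k => h.differentiableAt_connection hyb (Pi.single k 1) i j) _
    rw [e1, matBar, Matrix.of_apply, hBsum]
    refine (dBar_sum_holomorphic_mul _ hψ' (fun k => hAk k i j) v).trans ?_
    exact Finset.sum_congr rfl fun k _ => congrArg _
      (dBar_comp (h.differentiableAt_connection hyb (Pi.single k 1) i j) hψ v)
  have hconn : (fun z => h.connection a z u) =ᶠ[𝓝 y]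
      fun z => (S z * B z) * T z + S z * matHol T z u := by
    filter_upwards [(isOpen_frameOverlap a b).mem_nhds hy] with z hz
    exact h.connection_transition hz u
  have hSB := differentiableAt_matrix_mul hSr hB
  have hTur : ∀ i j, DifferentiableAt ℝ (fun z => matHol T z u i j) y := fun i j =>
    (hTu i j).restrictScalars ℝ
  have hadd : matBar (fun z => (S z * B z) * T z + S z * matHol T z u) y v =
      matBar (fun z => (S z * B z) * T z) y v + matBar (fun z => S z * matHol T z u) y v := by
    ext i j
    exact dBar_add (differentiableAt_matrix_mul hSB hTr i j)
      (differentiableAt_matrix_mul hSr hTur i j) v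
  have e : h.curvature a y u v = matBar (fun z => h.connection a z u) y v := rfl
  rw [e, matBar_congr hconn, hadd, matBar_mul hSB hTr, matBar_mul hSr hB,
    matBar_mul hSr hTur, matBar_holomorphic hSd, matBar_holomorphic hTd, matBar_holomorphic hTu,
    hBbar]
  simp

end Transition

end HermBundle

/-! ### Uniform bound for the curvature term -/

namespace HermBundle

open Topology Matrix

variable {n r : ℕ} {X : Type*} [TopologicalSpace X] [ChartedSpace (Fin n → ℂ) X]
  {E : X → Type*} [∀ x, AddCommGroup (E x)] [∀ x, Module ℂ (E x)] [∀ x, TopologicalSpace (E x)]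
  [TopologicalSpace (TotalSpace (Fin r → ℂ) E)] [FiberBundle (Fin r → ℂ) E]
  [VectorBundle ℂ (Fin r → ℂ) E]
  [IsManifold 𝓘(ℂ, Fin n → ℂ) ω X]
  [ContMDiffVectorBundle ω (Fin r → ℂ) E 𝓘(ℂ, Fin n → ℂ)]

/-- The definition uses the chart and the frame attached to `x` itself, which need not vary
continuously with `x`. Since curvature and `w` are conjugated by the same transition matrix, the
trace may be computed in one fixed chart, where compactness gives bounds. -/
theorem curvatureDensity_eq (g : HermitianMetric n n (HolTangent n X))
    (h : HermitianMetric n r E) (w : EndSection E) {b x : X}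
    (hx : x ∈ (chartAt (Fin n → ℂ) b).source) (hxE : x ∈ frameSet r E b) :
    curvatureDensity g h w x = -(1 / (n : ℝ)) * ∑ k,
      (Matrix.trace (h.curvature b (chartAt (Fin n → ℂ) b x)
        (localCoord n b x (g.unitaryFrame x k)) (localCoord n b x (g.unitaryFrame x k)) *
          localMatrix r b x (w x))).re := by
  have hs : (chartAt (Fin n → ℂ) x).symm (chartAt (Fin n → ℂ) x x) = x :=
    (chartAt (Fin n → ℂ) x).left_inv (mem_chart_source _ x)
  set y := chartAt (Fin n → ℂ) x x with hy
  have hxx : x ∈ frameSet r E x := FiberBundle.mem_baseSet_trivializationAt' x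
  have hov : y ∈ frameOverlap n r E x b := by
    have ht : y ∈ (chartAt (Fin n → ℂ) x).target := mem_chart_target _ x
    refine ⟨⟨⟨ht, ?_⟩, ⟨ht, ?_⟩⟩, ⟨ht, ?_⟩⟩ <;> rw [Set.mem_preimage, hs] <;> assumption
  have hψ : chartChange n x b y = chartAt (Fin n → ℂ) b x := by rw [chartChange, hs]
  have hc : ∀ e : HolTangent n X x,
      fderiv ℂ (chartChange n x b) y (localCoord n x x e) = localCoord n b x e := by
    intro e
    rw [← transition_tangent_mulVec hov.1.2, hs, transition_mulVec, localVector_localCoord]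
    rw [frameSet_tangent]
    exact mem_chart_source _ x
  rw [curvatureDensity]
  refine congrArg (-(1 / (n : ℝ)) * ·) (Finset.sum_congr rfl fun k _ => congrArg Complex.re ?_)
  rw [h.curvature_transition hov, hc, hψ, coordTransition, coordTransition, hs,
    localMatrix_eq_transition (a := b) hxx (w x), Matrix.mul_assoc, Matrix.mul_assoc,
    Matrix.trace_mul_comm]
  simp only [Matrix.mul_assoc]

theorem HermitianMetric.exists_curvature_bound (h : HermitianMetric n r E) {b : X}
    {K : Set (Fin n → ℂ)} (hK : IsCompact K) (hKs : K ⊆ localDomain n r E b) :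
    ∃ B : ℝ, 0 ≤ B ∧ ∀ y ∈ K, ∀ u v i j,
      ‖h.curvature b y u v i j‖ ≤ n ^ 2 * B * ‖u‖ * ‖v‖ := by
  have hcont : ∀ k l i j, ContinuousOn
      (fun y => h.curvature b y (Pi.single k 1) (Pi.single l 1) i j) K := fun k l i j =>
    ((contDiffOn_dBar (isOpen_localDomain b) (h.contDiffOn_connection b (Pi.single k 1) i j)
      (Pi.single l 1)).continuousOn).mono hKs
  obtain ⟨B, hB⟩ := hK.exists_bound_of_continuousOn
    (f := fun y => ∑ k : Fin n, ∑ l : Fin n, ∑ i, ∑ j,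
      ‖h.curvature b y (Pi.single k 1) (Pi.single l 1) i j‖)
    (continuousOn_finsetSum _ fun k _ => continuousOn_finsetSum _ fun l _ =>
      continuousOn_finsetSum _ fun i _ => continuousOn_finsetSum _ fun j _ => (hcont k l i j).norm)
  have hent : ∀ y ∈ K, ∀ k l i j,
      ‖h.curvature b y (Pi.single k 1) (Pi.single l 1) i j‖ ≤ |B| := by
    intro y hy k l i j
    refine le_trans ?_ ((le_abs_self _).trans ((hB y hy).trans (le_abs_self B)))
    refine le_trans ?_ (Finset.single_le_sum (f := fun k => ∑ l : Fin n, ∑ i, ∑ j,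
      ‖h.curvature b y (Pi.single k 1) (Pi.single l 1) i j‖)
      (fun _ _ => by positivity) (Finset.mem_univ k))
    refine le_trans ?_ (Finset.single_le_sum (f := fun l => ∑ i, ∑ j,
      ‖h.curvature b y (Pi.single k 1) (Pi.single l 1) i j‖)
      (fun _ _ => by positivity) (Finset.mem_univ l))
    refine le_trans ?_ (Finset.single_le_sum (f := fun i => ∑ j,
      ‖h.curvature b y (Pi.single k 1) (Pi.single l 1) i j‖)
      (fun _ _ => by positivity) (Finset.mem_univ i))
    exact Finset.single_le_sum (f := fun j =>
      ‖h.curvature b y (Pi.single k 1) (Pi.single l 1) i j‖)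
      (fun _ _ => by positivity) (Finset.mem_univ j)
  refine ⟨|B|, abs_nonneg B, fun y hy u v i j => ?_⟩
  rw [h.curvature_eq_sum (hKs hy)]
  calc _ ≤ ∑ _k : Fin n, ‖u‖ * ∑ _l : Fin n, ‖v‖ * |B| := by
        refine (norm_sum_le _ _).trans (Finset.sum_le_sum fun k _ => ?_)
        rw [norm_mul]
        refine mul_le_mul (norm_le_pi_norm u k) ((norm_sum_le _ _).trans
          (Finset.sum_le_sum fun l _ => ?_)) (norm_nonneg _) (norm_nonneg _)
        rw [norm_mul, RCLike.norm_conj]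
        exact mul_le_mul (norm_le_pi_norm v l) (hent y hy k l i j) (norm_nonneg _) (norm_nonneg _)
    _ = _ := by simp only [Finset.sum_const, Finset.card_univ, Fintype.card_fin, nsmul_eq_mul]; ring

theorem norm_trace_mul_le {r : ℕ} {M N : Matrix (Fin r) (Fin r) ℂ} {A B : ℝ}
    (hM : ∀ i j, ‖M i j‖ ≤ A) (hN : ∀ i j, ‖N i j‖ ≤ B) : ‖(M * N).trace‖ ≤ r ^ 2 * A * B := by
  simp only [Matrix.trace, Matrix.diag, Matrix.mul_apply]
  calc _ ≤ ∑ _i : Fin r, ∑ _j : Fin r, A * B := by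
        refine (norm_sum_le _ _).trans (Finset.sum_le_sum fun i _ =>
          (norm_sum_le _ _).trans (Finset.sum_le_sum fun j _ => ?_))
        rw [norm_mul]
        exact mul_le_mul (hM i j) (hN j i) (norm_nonneg _) ((norm_nonneg _).trans (hM i j))
    _ = _ := by simp only [Finset.sum_const, Finset.card_univ, Fintype.card_fin, nsmul_eq_mul]; ring

theorem exists_abs_curvatureDensity_le_chart (g : HermitianMetric n n (HolTangent n X))
    (h : HermitianMetric n r E) {b : X} {K : Set (Fin n → ℂ)} (hK : IsCompact K)
    (hKs : K ⊆ localDomain n r E b) : ∃ C : ℝ, 0 ≤ C ∧ ∀ x ∈ (chartAt (Fin n → ℂ) b).symm '' K,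
      ∀ w : EndSection E, |curvatureDensity g h w x| ≤ C * endNorm h x (w x) := by
  obtain ⟨B, hB0, hB⟩ := h.exists_curvature_bound hK hKs
  obtain ⟨C, hC0, hC⟩ := h.exists_frameBound hK hKs
  have hKs' : K ⊆ localDomain n n (HolTangent n X) b := by
    rw [localDomain_tangent]; exact hKs.trans (localDomain_subset_target b)
  obtain ⟨C', hC0', hC'⟩ := g.exists_frameBound hK hKs'
  refine ⟨1 / n * (n * (r ^ 2 * (n ^ 2 * B * C' * C') * (r ^ 2 * C ^ 2))), by positivity, ?_⟩
  rintro _ ⟨y, hy, rfl⟩ w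
  have hyt : y ∈ (chartAt (Fin n → ℂ) b).target := localDomain_subset_target b (hKs hy)
  rw [curvatureDensity_eq g h w ((chartAt (Fin n → ℂ) b).map_target hyt) (hKs hy).2,
    (chartAt (Fin n → ℂ) b).right_inv hyt]
  set x := (chartAt (Fin n → ℂ) b).symm y with hx
  rw [abs_mul, abs_neg, abs_of_nonneg (a := 1 / (n : ℝ)) (by positivity), mul_assoc]
  refine mul_le_mul_of_nonneg_left ?_ (by positivity)
  have hc : ∀ k, ‖localCoord n b x (g.unitaryFrame x k)‖ ≤ C' :=
    (hC' y hy _ (g.isUnitary_unitaryFrame x)).1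
  calc _ ≤ ∑ _k : Fin n, r ^ 2 * (n ^ 2 * B * C' * C') * (r ^ 2 * C ^ 2 * endNorm h x (w x)) := by
        refine (Finset.abs_sum_le_sum_abs _ _).trans (Finset.sum_le_sum fun k _ => ?_)
        refine (Complex.abs_re_le_norm _).trans (norm_trace_mul_le (fun i j => ?_) fun i j => ?_)
        · refine (hB y hy _ _ i j).trans ?_
          gcongr
          · exact hc k
          · exact hc k
        · exact norm_localMatrix_le (hKs hy).2 hC0.le (hC y hy) _ i j
    _ = _ := by simp only [Finset.sum_const, Finset.card_univ, Fintype.card_fin, nsmul_eq_mul]; ring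

/-- Finitely many coordinate balls cover `X`, and the sum of their constants serves for all of them,
independently of `w`. -/
theorem exists_abs_curvatureDensity_le [CompactSpace X]
    (g : HermitianMetric n n (HolTangent n X)) (h : HermitianMetric n r E) :
    ∃ C : ℝ, 0 ≤ C ∧ ∀ (w : EndSection E) (x : X),
      |curvatureDensity g h w x| ≤ C * endNorm h x (w x) := by
  obtain ⟨I, R, hR, hcov⟩ := exists_chartBall_cover n r E
  have hK : ∀ b, Metric.closedBall (chartAt (Fin n → ℂ) b b) (R b) ⊆ localDomain n r E b :=
    fun b => (Metric.closedBall_subset_closedBall (by linarith [(hR b).1])).trans (hR b).2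
  choose C hC0 hC using fun b =>
    exists_abs_curvatureDensity_le_chart g h (isCompact_closedBall _ _) (hK b)
  refine ⟨∑ b ∈ I, C b, Finset.sum_nonneg fun b _ => hC0 b, fun w x => ?_⟩
  obtain ⟨b, hb, hxb⟩ := hcov x
  exact (hC b x hxb w).trans (mul_le_mul_of_nonneg_right
    (Finset.single_le_sum (fun b _ => hC0 b) hb) (endNorm_nonneg _ _ _))

end HermBundle

/-! ### Hölder's inequality and the gradient estimate -/

namespace HermBundle

open Topology

section Holder

variable {α : Type*} [MeasurableSpace α] {μ : Measure α}

/-- Here `|F| ≤ |u|^{1/2} |e|^{1/2}`, and Hölder gives the geometric mean of the two norms on the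
right; replacing each of them by their sum bounds it by the sum. -/
theorem eLpNorm_le_add_of_sq_le {F u e : α → ℝ} (hu : AEStronglyMeasurable u μ)
    (he : AEStronglyMeasurable e μ) (hF : ∀ᵐ x ∂μ, F x ^ 2 ≤ u x * e x) (p q : ℝ≥0∞)
    [hpq : ENNReal.HolderTriple (2 * q) 2 p] : eLpNorm F p μ ≤ eLpNorm u q μ + eLpNorm e 1 μ := by
  have hhalf : ENNReal.ofReal (1 / 2) = 2⁻¹ := by
    rw [one_div, ENNReal.ofReal_inv_of_pos (by norm_num), ENNReal.ofReal_ofNat]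
  have hu' : AEStronglyMeasurable (fun x => ‖u x‖ ^ (1 / 2 : ℝ)) μ :=
    (Real.continuous_rpow_const (by norm_num)).comp_aestronglyMeasurable hu.norm
  have he' : AEStronglyMeasurable (fun x => ‖e x‖ ^ (1 / 2 : ℝ)) μ :=
    (Real.continuous_rpow_const (by norm_num)).comp_aestronglyMeasurable he.norm
  have h1 : eLpNorm F p μ ≤
      eLpNorm ((fun x => ‖u x‖ ^ (1 / 2 : ℝ)) • fun x => ‖e x‖ ^ (1 / 2 : ℝ)) p μ := by
    refine eLpNorm_mono_ae ?_
    filter_upwards [hF] with x hx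
    simp only [Pi.smul_apply', smul_eq_mul]
    rw [← Real.mul_rpow (norm_nonneg _) (norm_nonneg _), ← norm_mul, ← Real.sqrt_eq_rpow,
      Real.norm_of_nonneg (Real.sqrt_nonneg _), Real.norm_eq_abs]
    exact Real.abs_le_sqrt (hx.trans (le_abs_self _))
  have h2 : eLpNorm (fun x => ‖u x‖ ^ (1 / 2 : ℝ)) (2 * q) μ = eLpNorm u q μ ^ (1 / 2 : ℝ) := by
    rw [eLpNorm_norm_rpow _ (by norm_num), hhalf, mul_comm 2 q, mul_assoc,
      ENNReal.mul_inv_cancel (by simp) (by simp), mul_one]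
  have h3 : eLpNorm (fun x => ‖e x‖ ^ (1 / 2 : ℝ)) 2 μ = eLpNorm e 1 μ ^ (1 / 2 : ℝ) := by
    rw [eLpNorm_norm_rpow _ (by norm_num), hhalf, ENNReal.mul_inv_cancel (by simp) (by simp)]
  refine h1.trans ((eLpNorm_smul_le_mul_eLpNorm (p := 2 * q) (q := 2) he' hu').trans ?_)
  rw [h2, h3]
  calc _ ≤ (eLpNorm u q μ + eLpNorm e 1 μ) ^ (1 / 2 : ℝ) *
        (eLpNorm u q μ + eLpNorm e 1 μ) ^ (1 / 2 : ℝ) := by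
        gcongr
        · exact le_self_add
        · exact le_add_self
    _ = _ := by
        rw [← ENNReal.rpow_add_of_nonneg _ _ (by norm_num) (by norm_num)]
        norm_num

/-- Powers of the total volume occur with exponents depending on `p`; this bounds them uniformly, so
the final constants do not depend on `p`. -/
theorem rpow_le_one_add {V : ℝ≥0∞} {t : ℝ} (h0 : 0 ≤ t) (h1 : t ≤ 1) : V ^ t ≤ 1 + V := by
  rcases le_total V 1 with h | h
  · exact (ENNReal.rpow_le_one h h0).trans le_self_add
  · calc V ^ t ≤ V ^ (1 : ℝ) := ENNReal.rpow_le_rpow_of_exponent_le h h1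
      _ ≤ 1 + V := by rw [ENNReal.rpow_one]; exact le_add_self

theorem eLpNorm_le_mul_one_add {F : Type*} [NormedAddCommGroup F] {f : α → F} {p q : ℝ≥0∞}
    (hp : 1 ≤ p) (hpq : p ≤ q) (hf : AEStronglyMeasurable f μ) :
    eLpNorm f p μ ≤ eLpNorm f q μ * (1 + μ Set.univ) := by
  refine (eLpNorm_le_eLpNorm_mul_rpow_measure_univ hpq hf).trans
    (mul_le_mul_right (rpow_le_one_add ?_ ?_) _)
  · rcases eq_or_ne q ⊤ with rfl | hq
    · simp
    · have hp0 : p ≠ ⊤ := ne_top_of_le_ne_top hq hpq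
      have h1 : 0 < p.toReal := ENNReal.toReal_pos (one_pos.trans_le hp).ne' hp0
      exact sub_nonneg.2 (one_div_le_one_div_of_le h1 (ENNReal.toReal_mono hq hpq))
  · have h1 : 1 / p.toReal ≤ 1 := by
      rcases eq_or_ne p ⊤ with rfl | hp'
      · simp
      · have : 1 ≤ p.toReal := by simpa using ENNReal.toReal_mono hp' hp
        rw [div_le_one (by linarith)]; exact this
    have h2 : 0 ≤ 1 / q.toReal := by positivity
    linarith

theorem eLpNorm_const_le_one_add {q : ℝ≥0∞} (hq : 1 ≤ q) (c : ℝ) :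
    eLpNorm (fun _ : α => c) q μ ≤ ‖c‖ₑ * (1 + μ Set.univ) := by
  rcases eq_or_ne μ 0 with rfl | hμ
  · simp
  rw [eLpNorm_const c (one_pos.trans_le hq).ne' hμ]
  refine mul_le_mul_right (rpow_le_one_add (by positivity) ?_) _
  rcases eq_or_ne q ⊤ with rfl | hq'
  · simp
  · have : 1 ≤ q.toReal := by simpa using ENNReal.toReal_mono hq' hq
    rw [div_le_one (by linarith)]; exact this

/-- The exponents `2 p/(2-p)`, `2` and `p` are a Hölder triple. -/
theorem holderTriple_conj {p : ℝ} (h1 : 1 ≤ p) (h2 : p ≤ 2) :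
    ENNReal.HolderTriple (2 * (ENNReal.ofReal p / ENNReal.ofReal (2 - p))) 2
      (ENNReal.ofReal p) := by
  have ha0 : ENNReal.ofReal p ≠ 0 := (ENNReal.ofReal_pos.2 (by linarith)).ne'
  have hsum : ENNReal.ofReal (2 - p) + ENNReal.ofReal p = 2 := by
    rw [← ENNReal.ofReal_add (by linarith) (by linarith)]; norm_num
  constructor
  rw [ENNReal.mul_inv (by simp) (by simp), ENNReal.inv_div (by simp) (by simp [ha0])]
  calc 2⁻¹ * (ENNReal.ofReal (2 - p) / ENNReal.ofReal p) + 2⁻¹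
      = 2⁻¹ * (ENNReal.ofReal (2 - p) / ENNReal.ofReal p +
          ENNReal.ofReal p / ENNReal.ofReal p) := by
        rw [ENNReal.div_self ha0 (by simp), mul_add, mul_one]
    _ = (ENNReal.ofReal p)⁻¹ := by
        rw [← ENNReal.add_div, hsum, div_eq_mul_inv, ← mul_assoc,
          ENNReal.inv_mul_cancel (by simp) (by simp), one_mul]

/-- The denominator is at most `1`. At `p = 2` it is `0` and the quotient is `⊤`, the intended value
of the exponent. -/
theorem le_conj_exponent {p : ℝ} (h1 : 1 ≤ p) :
    ENNReal.ofReal p ≤ ENNReal.ofReal p / ENNReal.ofReal (2 - p) := by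
  conv_lhs => rw [← div_one (ENNReal.ofReal p)]
  exact ENNReal.div_le_div_left (by
    rw [← ENNReal.ofReal_one]; exact ENNReal.ofReal_le_ofReal (by linarith)) _

end Holder

variable {n r : ℕ} {X : Type*} [TopologicalSpace X] [ChartedSpace (Fin n → ℂ) X]
  {E : X → Type*} [∀ x, AddCommGroup (E x)] [∀ x, Module ℂ (E x)] [∀ x, TopologicalSpace (E x)]
  [TopologicalSpace (TotalSpace (Fin r → ℂ) E)] [FiberBundle (Fin r → ℂ) E]
  [VectorBundle ℂ (Fin r → ℂ) E]
  [IsManifold 𝓘(ℂ, Fin n → ℂ) ω X] [MeasurableSpace X] [BorelSpace X] [CompactSpace X]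
  [T2Space X]
  {g : HermitianMetric n n (HolTangent n X)} {h : HermitianMetric n r E} {w : EndSection E}

theorem sobolevSpace_anti {p q : ℝ≥0∞} (hpq : p ≤ q) : sobolevSpace g h q ⊆ sobolevSpace g h p :=
  fun _ hw => have := isFiniteMeasure_kahlerVolume g
    ⟨hw.1, hw.2.1, hw.2.2.1, hw.2.2.2.1.mono_exponent hpq, hw.2.2.2.2.mono_exponent hpq⟩

theorem weakDerivative_spec (hw : ∃ D, IsWeakDerivative h w D) :
    IsWeakDerivative h w (weakDerivative h w) := by
  rw [weakDerivative, dif_pos hw]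
  exact hw.choose_spec

/-- The constants come from `|Dw|² = 2|∂̄w|²` and `|∂̄w|² ≤ 4(1 + 2|w|) f_w`. -/
theorem ae_formNorm_sq_le (hw : w ∈ sobolevSpace g h 1) : ∀ᵐ x ∂kahlerVolume g,
    formNorm g h (weakDerivative h w) x ^ 2 ≤
      (8 + 16 * endNorm h x (w x)) * energyDensity g h w x := by
  filter_upwards [hw.1, (weakDerivative_spec hw.2.2.1).ae_adjoint g hw.1] with x hx hx'
  rw [formNorm_sq_eq g h w x hx']
  have := antiNormSq_le_energyDensity g h w x hx
  linarith

/-- Hölder for the product of `8 + 16|w|`, measured in `L^{p*}`, and `f_w`, measured in `L¹`. Only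
`w ∈ H^{1,1}` is assumed, so the estimate also proves membership in `H^{1,p}`. -/
theorem eLpNorm_formNorm_le (hw : w ∈ sobolevSpace g h 1)
    (he : Integrable (energyDensity g h w) (kahlerVolume g)) {p : ℝ} (h1 : 1 ≤ p) (h2 : p ≤ 2) :
    eLpNorm (formNorm g h (weakDerivative h w)) (ENNReal.ofReal p) (kahlerVolume g) ≤
      8 * (1 + kahlerVolume g Set.univ) +
        16 * lpNorm g h (ENNReal.ofReal p / ENNReal.ofReal (2 - p)) w +
        eLpNorm (energyDensity g h w) 1 (kahlerVolume g) := by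
  set q := ENNReal.ofReal p / ENNReal.ofReal (2 - p)
  have := holderTriple_conj h1 h2
  have hu := hw.2.2.2.1.1
  have hq : 1 ≤ q := le_trans (by
    rw [← ENNReal.ofReal_one]; exact ENNReal.ofReal_le_ofReal h1) (le_conj_exponent h1)
  refine (eLpNorm_le_add_of_sq_le (aestronglyMeasurable_const.add (hu.const_mul 16)) he.1
    (ae_formNorm_sq_le hw) (ENNReal.ofReal p) q).trans ?_
  refine add_le_add_left ?_ _
  refine (eLpNorm_add_le aestronglyMeasurable_const (hu.const_mul 16) hq).trans ?_
  refine add_le_add ((eLpNorm_const_le_one_add hq 8).trans_eq ?_) ?_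
  · congr 1
    rw [Real.enorm_eq_ofReal (by norm_num)]; norm_num
  · refine (eLpNorm_const_smul_le (c := (16 : ℝ)) (f := fun x => endNorm h x (w x))).trans_eq ?_
    rw [Real.enorm_eq_ofReal (by norm_num)]; norm_num [lpNorm]

end HermBundle

/-! ### The a priori estimate -/

namespace HermBundle

variable {n r : ℕ} {X : Type*} [TopologicalSpace X] [ChartedSpace (Fin n → ℂ) X]
  {E : X → Type*} [∀ x, AddCommGroup (E x)] [∀ x, Module ℂ (E x)] [∀ x, TopologicalSpace (E x)]
  [TopologicalSpace (TotalSpace (Fin r → ℂ) E)] [FiberBundle (Fin r → ℂ) E]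
  [VectorBundle ℂ (Fin r → ℂ) E]
  [IsManifold 𝓘(ℂ, Fin n → ℂ) ω X] [MeasurableSpace X] [BorelSpace X] [CompactSpace X]
  [T2Space X]

theorem integrable_of_donaldson_lt_top {g : HermitianMetric n n (HolTangent n X)}
    {h : HermitianMetric n r E} {w : EndSection E} (hd : donaldson g h w < ⊤) :
    Integrable (energyDensity g h w) (kahlerVolume g) := by
  by_contra hc
  rw [donaldson, if_neg hc] at hd
  exact lt_irrefl _ hd

variable [ContMDiffVectorBundle ω (Fin r → ℂ) E 𝓘(ℂ, Fin n → ℂ)]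

/-- Domination by an integrable function suffices; measurability of the curvature density is not
needed, because an undefined integral has the value `0`. -/
theorem abs_integral_curvatureDensity_le {g : HermitianMetric n n (HolTangent n X)}
    {h : HermitianMetric n r E} {C : ℝ}
    (hC : ∀ (w : EndSection E) (x : X), |curvatureDensity g h w x| ≤ C * endNorm h x (w x))
    {w : EndSection E} (hw : w ∈ sobolevSpace g h 1) :
    |∫ x, curvatureDensity g h w x ∂kahlerVolume g| ≤ C * (lpNorm g h 1 w).toReal := by
  have hi : Integrable (fun x => endNorm h x (w x)) (kahlerVolume g) :=
    memLp_one_iff_integrable.1 hw.2.2.2.1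
  refine (norm_integral_le_of_norm_le (f := curvatureDensity g h w) (hi.const_mul C)
    (Filter.Eventually.of_forall fun x => hC w x)).trans_eq ?_
  rw [integral_const_mul, lpNorm, eLpNorm_one_eq_lintegral_enorm,
    ← integral_norm_eq_lintegral_enorm hi.1]
  simp only [Real.norm_of_nonneg (endNorm_nonneg _ _ _)]

theorem exists_sobolevNorm_le (g : HermitianMetric n n (HolTangent n X))
    (h : HermitianMetric n r E) : ∃ C₁ C₂ : ℝ, 0 < C₁ ∧ 0 < C₂ ∧
      ∀ p : ℝ, 1 ≤ p → p ≤ 2 → ∀ w ∈ sobolevSpace g h (ENNReal.ofReal p),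
        (sobolevNorm g h (ENNReal.ofReal p) w : EReal) ≤
          (C₁ : EReal) * donaldson g h w + (C₂ : EReal) *
            ((lpNorm g h (ENNReal.ofReal p / ENNReal.ofReal (2 - p)) w : EReal) + 1) := by
  obtain ⟨C, hC0, hC⟩ := exists_abs_curvatureDensity_le g h
  have hfin := isFiniteMeasure_kahlerVolume g
  set v := (kahlerVolume g Set.univ).toReal
  have hV : kahlerVolume g Set.univ = ENNReal.ofReal v :=
    (ENNReal.ofReal_toReal (measure_ne_top _ _)).symm
  have hv : 0 ≤ v := ENNReal.toReal_nonneg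
  -- The summands pay for, in order: `‖w‖_p ≤ (1+v)‖w‖_{p*}`, the term `16|w|` in the gradient
  -- estimate, the curvature integral bounded by `C‖w‖₁`, and the constant `8` in the gradient
  -- estimate.
  set C₂ := (1 + v) + 16 + C * (1 + v) + 8 * (1 + v) with hC2
  have hC2pos : 0 < C₂ := by positivity
  refine ⟨1, C₂, one_pos, hC2pos, fun p h1 h2 w hw => ?_⟩
  have hp1 : (1 : ℝ≥0∞) ≤ ENNReal.ofReal p := by
    rw [← ENNReal.ofReal_one]; exact ENNReal.ofReal_le_ofReal h1
  have hw1 := sobolevSpace_anti hp1 hw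
  set q := ENNReal.ofReal p / ENNReal.ofReal (2 - p)
  have hpq : ENNReal.ofReal p ≤ q := le_conj_exponent h1
  rw [EReal.coe_one, one_mul]
  by_cases he : Integrable (energyDensity g h w) (kahlerVolume g)
  swap
  -- If the functional is `+∞` there is nothing to prove, once the other summand is known not to be
  -- `⊥`.
  · rw [donaldson, if_neg he, EReal.top_add_of_ne_bot]
    · exact le_top
    · refine ne_of_gt (lt_of_lt_of_le EReal.bot_lt_zero ?_)
      exact mul_nonneg (by exact_mod_cast hC2pos.le)
        (add_nonneg (EReal.coe_ennreal_nonneg _) zero_le_one)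
  have hdon : donaldson g h w = (((∫ x, energyDensity g h w x ∂kahlerVolume g) +
      ∫ x, curvatureDensity g h w x ∂kahlerVolume g : ℝ) : EReal) := by rw [donaldson, if_pos he]
  by_cases hL : lpNorm g h q w = ⊤
  · rw [hL, hdon, EReal.coe_ennreal_top, ← EReal.coe_one,
      EReal.top_add_of_ne_bot (EReal.coe_ne_bot 1),
      EReal.coe_mul_top_of_pos hC2pos, EReal.coe_add_top]
    exact le_top
  set l := (lpNorm g h q w).toReal
  have hl : lpNorm g h q w = ENNReal.ofReal l := (ENNReal.ofReal_toReal hL).symm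
  have hl0 : 0 ≤ l := ENNReal.toReal_nonneg
  have hu := hw1.2.2.2.1.1
  have hlow : ∀ s : ℝ≥0∞, 1 ≤ s → s ≤ q → lpNorm g h s w ≤ ENNReal.ofReal (l * (1 + v)) := by
    intro s hs hsq
    refine (eLpNorm_le_mul_one_add hs hsq hu).trans_eq ?_
    rw [hV, ENNReal.ofReal_mul hl0, ← hl, ENNReal.ofReal_add zero_le_one hv, ENNReal.ofReal_one]
    rfl
  have hE : eLpNorm (energyDensity g h w) 1 (kahlerVolume g) =
      ENNReal.ofReal (∫ x, energyDensity g h w x ∂kahlerVolume g) := by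
    rw [eLpNorm_one_eq_lintegral_enorm, ← ofReal_integral_norm_eq_lintegral_enorm he]
    simp only [Real.norm_of_nonneg (energyDensity_nonneg g h w _)]
  have hE0 : 0 ≤ ∫ x, energyDensity g h w x ∂kahlerVolume g :=
    integral_nonneg fun x => energyDensity_nonneg g h w x
  have hF := eLpNorm_formNorm_le hw1 he h1 h2
  have hκ := abs_integral_curvatureDensity_le hC hw1
  have hl1 : (lpNorm g h 1 w).toReal ≤ l * (1 + v) :=
    ENNReal.toReal_le_of_le_ofReal (by positivity) (hlow 1 le_rfl (hp1.trans hpq))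
  have hS : sobolevNorm g h (ENNReal.ofReal p) w ≤ ENNReal.ofReal (l * (1 + v) +
      (8 * (1 + v) + 16 * l + ∫ x, energyDensity g h w x ∂kahlerVolume g)) := by
    rw [ENNReal.ofReal_add (by positivity) (by positivity)]
    refine add_le_add (hlow _ hp1 hpq) (hF.trans_eq ?_)
    rw [hE, hl, hV, ENNReal.ofReal_add (by positivity) hE0,
      ENNReal.ofReal_add (by positivity) (by positivity), ENNReal.ofReal_mul (by norm_num),
      ENNReal.ofReal_mul (by norm_num), ENNReal.ofReal_add zero_le_one hv]
    simp
  have hS' := EReal.coe_ennreal_le_coe_ennreal_iff.2 hS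
  rw [EReal.coe_ennreal_ofReal, max_eq_left (by positivity)] at hS'
  refine hS'.trans ?_
  rw [hdon, hl, EReal.coe_ennreal_ofReal, max_eq_left hl0, ← EReal.coe_one, ← EReal.coe_add,
    ← EReal.coe_mul, ← EReal.coe_add, EReal.coe_le_coe_iff, hC2]
  -- The functional may fall below `∫ f_w` by at most the curvature integral, which is returned
  -- through the summand `C (1+v)` of `C₂`.
  have h3 := (neg_le_abs _).trans (hκ.trans (mul_le_mul_of_nonneg_left hl1 hC0))
  nlinarith [mul_nonneg hC0 (add_nonneg zero_le_one hv), mul_nonneg hl0 hv]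

end HermBundle

/-! ### The weak derivative as a real differential in a chart -/

namespace HermBundle

open Topology Matrix

section Vec

variable {n r : ℕ}

/-- A matrix as a vector of a Euclidean space. -/
noncomputable def matVec (M : Matrix (Fin r) (Fin r) ℂ) : EuclideanSpace ℂ (Fin r × Fin r) :=
  WithLp.toLp 2 fun q => M q.1 q.2

theorem matVec_apply (M : Matrix (Fin r) (Fin r) ℂ) (q : Fin r × Fin r) :
    matVec M q = M q.1 q.2 := rfl

theorem matVec_eq_sum (M : Matrix (Fin r) (Fin r) ℂ) :
    matVec M = ∑ q, M q.1 q.2 • EuclideanSpace.single q (1 : ℂ) := by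
  ext p
  simp [matVec_apply, Finset.sum_apply, Pi.single_apply]

theorem norm_matVec_le (M : Matrix (Fin r) (Fin r) ℂ) : ‖matVec M‖ ≤ ∑ i, ∑ j, ‖M i j‖ := by
  rw [matVec_eq_sum, ← Fintype.sum_prod_type' (f := fun i j => ‖M i j‖)]
  refine (norm_sum_le _ _).trans (Finset.sum_le_sum fun q _ => ?_)
  rw [norm_smul, PiLp.norm_single]
  simp

theorem norm_le_norm_matVec (M : Matrix (Fin r) (Fin r) ℂ) (i j : Fin r) :
    ‖M i j‖ ≤ ‖matVec M‖ :=
  PiLp.norm_apply_le (matVec M) (i, j)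

theorem locallyIntegrableOn_clm {F F' : Type*} [NormedAddCommGroup F] [NormedSpace ℝ F]
    [NormedAddCommGroup F'] [NormedSpace ℝ F'] {Ω : Set (Fin n → ℂ)} (L : F →L[ℝ] F')
    {f : (Fin n → ℂ) → F} (hf : LocallyIntegrableOn f Ω) :
    LocallyIntegrableOn (fun y => L (f y)) Ω := fun x hx => by
  obtain ⟨s, hs, hi⟩ := hf x hx
  exact ⟨s, hs, L.integrable_comp hi⟩

theorem locallyIntegrableOn_matVec {Ω : Set (Fin n → ℂ)}
    {M : (Fin n → ℂ) → Matrix (Fin r) (Fin r) ℂ}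
    (hM : ∀ i j, LocallyIntegrableOn (fun y => M y i j) Ω) :
    LocallyIntegrableOn (fun y => matVec (M y)) Ω := by
  simp only [matVec_eq_sum]
  exact locallyIntegrableOn_finset_sum _ fun q => locallyIntegrableOn_clm
    (((ContinuousLinearMap.id ℂ ℂ).smulRight
      (EuclideanSpace.single q (1 : ℂ))).restrictScalars ℝ) (hM q.1 q.2)

/-- A real linear map on `ℂⁿ` is determined by its values on the vectors `e_k` and `i e_k`. This
reduces local integrability in operator norm to that of finitely many directional derivatives. -/
theorem clm_eq_sum {F : Type*} [NormedAddCommGroup F] [NormedSpace ℝ F]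
    (L : (Fin n → ℂ) →L[ℝ] F) : L = ∑ k : Fin n,
      ((Complex.reCLM.comp (ContinuousLinearMap.proj k)).smulRight (L (Pi.single k 1)) +
        (Complex.imCLM.comp (ContinuousLinearMap.proj k)).smulRight
          (L (Pi.single k Complex.I))) := by
  ext v
  have hv : v = ∑ k : Fin n, ((v k).re • (Pi.single k 1 : Fin n → ℂ) +
      (v k).im • (Pi.single k Complex.I : Fin n → ℂ)) := by
    funext j
    simp only [Finset.sum_apply, Pi.add_apply, Pi.smul_apply, Pi.single_apply, Complex.real_smul,
      mul_ite, mul_one, mul_zero, Finset.sum_add_distrib, Finset.sum_ite_eq, Finset.mem_univ,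
      if_true]
    exact (Complex.re_add_im _).symm
  conv_lhs => rw [hv]
  simp [map_sum]

theorem locallyIntegrableOn_of_apply {F : Type*} [NormedAddCommGroup F] [NormedSpace ℝ F]
    {Ω : Set (Fin n → ℂ)} {L : (Fin n → ℂ) → (Fin n → ℂ) →L[ℝ] F}
    (hL : ∀ v, LocallyIntegrableOn (fun y => L y v) Ω) : LocallyIntegrableOn L Ω := by
  have h := locallyIntegrableOn_finset_sum (Ω := Ω) Finset.univ fun k : Fin n =>
    (locallyIntegrableOn_clm (ContinuousLinearMap.smulRightL ℝ (Fin n → ℂ) F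
      (Complex.reCLM.comp (ContinuousLinearMap.proj k))) (hL (Pi.single k 1))).add
    (locallyIntegrableOn_clm (ContinuousLinearMap.smulRightL ℝ (Fin n → ℂ) F
      (Complex.imCLM.comp (ContinuousLinearMap.proj k))) (hL (Pi.single k Complex.I)))
  rw [funext fun y => clm_eq_sum (L y)]
  exact h

end Vec

variable {n r : ℕ} {X : Type*} [TopologicalSpace X] [ChartedSpace (Fin n → ℂ) X]
  {E : X → Type*} [∀ x, AddCommGroup (E x)] [∀ x, Module ℂ (E x)] [∀ x, TopologicalSpace (E x)]
  [TopologicalSpace (TotalSpace (Fin r → ℂ) E)] [FiberBundle (Fin r → ℂ) E]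
  [VectorBundle ℂ (Fin r → ℂ) E]
  [IsManifold 𝓘(ℂ, Fin n → ℂ) ω X]

theorem localMatrix_add (a x : X) (S T : E x →ₗ[ℂ] E x) :
    localMatrix r a x (S + T) = localMatrix r a x S + localMatrix r a x T := by
  simp [localMatrix, LinearMap.comp_add, LinearMap.add_comp]

theorem localMatrix_smul (a x : X) (c : ℂ) (T : E x →ₗ[ℂ] E x) :
    localMatrix r a x (c • T) = c • localMatrix r a x T := by
  simp [localMatrix, LinearMap.comp_smul, LinearMap.smul_comp]

theorem HermitianMetric.connection_add (h : HermitianMetric n r E) (a : X) (y u v : Fin n → ℂ) :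
    h.connection a y (u + v) = h.connection a y u + h.connection a y v := by
  ext i j
  rw [Matrix.add_apply, h.connection_eq_sum, h.connection_eq_sum a y u,
    h.connection_eq_sum a y v, ← Finset.sum_add_distrib]
  exact Finset.sum_congr rfl fun k _ => add_mul _ _ _

theorem HermitianMetric.connection_smul (h : HermitianMetric n r E) (a : X) (y : Fin n → ℂ)
    (c : ℂ) (v : Fin n → ℂ) : h.connection a y (c • v) = c • h.connection a y v := by
  ext i j
  rw [Matrix.smul_apply, h.connection_eq_sum, h.connection_eq_sum a y v, Finset.smul_sum]
  exact Finset.sum_congr rfl fun k _ => mul_assoc _ _ _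

/-- The matrix of the real differential of `w` along `v`, in the coordinates and the frame
attached to `a`, when `D` is the covariant derivative of `w`. -/
noncomputable def derivMatrix (h : HermitianMetric n r E) (w : EndSection E) (D : EndForm n E)
    (a : X) (y v : Fin n → ℂ) : Matrix (Fin r) (Fin r) ℂ :=
  let x := (chartAt (Fin n → ℂ) a).symm y
  localMatrix r a x (D.hol x (localVector n (HolTangent n X) a x v)) +
    localMatrix r a x (D.anti x (localVector n (HolTangent n X) a x v)) -
    (h.connection a y v * localMatrix r a x (w x) - localMatrix r a x (w x) * h.connection a y v)

theorem derivMatrix_add (h : HermitianMetric n r E) (w : EndSection E) (D : EndForm n E)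
    (a : X) (y u v : Fin n → ℂ) :
    derivMatrix h w D a y (u + v) = derivMatrix h w D a y u + derivMatrix h w D a y v := by
  simp only [derivMatrix, localVector, map_add, localMatrix_add, h.connection_add,
    Matrix.add_mul, Matrix.mul_add]
  abel

theorem derivMatrix_real_smul (h : HermitianMetric n r E) (w : EndSection E) (D : EndForm n E)
    (a : X) (y : Fin n → ℂ) (c : ℝ) (v : Fin n → ℂ) :
    derivMatrix h w D a y (c • v) = (c : ℂ) • derivMatrix h w D a y v := by
  have : c • v = (c : ℂ) • v := by funext i; simp
  simp only [this, derivMatrix, localVector, map_smul, LinearMap.map_smulₛₗ, localMatrix_smul,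
    h.connection_smul, Complex.conj_ofReal, Matrix.smul_mul, Matrix.mul_smul,
    smul_sub, smul_add]

/-- The real differential of the matrix of `w`. -/
noncomputable def derivCLM (h : HermitianMetric n r E) (w : EndSection E) (D : EndForm n E)
    (a : X) (y : Fin n → ℂ) : (Fin n → ℂ) →L[ℝ] EuclideanSpace ℂ (Fin r × Fin r) :=
  LinearMap.toContinuousLinearMap
    { toFun := fun v => matVec (derivMatrix h w D a y v)
      map_add' := fun u v => by
        ext q; simp [derivMatrix_add, matVec_apply]
      map_smul' := fun c v => by
        ext q; simp [derivMatrix_real_smul, matVec_apply] }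

theorem derivCLM_apply (h : HermitianMetric n r E) (w : EndSection E) (D : EndForm n E)
    (a : X) (y v : Fin n → ℂ) :
    derivCLM h w D a y v = matVec (derivMatrix h w D a y v) := rfl

/-- The real differential is `∂ + ∂̄`, so adding the two defining identities gives the weak
differential `D' + D'' - [A, W]`. Real test functions are viewed as complex ones, and the
vector-valued integrals are compared entry by entry. -/
theorem IsWeakDerivative.hasWeakFDerivOn {h : HermitianMetric n r E} {w : EndSection E}
    {D : EndForm n E} (hD : IsWeakDerivative h w D) (a : X) :
    WeakDeriv.HasWeakFDerivOn volume (localDomain n r E a)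
      (fun y => matVec (localMatrix r a ((chartAt (Fin n → ℂ) a).symm y)
        (w ((chartAt (Fin n → ℂ) a).symm y)))) (derivCLM h w D a) := by
  set Ω := localDomain n r E a with hΩdef
  have hl := (isOpen_localDomain (n := n) (r := r) (E := E) a).isLocallyClosed
  set s : (Fin n → ℂ) → X := fun y => (chartAt (Fin n → ℂ) a).symm y with hs
  set W : (Fin n → ℂ) → Matrix (Fin r) (Fin r) ℂ := fun y => localMatrix r a (s y) (w (s y))
    with hWdef
  set P : (Fin n → ℂ) → (Fin n → ℂ) → Matrix (Fin r) (Fin r) ℂ := fun v y =>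
      localMatrix r a (s y) (D.hol (s y) (localVector n (HolTangent n X) a (s y) v))
  set Q : (Fin n → ℂ) → (Fin n → ℂ) → Matrix (Fin r) (Fin r) ℂ := fun v y =>
      localMatrix r a (s y) (D.anti (s y) (localVector n (HolTangent n X) a (s y) v))
  have hA : ∀ i j, LocallyIntegrableOn (fun y => W y i j) Ω ∧
      ∀ v : Fin n → ℂ,
        LocallyIntegrableOn (fun y => P v y i j) Ω ∧
        LocallyIntegrableOn (fun y => Q v y i j) Ω ∧
        ∀ φ : (Fin n → ℂ) → ℂ, ContDiff ℝ ∞ φ → HasCompactSupport φ → tsupport φ ⊆ Ω →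
          ∫ y, W y i j * dHol φ y v =
            -∫ y, (P v y - (h.connection a y v * W y - W y * h.connection a y v)) i j * φ y ∧
          ∫ y, W y i j * dBar φ y v = -∫ y, Q v y i j * φ y := hD a
  have hB : ∀ v y, derivMatrix h w D a y v =
      P v y + Q v y - (h.connection a y v * W y - W y * h.connection a y v) := fun v y => rfl
  have hAc : ∀ v i j, ContinuousOn (fun y => h.connection a y v i j) Ω := fun v i j =>
    (h.contDiffOn_connection a v i j).continuousOn
  have hcomm : ∀ v i j, LocallyIntegrableOn (fun y => (h.connection a y v * W y -
      W y * h.connection a y v) i j) Ω := by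
    intro v i j
    refine LocallyIntegrableOn.sub ?_ ?_
    · simp only [Matrix.mul_apply]
      exact locallyIntegrableOn_finset_sum _ fun m =>
        (hA m j).1.continuousOn_mul (hAc v i m) hl
    · simp only [Matrix.mul_apply]
      exact locallyIntegrableOn_finset_sum _ fun m =>
        (hA i m).1.mul_continuousOn (hAc v m j) hl
  have hBi : ∀ v i j, LocallyIntegrableOn (fun y => derivMatrix h w D a y v i j) Ω :=
    fun v i j => (((hA i j).2 v).1.add ((hA i j).2 v).2.1).sub (hcomm v i j)
  have hf : LocallyIntegrableOn (fun y => matVec (W y)) Ω :=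
    locallyIntegrableOn_matVec fun i j => (hA i j).1
  have hG : ∀ v, LocallyIntegrableOn (fun y => derivCLM h w D a y v) Ω := fun v =>
    locallyIntegrableOn_matVec fun i j => hBi v i j
  refine ⟨hf, locallyIntegrableOn_of_apply hG, fun φ hφ hc hsub v => ?_⟩
  have hφ' : Continuous fun y => fderiv ℝ φ y v :=
    (hφ.continuous_fderiv (by simp)).clm_apply continuous_const
  have hsub' : tsupport (fun y => fderiv ℝ φ y v) ⊆ tsupport φ :=
    tsupport_fderiv_apply_subset ℝ v
  have i1 : Integrable fun y => fderiv ℝ φ y v • matVec (W y) :=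
    WeakDeriv.integrable_smul_of_tsupport_subset hf hφ'
      (hc.of_isClosed_subset (isClosed_tsupport _) hsub') (hsub'.trans hsub)
  have i2 : Integrable fun y => φ y • derivCLM h w D a y v :=
    WeakDeriv.integrable_smul_of_tsupport_subset (hG v) hφ.continuous hc hsub
  set ψ : (Fin n → ℂ) → ℂ := fun y => (φ y : ℂ) with hψ
  have hψs : ContDiff ℝ ∞ ψ := Complex.ofRealCLM.contDiff.comp hφ
  have hψsub : tsupport ψ ⊆ tsupport φ := closure_mono fun y hy hh => hy (by simp [hψ, hh])
  have hψc : HasCompactSupport ψ := hc.of_isClosed_subset (isClosed_tsupport _) hψsub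
  have hψΩ : tsupport ψ ⊆ Ω := hψsub.trans hsub
  have hψd : ∀ y, (fderiv ℝ φ y v : ℂ) = dHol ψ y v + dBar ψ y v := by
    intro y
    rw [dHol_add_dBar]
    have h2 : fderiv ℝ ψ y = Complex.ofRealCLM.comp (fderiv ℝ φ y) :=
      Complex.ofRealCLM.hasFDerivAt.fderiv ▸
        fderiv_comp y Complex.ofRealCLM.differentiableAt (hφ.differentiable (by simp) y)
    rw [h2]; rfl
  ext ⟨i, j⟩
  have e1 := (EuclideanSpace.proj (𝕜 := ℂ) (i, j) :
    EuclideanSpace ℂ (Fin r × Fin r) →L[ℂ] ℂ).integral_comp_comm i1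
  have e2 := (EuclideanSpace.proj (𝕜 := ℂ) (i, j) :
    EuclideanSpace ℂ (Fin r × Fin r) →L[ℂ] ℂ).integral_comp_comm i2
  obtain ⟨k1, k2⟩ := ((hA i j).2 v).2.2 ψ hψs hψc hψΩ
  have j1 := integrable_mul_of_tsupport_subset (hA i j).1 (continuous_dHol hψs v)
    (hasCompactSupport_dHol hψc v) ((tsupport_dHol_subset ψ v).trans hψΩ)
  have j2 := integrable_mul_of_tsupport_subset (hA i j).1 (continuous_dBar hψs v)
    (hasCompactSupport_dBar hψc v) ((tsupport_dBar_subset ψ v).trans hψΩ)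
  have j3 : Integrable fun y =>
      (P v y - (h.connection a y v * W y - W y * h.connection a y v)) i j * ψ y := integrable_mul_of_tsupport_subset
    (((hA i j).2 v).1.sub (hcomm v i j)) hψs.continuous hψc hψΩ
  have j4 := integrable_mul_of_tsupport_subset ((hA i j).2 v).2.1 hψs.continuous hψc hψΩ
  have k3 : ∫ y, (fderiv ℝ φ y v : ℂ) * W y i j =
      -∫ y, (φ y : ℂ) * derivMatrix h w D a y v i j := by
    calc ∫ y, (fderiv ℝ φ y v : ℂ) * W y i j
        = ∫ y, (W y i j * dHol ψ y v + W y i j * dBar ψ y v) :=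
          integral_congr_ae (Filter.Eventually.of_forall fun y => by
            simp only [hψd]; ring)
      _ = -((∫ y, (P v y - (h.connection a y v * W y - W y * h.connection a y v)) i j * ψ y) +
            ∫ y, Q v y i j * ψ y) := by rw [integral_add j1 j2, k1, k2]; ring
      _ = _ := by
          rw [← integral_add j3 j4]
          refine congrArg Neg.neg (integral_congr_ae (Filter.Eventually.of_forall fun y => ?_))
          simp only [hB, Matrix.add_apply, Matrix.sub_apply, hψ]
          ring
  have e1' : (∫ y, fderiv ℝ φ y v • matVec (W y)) (i, j) =
      ∫ y, (fderiv ℝ φ y v : ℂ) * W y i j := e1.symm.trans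
    (integral_congr_ae (Filter.Eventually.of_forall fun y => by
      simp [matVec_apply]))
  have e2' : (∫ y, φ y • derivCLM h w D a y v) (i, j) =
      ∫ y, (φ y : ℂ) * derivMatrix h w D a y v i j := e2.symm.trans
    (integral_congr_ae (Filter.Eventually.of_forall fun y => by
      simp [derivCLM_apply, matVec_apply]))
  rw [PiLp.neg_apply, e1', e2', k3]

end HermBundle

/-! ### Integrability of endomorphisms of finite energy -/

namespace HermBundle

open Topology Matrix

variable {n r : ℕ} {X : Type*} [TopologicalSpace X] [ChartedSpace (Fin n → ℂ) X]
  {E : X → Type*} [∀ x, AddCommGroup (E x)] [∀ x, Module ℂ (E x)] [∀ x, TopologicalSpace (E x)]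
  [TopologicalSpace (TotalSpace (Fin r → ℂ) E)] [FiberBundle (Fin r → ℂ) E]
  [VectorBundle ℂ (Fin r → ℂ) E]
  [IsManifold 𝓘(ℂ, Fin n → ℂ) ω X]

theorem HermitianMetric.exists_connection_bound (h : HermitianMetric n r E) {a : X}
    {K : Set (Fin n → ℂ)} (hK : IsCompact K) (hKs : K ⊆ localDomain n r E a) :
    ∃ B : ℝ, 0 ≤ B ∧ ∀ y ∈ K, ∀ v i j, ‖h.connection a y v i j‖ ≤ n * B * ‖v‖ := by
  obtain ⟨B, hB⟩ := hK.exists_bound_of_continuousOn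
    (f := fun y => ∑ k : Fin n, ∑ i, ∑ j, ‖h.connection a y (Pi.single k 1) i j‖)
    (continuousOn_finsetSum _ fun k _ => continuousOn_finsetSum _ fun i _ =>
      continuousOn_finsetSum _ fun j _ =>
        ((h.contDiffOn_connection a (Pi.single k 1) i j).continuousOn.mono hKs).norm)
  have hent : ∀ y ∈ K, ∀ k i j, ‖h.connection a y (Pi.single k 1) i j‖ ≤ |B| := by
    intro y hy k i j
    refine le_trans ?_ ((le_abs_self _).trans ((hB y hy).trans (le_abs_self B)))
    refine le_trans ?_ (Finset.single_le_sum (f := fun k => ∑ i, ∑ j,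
      ‖h.connection a y (Pi.single k 1) i j‖) (fun _ _ => by positivity) (Finset.mem_univ k))
    refine le_trans ?_ (Finset.single_le_sum (f := fun i => ∑ j,
      ‖h.connection a y (Pi.single k 1) i j‖) (fun _ _ => by positivity) (Finset.mem_univ i))
    exact Finset.single_le_sum (f := fun j => ‖h.connection a y (Pi.single k 1) i j‖)
      (fun _ _ => by positivity) (Finset.mem_univ j)
  refine ⟨|B|, abs_nonneg B, fun y hy v i j => ?_⟩
  rw [h.connection_eq_sum]
  calc _ ≤ ∑ _k : Fin n, ‖v‖ * |B| := by
        refine (norm_sum_le _ _).trans (Finset.sum_le_sum fun k _ => ?_)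
        rw [norm_mul]
        exact mul_le_mul (norm_le_pi_norm v k) (hent y hy k i j) (norm_nonneg _) (norm_nonneg _)
    _ = _ := by simp only [Finset.sum_const, Finset.card_univ, Fintype.card_fin, nsmul_eq_mul]; ring

theorem norm_commutator_le {r : ℕ} {A W : Matrix (Fin r) (Fin r) ℂ} {α β : ℝ}
    (hA : ∀ i j, ‖A i j‖ ≤ α) (hW : ∀ i j, ‖W i j‖ ≤ β) (i j : Fin r) :
    ‖(A * W - W * A) i j‖ ≤ 2 * r * α * β := by
  rw [Matrix.sub_apply, Matrix.mul_apply, Matrix.mul_apply, ← Finset.sum_sub_distrib]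
  calc _ ≤ ∑ _k : Fin r, (α * β + β * α) := by
        refine (norm_sum_le _ _).trans (Finset.sum_le_sum fun k _ => (norm_sub_le _ _).trans ?_)
        rw [norm_mul, norm_mul]
        exact add_le_add
          (mul_le_mul (hA i k) (hW k j) (norm_nonneg _) ((norm_nonneg _).trans (hA i k)))
          (mul_le_mul (hW i k) (hA k j) (norm_nonneg _) ((norm_nonneg _).trans (hW i k)))
    _ = _ := by simp only [Finset.sum_const, Finset.card_univ, Fintype.card_fin, nsmul_eq_mul]; ring

/-- The differential of the matrix differs from the covariant derivative by the commutator with the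
connection, a term of order zero that is bounded by `‖W‖` on compact sets. -/
theorem exists_norm_derivCLM_le (g : HermitianMetric n n (HolTangent n X))
    (h : HermitianMetric n r E) {a : X} {K : Set (Fin n → ℂ)} (hK : IsCompact K)
    (hKs : K ⊆ localDomain n r E a) : ∃ C : ℝ, 0 ≤ C ∧ ∀ y ∈ K, ∀ w D,
      ‖derivCLM h w D a y‖ ≤ C * (formNorm g h D ((chartAt (Fin n → ℂ) a).symm y) +
        ‖matVec (localMatrix r a ((chartAt (Fin n → ℂ) a).symm y)
          (w ((chartAt (Fin n → ℂ) a).symm y)))‖) := by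
  obtain ⟨B, hB0, hB⟩ := h.exists_connection_bound hK hKs
  obtain ⟨C, hC0, hC⟩ := h.exists_frameBound hK hKs
  have hKs' : K ⊆ localDomain n n (HolTangent n X) a := by
    rw [localDomain_tangent]; exact hKs.trans (localDomain_subset_target a)
  obtain ⟨C', hC0', hC'⟩ := g.exists_frameBound hK hKs'
  set c₁ : ℝ := 2 * (n * C' * (r ^ 2 * C ^ 2)) with hc1
  set c₂ : ℝ := 2 * r * (n * B) with hc2
  refine ⟨r ^ 2 * (c₁ + c₂), by positivity, fun y hy w D => ?_⟩
  set x := (chartAt (Fin n → ℂ) a).symm y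
  set N := ‖matVec (localMatrix r a x (w x))‖
  have hF : 0 ≤ formNorm g h D x := Real.sqrt_nonneg _
  have hN : 0 ≤ N := norm_nonneg _
  refine ContinuousLinearMap.opNorm_le_bound _ (by positivity) fun v => ?_
  rw [derivCLM_apply]
  refine (norm_matVec_le _).trans ?_
  have hent : ∀ i j, ‖derivMatrix h w D a y v i j‖ ≤
      (c₁ + c₂) * (formNorm g h D x + N) * ‖v‖ := by
    intro i j
    have e1 := norm_localMatrix_hol_le (hKs hy).2 hC0.le (hC y hy) (hC' y hy) D v i j
    have e2 := norm_localMatrix_anti_le (hKs hy).2 hC0.le (hC y hy) (hC' y hy) D v i j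
    have e3 := norm_commutator_le (fun i j => hB y hy v i j)
      (fun i j => norm_le_norm_matVec (localMatrix r a x (w x)) i j) i j
    rw [derivMatrix, Matrix.sub_apply, Matrix.add_apply]
    refine (norm_sub_le _ _).trans ((add_le_add ((norm_add_le _ _).trans (add_le_add e1 e2))
      e3).trans ?_)
    have hc1' : 0 ≤ c₁ := by positivity
    have hc2' : 0 ≤ c₂ := by positivity
    calc _ = (c₁ * formNorm g h D x + c₂ * N) * ‖v‖ := by
          rw [hc1, hc2]; ring
      _ ≤ _ := by
          refine mul_le_mul_of_nonneg_right ?_ (norm_nonneg _)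
          nlinarith [mul_nonneg hc1' hN, mul_nonneg hc2' hF]
  calc _ ≤ ∑ _i : Fin r, ∑ _j : Fin r, (c₁ + c₂) * (formNorm g h D x + N) * ‖v‖ :=
        Finset.sum_le_sum fun i _ => Finset.sum_le_sum fun j _ => hent i j
    _ = _ := by simp only [Finset.sum_const, Finset.card_univ, Fintype.card_fin, nsmul_eq_mul]; ring

theorem exists_endNorm_comparison (h : HermitianMetric n r E) {a : X} {K : Set (Fin n → ℂ)}
    (hK : IsCompact K) (hKs : K ⊆ localDomain n r E a) : ∃ C : ℝ, 1 ≤ C ∧ ∀ y ∈ K,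
      ∀ T : E ((chartAt (Fin n → ℂ) a).symm y) →ₗ[ℂ] E ((chartAt (Fin n → ℂ) a).symm y),
        endNorm h _ T ≤ C * ‖matVec (localMatrix r a _ T)‖ ∧
          ‖matVec (localMatrix r a _ T)‖ ≤ C * endNorm h _ T := by
  obtain ⟨C, hC0, hC⟩ := h.exists_frameBound hK hKs
  refine ⟨1 + r ^ 2 * C ^ 2 * r ^ 2, le_add_of_nonneg_right (by positivity),
    fun y hy T => ⟨?_, ?_⟩⟩
  · calc _ ≤ r ^ 2 * C ^ 2 * ∑ i, ∑ j, ‖localMatrix r a _ T i j‖ :=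
          endNorm_le_sum (hKs hy).2 hC0.le (hC y hy) T
      _ ≤ r ^ 2 * C ^ 2 * ∑ _i : Fin r, ∑ _j : Fin r, ‖matVec (localMatrix r a _ T)‖ :=
          mul_le_mul_of_nonneg_left (Finset.sum_le_sum fun i _ => Finset.sum_le_sum fun j _ =>
            norm_le_norm_matVec _ i j) (by positivity)
      _ = r ^ 2 * C ^ 2 * r ^ 2 * ‖matVec (localMatrix r a _ T)‖ := by
          simp only [Finset.sum_const, Finset.card_univ, Fintype.card_fin, nsmul_eq_mul]; ring
      _ ≤ _ := mul_le_mul_of_nonneg_right (le_add_of_nonneg_left zero_le_one) (norm_nonneg _)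
  · calc _ ≤ ∑ i, ∑ j, ‖localMatrix r a _ T i j‖ := norm_matVec_le _
      _ ≤ ∑ _i : Fin r, ∑ _j : Fin r, r ^ 2 * C ^ 2 * endNorm h _ T :=
          Finset.sum_le_sum fun i _ => Finset.sum_le_sum fun j _ =>
            norm_localMatrix_le (hKs hy).2 hC0.le (hC y hy) T i j
      _ = r ^ 2 * C ^ 2 * r ^ 2 * endNorm h _ T := by
          simp only [Finset.sum_const, Finset.card_univ, Fintype.card_fin, nsmul_eq_mul]; ring
      _ ≤ _ := mul_le_mul_of_nonneg_right (le_add_of_nonneg_left zero_le_one)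
          (endNorm_nonneg _ _ _)

variable [MeasurableSpace X] [BorelSpace X] [CompactSpace X] [T2Space X]
  {g : HermitianMetric n n (HolTangent n X)} {h : HermitianMetric n r E} {w : EndSection E}

/-- Almost everywhere in a chart, `‖dW‖² / (1 + ‖W‖)` is controlled by `f_w + |w|`. -/
theorem exists_ae_deriv_sq_div_le (hw : w ∈ sobolevSpace g h 1) {a : X} {K : Set (Fin n → ℂ)}
    (hK : IsCompact K) (hKs : K ⊆ localDomain n r E a) : ∃ C : ℝ, 0 ≤ C ∧ ∀ᵐ y, y ∈ K →
      ‖derivCLM h w (weakDerivative h w) a y‖ ^ 2 /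
        (1 + ‖matVec (localMatrix r a ((chartAt (Fin n → ℂ) a).symm y)
          (w ((chartAt (Fin n → ℂ) a).symm y)))‖) ≤
      C * (energyDensity g h w ((chartAt (Fin n → ℂ) a).symm y) +
        endNorm h _ (w ((chartAt (Fin n → ℂ) a).symm y))) := by
  obtain ⟨C₁, hC1, hD⟩ := exists_norm_derivCLM_le g h hK hKs
  obtain ⟨C₂, hC2, hN⟩ := exists_endNorm_comparison h hK hKs
  refine ⟨2 * C₁ ^ 2 * (16 * C₂), by positivity, ?_⟩
  filter_upwards [ae_chart_of_ae_kahlerVolume g (ae_formNorm_sq_le hw) a] with y hy hyK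
  have h1 := hy (localDomain_subset_target a (hKs hyK))
  have h2 := hD y hyK w (weakDerivative h w)
  obtain ⟨h3, h4⟩ := hN y hyK (w _)
  have he := energyDensity_nonneg g h w ((chartAt (Fin n → ℂ) a).symm y)
  have hu := endNorm_nonneg h _ (w ((chartAt (Fin n → ℂ) a).symm y))
  set N := ‖matVec (localMatrix r a ((chartAt (Fin n → ℂ) a).symm y)
          (w ((chartAt (Fin n → ℂ) a).symm y)))‖
  set u := endNorm h _ (w ((chartAt (Fin n → ℂ) a).symm y))
  set e := energyDensity g h w ((chartAt (Fin n → ℂ) a).symm y)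
  set F := formNorm g h (weakDerivative h w) ((chartAt (Fin n → ℂ) a).symm y)
  have hN0 : 0 ≤ N := norm_nonneg _
  have hF0 : 0 ≤ F := Real.sqrt_nonneg _
  -- The gradient bound has the factor `8 + 16u`, at most `16 C₂ (1 + N)` because `u ≤ C₂ N` and `C₂
  -- ≥ 1`. The next bound gives `N²`, the contribution of the commutator, the same shape with `u` in
  -- place of the energy density, so division by `1 + N` leaves integrable terms.
  have h5 : F ^ 2 ≤ 16 * C₂ * (1 + N) * e :=
    h1.trans (mul_le_mul_of_nonneg_right (by nlinarith) he)
  have h6 : N ^ 2 ≤ 16 * C₂ * (1 + N) * u := by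
    nlinarith [mul_nonneg hN0 (sub_nonneg.2 h4), mul_nonneg hu hN0, mul_nonneg
      (mul_nonneg hu hN0) (sub_nonneg.2 hC2), mul_nonneg hu (sub_nonneg.2 hC2)]
  rw [div_le_iff₀ (by positivity)]
  calc _ ≤ (C₁ * (F + N)) ^ 2 := pow_le_pow_left₀ (norm_nonneg _) h2 2
    _ ≤ C₁ ^ 2 * (2 * (F ^ 2 + N ^ 2)) := by
        rw [mul_pow]
        exact mul_le_mul_of_nonneg_left (by nlinarith [sq_nonneg (F - N)]) (sq_nonneg _)
    _ ≤ C₁ ^ 2 * (2 * (16 * C₂ * (1 + N) * e + 16 * C₂ * (1 + N) * u)) :=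
        mul_le_mul_of_nonneg_left (by linarith) (sq_nonneg _)
    _ = _ := by ring

theorem exists_map_volume_le_kahlerVolume (g : HermitianMetric n n (HolTangent n X)) {a : X}
    {K : Set (Fin n → ℂ)} (hK : IsCompact K) (hKt : K ⊆ (chartAt (Fin n → ℂ) a).target) :
    ∃ C : ℝ≥0∞, C ≠ ⊤ ∧
      (volume.restrict K).map (chartAt (Fin n → ℂ) a).symm ≤ C • kahlerVolume g := by
  obtain ⟨C, hC, hle⟩ := exists_map_volume_le g hK hKt
  refine ⟨C, hC, hle.trans (Measure.le_iff.2 fun S _ => ?_)⟩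
  rw [Measure.smul_apply, Measure.smul_apply]
  exact mul_le_mul_right (chartVolume_le_kahlerVolume g a S) C

theorem lintegral_chart_lt_top (g : HermitianMetric n n (HolTangent n X)) {a : X}
    {K : Set (Fin n → ℂ)} (hK : IsCompact K)
    (hKt : K ⊆ (chartAt (Fin n → ℂ) a).target) {f : X → ℝ≥0∞}
    (hf : AEMeasurable f (kahlerVolume g)) (hfi : ∫⁻ x, f x ∂kahlerVolume g < ⊤) :
    ∫⁻ y in K, f ((chartAt (Fin n → ℂ) a).symm y) < ⊤ := by
  obtain ⟨C, hC, hle⟩ := exists_map_volume_le_kahlerVolume g hK hKt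
  have hm : AEMeasurable f ((volume.restrict K).map (chartAt (Fin n → ℂ) a).symm) :=
    (hf.smul_measure C).mono_measure hle
  rw [← lintegral_map' hm (aemeasurable_symm hK.measurableSet hKt)]
  refine (lintegral_mono' hle le_rfl).trans_lt ?_
  rw [lintegral_smul_measure]
  exact ENNReal.mul_lt_top hC.lt_top hfi

theorem eLpNorm_kahlerVolume_lt_top (g : HermitianMetric n n (HolTangent n X)) {I : Finset X}
    {R : X → ℝ}
    (hR : ∀ a, Metric.closedBall (chartAt (Fin n → ℂ) a a) (R a) ⊆ (chartAt (Fin n → ℂ) a).target)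
    (hcov : ∀ x, ∃ a ∈ I, x ∈ chartBall n a (R a)) {q : ℝ≥0∞} (hq0 : q ≠ 0) (hq : q ≠ ⊤)
    {f : X → ℝ} (hf : AEStronglyMeasurable f (kahlerVolume g))
    (h : ∀ a ∈ I, eLpNorm (fun y => f ((chartAt (Fin n → ℂ) a).symm y)) q
      (volume.restrict (Metric.closedBall (chartAt (Fin n → ℂ) a a) (R a))) < ⊤) :
    eLpNorm f q (kahlerVolume g) < ⊤ := by
  obtain ⟨C, hC, hle⟩ := exists_kahlerVolume_le g hR hcov
  rw [eLpNorm_lt_top_iff_lintegral_rpow_enorm_lt_top hq0 hq]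
  refine (lintegral_mono' hle le_rfl).trans_lt ?_
  rw [lintegral_finsetSum_measure]
  refine ENNReal.sum_lt_top.2 fun a ha => ?_
  rw [lintegral_smul_measure]
  refine ENNReal.mul_lt_top (hC a).lt_top ?_
  have hK := isCompact_closedBall (chartAt (Fin n → ℂ) a a) (R a)
  obtain ⟨C', hC', hle'⟩ := exists_map_volume_le_kahlerVolume g hK (hR a)
  have hm : AEMeasurable f ((volume.restrict
      (Metric.closedBall (chartAt (Fin n → ℂ) a a) (R a))).map (chartAt (Fin n → ℂ) a).symm) :=
    (hf.aemeasurable.smul_measure C').mono_measure hle'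
  rw [lintegral_map' (hm.enorm.pow_const _) (aemeasurable_symm hK.measurableSet (hR a))]
  exact (eLpNorm_lt_top_iff_lintegral_rpow_enorm_lt_top hq0 hq).1 (h a ha)

/-- The real dimension is `2n`, so the last hypothesis is the Sobolev condition for passing from
gradients in `L^s` to `L^q` with `q = 2p/(2-p)`. The square-root substitution then gives `L^{q/2}`,
and `q/2 = p*`. -/
theorem lpNorm_lt_top (hw : w ∈ sobolevSpace g h 1)
    (he : Integrable (energyDensity g h w) (kahlerVolume g)) {p s : ℝ} (hp1 : 1 ≤ p) (hp2 : p < 2)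
    (hs1 : 1 ≤ s) (hs2 : s ≤ 2) (hsn : s < 2 * n)
    (hsp : 1 / s - 1 / (2 * n) ≤ 1 / p - 1 / 2) :
    lpNorm g h (ENNReal.ofReal p / ENNReal.ofReal (2 - p)) w < ⊤ := by
  obtain ⟨I, R, hR, hcov⟩ := exists_chartBall_cover n r E
  have hR' : ∀ {c : ℝ} (a : X), c ≤ 4 →
      Metric.closedBall (chartAt (Fin n → ℂ) a a) (c * R a) ⊆ localDomain n r E a := fun a hc =>
    (Metric.closedBall_subset_closedBall
      (mul_le_mul_of_nonneg_right hc (hR a).1.le)).trans (hR a).2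
  have hR1 : ∀ a : X, Metric.closedBall (chartAt (Fin n → ℂ) a a) (R a) ⊆ localDomain n r E a :=
    fun a => by simpa using hR' (c := 1) a (by norm_num)
  set q : NNReal := Real.toNNReal (2 * p / (2 - p)) with hqdef
  have hqval : (q : ℝ) = 2 * p / (2 - p) :=
    Real.coe_toNNReal _ (div_nonneg (by linarith) (by linarith))
  have hq : ENNReal.ofReal p / ENNReal.ofReal (2 - p) = (q : ℝ≥0∞) / 2 := by
    rw [← ENNReal.ofReal_div_of_pos (by linarith)]
    change _ = ENNReal.ofReal (2 * p / (2 - p)) / 2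
    rw [← ENNReal.ofReal_ofNat 2, ← ENNReal.ofReal_div_of_pos (by norm_num)]
    congr 1
    have : 2 - p ≠ 0 := by linarith
    field_simp
  have hq0 : ENNReal.ofReal p / ENNReal.ofReal (2 - p) ≠ 0 :=
    (ENNReal.div_pos (ENNReal.ofReal_pos.2 (by linarith)).ne' ENNReal.ofReal_ne_top).ne'
  have hqt : ENNReal.ofReal p / ENNReal.ofReal (2 - p) ≠ ⊤ :=
    (ENNReal.div_lt_top ENNReal.ofReal_ne_top (ENNReal.ofReal_pos.2 (by linarith)).ne').ne
  have hfin : Module.finrank ℝ (Fin n → ℂ) = 2 * n := by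
    rw [Module.finrank_pi_fintype]; simp [mul_comm]
  have hu := hw.2.2.2.1
  have hint : Integrable (fun x => energyDensity g h w x + endNorm h x (w x)) (kahlerVolume g) :=
    he.add (memLp_one_iff_integrable.1 hu)
  refine eLpNorm_kahlerVolume_lt_top g (fun a => (hR1 a).trans (localDomain_subset_target a))
    hcov hq0 hqt hu.1 fun a _ => ?_
  have hK := isCompact_closedBall (chartAt (Fin n → ℂ) a a) (2 * R a)
  have hK2 := hR' (c := 2) a (by norm_num)
  obtain ⟨C, hC0, hC⟩ := exists_ae_deriv_sq_div_le hw hK hK2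
  have hE : ∫⁻ y in Metric.closedBall (chartAt (Fin n → ℂ) a a) (2 * R a),
      -- The integrand is dominated by a multiple of `f_w + |w|`, which is integrable on `X` and
      -- therefore on the coordinate ball for Lebesgue measure.
      ENNReal.ofReal (‖derivCLM h w (weakDerivative h w) a y‖ ^ 2 /
        (1 + ‖matVec (localMatrix r a ((chartAt (Fin n → ℂ) a).symm y)
          (w ((chartAt (Fin n → ℂ) a).symm y)))‖)) < ⊤ := by
    refine lt_of_le_of_lt (lintegral_mono_ae ?_) (lintegral_chart_lt_top g hK
      (hK2.trans (localDomain_subset_target a))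
      (hint.const_mul C).1.aemeasurable.ennreal_ofReal
      (hint.const_mul C).lintegral_lt_top)
    filter_upwards [(ae_restrict_iff' hK.measurableSet).2 hC] with y hy
    exact ENNReal.ofReal_le_ofReal hy
  have main := ((weakDerivative_spec hw.2.2.1).hasWeakFDerivOn a).eLpNorm_lt_top_of_lintegral
    (hR a).1 (hR a).2 hE (s := Real.toNNReal s) (q := q)
    (by rwa [← NNReal.coe_le_coe, Real.coe_toNNReal _ (by linarith), NNReal.coe_one])
    (by rwa [← NNReal.coe_le_coe, Real.coe_toNNReal _ (by linarith), NNReal.coe_ofNat])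
    (by
      rw [hfin, ← NNReal.coe_lt_coe, Real.coe_toNNReal _ (by linarith)]
      push_cast; exact hsn)
    (by
      rw [hfin, Real.coe_toNNReal _ (by linarith), hqval, inv_div]
      push_cast
      rw [← one_div, ← one_div]
      refine hsp.trans_eq ?_
      have : p ≠ 0 := by linarith
      field_simp)
  rw [hq]
  obtain ⟨C', _, hC'⟩ := exists_endNorm_comparison h
    (isCompact_closedBall (chartAt (Fin n → ℂ) a a) (R a)) (hR1 a)
  refine (eLpNorm_le_mul_eLpNorm_of_ae_le_mul (c := C') ?_ _).trans_lt
    (ENNReal.mul_lt_top ENNReal.ofReal_lt_top main)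
  filter_upwards [ae_restrict_mem Metric.isClosed_closedBall.measurableSet] with y hy
  rw [Real.norm_of_nonneg (endNorm_nonneg _ _ _)]
  exact (hC' y hy _).1

end HermBundle

/-! ### The inclusions and the conclusion -/

namespace HermBundle

variable {n r : ℕ} {X : Type*} [TopologicalSpace X] [ChartedSpace (Fin n → ℂ) X]
  {E : X → Type*} [∀ x, AddCommGroup (E x)] [∀ x, Module ℂ (E x)] [∀ x, TopologicalSpace (E x)]
  [TopologicalSpace (TotalSpace (Fin r → ℂ) E)] [FiberBundle (Fin r → ℂ) E]
  [VectorBundle ℂ (Fin r → ℂ) E]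
  [IsManifold 𝓘(ℂ, Fin n → ℂ) ω X]
  [MeasurableSpace X] [BorelSpace X] [CompactSpace X] [T2Space X]
  {g : HermitianMetric n n (HolTangent n X)} {h : HermitianMetric n r E}

/-- Once `w ∈ L^{p*}`, Hölder bounds `Dw` in `L^p`, and `p ≤ p*` with finite volume puts `w` itself
in `L^p`. No bootstrap is needed. -/
theorem mem_sobolevSpace_of_finiteEnergy {w : EndSection E} (hw : w ∈ finiteEnergy g h)
    {p s : ℝ} (hp1 : 1 ≤ p) (hp2 : p < 2) (hs1 : 1 ≤ s) (hs2 : s ≤ 2) (hsn : s < 2 * n)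
    (hsp : 1 / s - 1 / (2 * n) ≤ 1 / p - 1 / 2) : w ∈ sobolevSpace g h (ENNReal.ofReal p) := by
  have he := integrable_of_donaldson_lt_top hw.2
  have hL := lpNorm_lt_top hw.1 he hp1 hp2 hs1 hs2 hsn hsp
  have hfin := isFiniteMeasure_kahlerVolume g
  have hu := hw.1.2.2.2.1
  refine ⟨hw.1.1, hw.1.2.1, hw.1.2.2.1,
    (MemLp.mono_exponent ⟨hu.1, hL⟩ (le_conj_exponent hp1)), hw.1.2.2.2.2.1, ?_⟩
  refine (eLpNorm_formNorm_le hw.1 he hp1 hp2.le).trans_lt ?_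
  refine ENNReal.add_lt_top.2 ⟨ENNReal.add_lt_top.2 ⟨?_, ?_⟩, ?_⟩
  · exact ENNReal.mul_lt_top (by simp) (by simp [measure_lt_top])
  · exact ENNReal.mul_lt_top (by simp) hL
  · exact (memLp_one_iff_integrable.2 he).2

end HermBundle

theorem proposition4p1 (n r : ℕ)
    {X : Type*} [TopologicalSpace X] [CompactSpace X] [T2Space X]
    [MeasurableSpace X] [BorelSpace X]
    [ChartedSpace (Fin n → ℂ) X] [IsManifold 𝓘(ℂ, Fin n → ℂ) ω X]
    {E : X → Type*} [∀ x, AddCommGroup (E x)] [∀ x, Module ℂ (E x)] [∀ x, TopologicalSpace (E x)]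
    [TopologicalSpace (TotalSpace (Fin r → ℂ) E)] [FiberBundle (Fin r → ℂ) E]
    [VectorBundle ℂ (Fin r → ℂ) E]
    [ContMDiffVectorBundle ω (Fin r → ℂ) E 𝓘(ℂ, Fin n → ℂ)]
    (g : HermBundle.HermitianMetric n n (HermBundle.HolTangent n X))
    (hg : HermBundle.IsKahler g)
    (h₀ : HermBundle.HermitianMetric n r E) :
    (∃ C₁ C₂ : ℝ, 0 < C₁ ∧ 0 < C₂ ∧
      ∀ p : ℝ, 1 < p → p ≤ 2 * n / (2 * n - 1) →
        ∀ w ∈ HermBundle.sobolevSpace g h₀ (ENNReal.ofReal p),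
          (HermBundle.sobolevNorm g h₀ (ENNReal.ofReal p) w : EReal) ≤
            (C₁ : EReal) * HermBundle.donaldson g h₀ w +
              (C₂ : EReal) *
                ((HermBundle.lpNorm g h₀ (ENNReal.ofReal p / ENNReal.ofReal (2 - p)) w : EReal)
                  + 1)) ∧
    (2 ≤ n → HermBundle.finiteEnergy g h₀ ⊆
      HermBundle.sobolevSpace g h₀ (ENNReal.ofReal (2 * n / (2 * n - 1)))) ∧
    (n = 1 → ∀ p : ℝ, 1 < p → p < 2 →
      HermBundle.finiteEnergy g h₀ ⊆ HermBundle.sobolevSpace g h₀ (ENNReal.ofReal p)) := by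
  refine ⟨?_, fun hn w hw => ?_, fun hn p hp1 hp2 w hw => ?_⟩
  · obtain ⟨C₁, C₂, h1, h2, h⟩ := HermBundle.exists_sobolevNorm_le g h₀
    refine ⟨C₁, C₂, h1, h2, fun p hp hp' w hw => h p hp.le ?_ w hw⟩
    -- For `n = 0` the quotient `2n/(2n-1)` is `0`, so no `p > 1` is admitted; for `n ≥ 1` it is at
    -- most `2`.
    rcases Nat.eq_zero_or_pos n with rfl | hn
    · norm_num at hp'
      linarith
    · have hn' : (1 : ℝ) ≤ n := by exact_mod_cast hn
      refine hp'.trans ?_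
      rw [div_le_iff₀ (by linarith)]
      linarith
  · have hn' : (2 : ℝ) ≤ n := by exact_mod_cast hn
    have hpos : (0 : ℝ) < 2 * n - 1 := by linarith
    -- With `n ≥ 2` the natural exponent `s = 2` is below the real dimension `2n`, and `p =
    -- 2n/(2n-1)` turns the Sobolev condition into an equality.
    refine HermBundle.mem_sobolevSpace_of_finiteEnergy hw (s := 2) ?_ ?_ (by norm_num) le_rfl
      (by linarith) (le_of_eq ?_)
    · rw [le_div_iff₀ hpos]; linarith
    · rw [div_lt_iff₀ hpos]; linarith
    · have : (n : ℝ) ≠ 0 := by linarith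
      field_simp
      ring
  · subst hn
    -- With `n = 1` the exponent `2` equals the real dimension and is excluded; `s = p < 2` again
    -- gives equality in the Sobolev condition.
    refine HermBundle.mem_sobolevSpace_of_finiteEnergy hw (s := p) hp1.le hp2 hp1.le hp2.le ?_ ?_
    · simpa using hp2
    · simp
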